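/- All knots and diagrams are oriented. A virtual knot diagram is a generic immersed closed curve in the plane (equivalently, the sphere) whose double points are real crossings (with over/under information, hence of writhe $w=\pm1$) or virtual crossings; virtual knots are the equivalence classes of such diagrams under the generalized Reidemeister moves $\Omega_1,\Omega_2,\Omega_3,\Omega_1',\Omega_2',\Omega_3',\Omega_3^s$. A diagram is classical if it has no virtual crossing, and a virtual knot is classical if it has a classical diagram. In the Gauss diagram, each real crossing is a chord of the counterclockwise oriented circle, directed from the over- to the under-passage and signed by its writhe. For a chord $c$ let $r_\pm(c)$ (respectively $l_\pm(c)$) be the number of $\pm$-chords crossing $c$ from left to right (respectively from right to left), put $\mathrm{Ind}(c)=r_+(c)-r_-(c)-l_+(c)+l_-(c)$, and let the writhe polynomial be $$W_D(t)=\sum_{\mathrm{Ind}(c)\neq 0} w(c)\,t^{\mathrm{Ind}(c)}.$$ The virtualization of a diagram at a real crossing $c$ is obtained by replacing $c$, inside a small disc, by the real crossing of opposite sign flanked by two virtual crossings, so that the four ends of the two strands are connected as before and the over-strand remains the over-strand (the flanking crossings may be placed on either pair of opposite sides of $c$). **Proposition.** Let $K$ be a classical knot diagram all of whose crossings are positive,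 or all of whose crossings are negative, and suppose that $K$ has unknotting number $1$, i.e. the least number of crossings of $K$ that have to be switched in order to obtain a diagram of the trivial knot is $1$. Then $K$ has a crossing whose switching yields a diagram of the trivial knot, and for every such crossing $c$ the virtualization $v(K)$ of $K$ at $c$ represents a non-classical virtual knot. Moreover $$W_{v(K)}(t)=a\,t^{2}+a\,t^{-2},\qquad a=r_+(c)-r_-(c)\neq 0,$$ where $r_\pm(c)$ is computed in $K$; thus $|a|$ is the number of chords of $K$ that cross $c$ from left to right, and $a$ has the sign of the crossings of $K$. -/

import Mathlib

open scoped LaurentPolynomial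

namespace VirtualKnot

/-! ## Words of passages

Traversing an oriented virtual knot diagram once produces a cyclic word of passages through its
crossings; every crossing is passed exactly twice. -/

/-- A crossing is real with writhe `+1`, real with writhe `-1`, or virtual. -/
inductive CrossingType
  | positive
  | negative
  | virt
  deriving DecidableEq

/-- The type of a crossing after exchanging over and under (equivalently, the other sign). -/
def CrossingType.flip : CrossingType → CrossingType
  | .positive => .negative
  | .negative => .positive
  | .virt => .virt

/-- One passage of the knot through a crossing. `ltr = true` means that the strand being followed
crosses the other strand of that crossing from its left side to its right side. -/
structure Passage where
  label : ℕ
  ltr : Bool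
  type : CrossingType
  deriving DecidableEq

/-- The other passage through the same crossing. -/
def Passage.mate (p : Passage) : Passage := { p with ltr := !p.ltr }

/-- The passage runs over a real crossing: at a positive crossing the over-strand crosses the
under-strand from left to right, at a negative crossing from right to left. -/
def Passage.IsOver (p : Passage) : Prop :=
  (p.type = .positive ∧ p.ltr = true) ∨ (p.type = .negative ∧ p.ltr = false)

instance : DecidablePred Passage.IsOver := fun p => by unfold Passage.IsOver; infer_instance

/-- The underlying immersed curve: crossing labels and crossing directions only. -/
def keys (w : List Passage) : List (ℕ × Bool) := w.map fun p => (p.label, p.ltr)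

/-- Every crossing that occurs is passed exactly twice, once in each direction, and the two
passages agree about the type of the crossing. -/
def IsWord (w : List Passage) : Prop := (keys w).Nodup ∧ ∀ p ∈ w, p.mate ∈ w

/-! ## Planarity

The four-valent graph of the word is thickened to a closed oriented surface by gluing a disc along
every boundary component. The diagram can be drawn on the sphere if and only if this connected
surface has Euler characteristic `2`. -/

inductive Side
  | left
  | right
  deriving DecidableEq

/-- The edges of the graph are named by the passage at which they start: the edge `e` leaves the
crossing after the passage `e`. `pre e` is the edge that runs into the passage `e`. -/
def pre (u : List (ℕ × Bool)) (e : {e // e ∈ u}) : {e // e ∈ u} :=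
  ⟨u.prev e.1 e.2, List.prev_mem _ _ e.2⟩

/-- Sides of edges that meet in one of the four corners at a crossing. Place the strand `j`, which
crosses from left to right, along the `x`-axis, and the other strand `k` along the `y`-axis. -/
inductive Corner (u : List (ℕ × Bool)) :
    {e // e ∈ u} × Side → {e // e ∈ u} × Side → Prop
  | northEast (x : ℕ) (j k : {e // e ∈ u}) (hj : j.1 = (x, true)) (hk : k.1 = (x, false)) :
      Corner u (j, .left) (k, .right)
  | northWest (x : ℕ) (j k : {e // e ∈ u}) (hj : j.1 = (x, true)) (hk : k.1 = (x, false)) :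
      Corner u (pre u j, .left) (k, .left)
  | southWest (x : ℕ) (j k : {e // e ∈ u}) (hj : j.1 = (x, true)) (hk : k.1 = (x, false)) :
      Corner u (pre u j, .right) (pre u k, .left)
  | southEast (x : ℕ) (j k : {e // e ∈ u}) (hj : j.1 = (x, true)) (hk : k.1 = (x, false)) :
      Corner u (j, .right) (pre u k, .right)

/-- The faces: sides of edges, glued around the corners. -/
def Face (u : List (ℕ × Bool)) : Type := Quot (Corner u)

/-- Vertices minus edges plus faces (for a word with at least one crossing). -/
noncomputable def eulerChar (u : List (ℕ × Bool)) : ℤ :=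
  ((u.length / 2 : ℕ) : ℤ) - (u.length : ℤ) + (Nat.card (Face u) : ℤ)

/-- Planarity. The Euler characteristic of a closed connected surface is at most `2`, so that
`2 ≤ eulerChar u` says that it is equal to `2`. The empty word is the round circle. -/
def Planar (u : List (ℕ × Bool)) : Prop := u = [] ∨ 2 ≤ eulerChar u

/-- An oriented virtual knot diagram on the sphere, up to isotopy of the sphere, with labelled
crossings and a base point on the curve. -/
structure Diagram where
  word : List Passage
  isWord : IsWord word
  planar : Planar (keys word)

/-! ## Generalized Reidemeister moves -/

/-- The levels of three strands `1, 2, 3` that form a triangle, the crossings `12`, `23`, `31`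
having the types `t₁₂, t₂₃, t₃₁`, where `bᵢⱼ` tells whether strand `i` crosses strand `j` from left
to right. Either all crossings are real and neither `1` over `2` over `3` over `1` nor its reverse
occurs (so that there is a top, a middle and a bottom strand), or one strand meets both others in virtual crossings. -/
def TriangleAllowed (t₁₂ t₂₃ t₃₁ : CrossingType) (b₁₂ b₂₃ b₃₁ : Bool) : Prop :=
  (t₁₂ ≠ .virt ∧ t₂₃ ≠ .virt ∧ t₃₁ ≠ .virt ∧
    ¬ ((Passage.mk 0 b₁₂ t₁₂).IsOver ∧ (Passage.mk 0 b₂₃ t₂₃).IsOver ∧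
        (Passage.mk 0 b₃₁ t₃₁).IsOver) ∧
    ¬ (¬ (Passage.mk 0 b₁₂ t₁₂).IsOver ∧ ¬ (Passage.mk 0 b₂₃ t₂₃).IsOver ∧
        ¬ (Passage.mk 0 b₃₁ t₃₁).IsOver)) ∨
  (t₁₂ = .virt ∧ t₃₁ = .virt) ∨ (t₁₂ = .virt ∧ t₂₃ = .virt) ∨ (t₂₃ = .virt ∧ t₃₁ = .virt)

/-- Two passages in the order `p, q` if `b` holds, else in the order `q, p`. -/
def inOrder (b : Bool) (p q : Passage) : List Passage := if b then [p, q] else [q, p]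

/-- Change of labelling and base point, and the moves `Ω₁, Ω₁', Ω₂, Ω₂', Ω₃, Ω₃', Ω₃ˢ`. -/
inductive Step : List Passage → List Passage → Prop
  | relabel (σ : Equiv.Perm ℕ) (w : List Passage) :
      Step w (w.map fun p => { p with label := σ p.label })
  | basePoint (A B : List Passage) : Step (A ++ B) (B ++ A)
  /-- A curl, with a real or a virtual crossing. -/
  | omega1 (A B : List Passage) (x : ℕ) (b : Bool) (t : CrossingType) :
      Step (A ++ B) (A ++ [⟨x, b, t⟩, ⟨x, !b, t⟩] ++ B)
  /-- A bigon between two strands that run in the same direction (`d = true`) or in opposite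
  directions (`d = false`): two virtual crossings, or two real crossings of opposite sign. -/
  | omega2 (A B C : List Passage) (x y : ℕ) (b d : Bool) (t : CrossingType) :
      Step (A ++ B ++ C)
        (A ++ [⟨x, b, t⟩, ⟨y, !b, t.flip⟩] ++ B ++
          inOrder d ⟨x, !b, t⟩ ⟨y, b, t.flip⟩ ++ C)
  /-- A strand is pushed across a crossing. The strands `1, 2, 3` bound a triangle, and the move
  reverses the order of the two crossings on each of them. Of the eight possible orders, the two
  with `ε = true` and `ε = false` are those that occur at a triangle of three oriented lines with
  the given crossing directions. -/
  | omega3 (A B C D : List Passage) (x y z : ℕ) (b₁₂ b₂₃ b₃₁ ε : Bool)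
      (t₁₂ t₂₃ t₃₁ : CrossingType) (h : TriangleAllowed t₁₂ t₂₃ t₃₁ b₁₂ b₂₃ b₃₁) :
      Step
        (A ++ inOrder ((b₁₂ == b₃₁) == ε) ⟨x, b₁₂, t₁₂⟩ ⟨z, !b₃₁, t₃₁⟩ ++
          B ++ inOrder ((b₂₃ == b₁₂) == ε) ⟨y, b₂₃, t₂₃⟩ ⟨x, !b₁₂, t₁₂⟩ ++
          C ++ inOrder ((b₃₁ == b₂₃) == ε) ⟨z, b₃₁, t₃₁⟩ ⟨y, !b₂₃, t₂₃⟩ ++ D)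
        (A ++ inOrder ((b₁₂ == b₃₁) == !ε) ⟨x, b₁₂, t₁₂⟩ ⟨z, !b₃₁, t₃₁⟩ ++
          B ++ inOrder ((b₂₃ == b₁₂) == !ε) ⟨y, b₂₃, t₂₃⟩ ⟨x, !b₁₂, t₁₂⟩ ++
          C ++ inOrder ((b₃₁ == b₂₃) == !ε) ⟨z, b₃₁, t₃₁⟩ ⟨y, !b₂₃, t₂₃⟩ ++ D)

namespace Diagram

/-- Equivalence of virtual knot diagrams: a finite sequence of generalized Reidemeister moves. -/
def VirtuallyEquivalent : Diagram → Diagram → Prop :=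
  Relation.EqvGen fun D E => Step D.word E.word

/-- A classical knot diagram has no virtual crossings. -/
def IsClassical (D : Diagram) : Prop := ∀ p ∈ D.word, p.type ≠ .virt

/-- Equivalence of classical knot diagrams: a finite sequence of Reidemeister moves through
classical diagrams. -/
def ClassicallyEquivalent : Diagram → Diagram → Prop :=
  Relation.EqvGen fun D E => D.IsClassical ∧ E.IsClassical ∧ Step D.word E.word

/-- The virtual knot represented by the diagram is not classical. -/
def IsNonClassical (D : Diagram) : Prop :=
  ∀ E : Diagram, E.IsClassical → ¬ D.VirtuallyEquivalent E

/-- The diagram without crossings. -/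
def unknot : Diagram where
  word := []
  isWord := ⟨List.nodup_nil, by simp⟩
  planar := Or.inl rfl

def IsPositive (D : Diagram) : Prop := ∀ p ∈ D.word, p.type = .positive

def IsNegative (D : Diagram) : Prop := ∀ p ∈ D.word, p.type = .negative

/-- The real crossings, that is, the chords of the Gauss diagram. The chord `c` is directed from
its tail, the over-passage `c`, to its head, the under-passage `c.mate`. -/
def chords (D : Diagram) : Finset Passage := (D.word.filter fun p => p.IsOver).toFinset

/-! ### The writhe polynomial -/

/-- The passages met strictly between the passages `a` and `b` when one starts at `a`. -/
def arc (D : Diagram) (a b : Passage) : List Passage :=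
  (D.word.rotate (D.word.idxOf a)).tail.takeWhile fun p => p ≠ b

/-- The arc of the (counterclockwise) circle of the Gauss diagram to the left of the chord `c`. -/
def leftArc (D : Diagram) (c : Passage) : List Passage := D.arc c.mate c

/-- The arc of the circle to the right of the chord `c`. -/
def rightArc (D : Diagram) (c : Passage) : List Passage := D.arc c c.mate

/-- The number of chords of type `s` that cross `c` from left to right. -/
def r (D : Diagram) (s : CrossingType) (c : Passage) : ℕ :=
  (D.chords.filter fun d => d.type = s ∧ d ∈ D.leftArc c ∧ d.mate ∈ D.rightArc c).card

/-- The number of chords of type `s` that cross `c` from right to left. -/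
def l (D : Diagram) (s : CrossingType) (c : Passage) : ℕ :=
  (D.chords.filter fun d => d.type = s ∧ d ∈ D.rightArc c ∧ d.mate ∈ D.leftArc c).card

/-- The index of a chord. -/
def index (D : Diagram) (c : Passage) : ℤ :=
  (D.r .positive c : ℤ) - D.r .negative c - D.l .positive c + D.l .negative c

/-- The sign of a chord. -/
def sign (c : Passage) : ℤ := if c.type = .positive then 1 else -1

/-- The writhe polynomial `W(t)`; `T n` stands for the monomial `t ^ n`. -/
noncomputable def writhePolynomial (D : Diagram) : ℤ[T;T⁻¹] :=
  ∑ c ∈ D.chords with D.index c ≠ 0, LaurentPolynomial.C (sign c) * LaurentPolynomial.T (D.index c)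

end Diagram

/-! ### Switching crossings -/

/-- Exchange over and under at the crossings with labels in `S`. -/
def switchWord (S : Finset ℕ) (w : List Passage) : List Passage :=
  w.map fun p => if p.label ∈ S then { p with type := p.type.flip } else p

theorem keys_switchWord (S : Finset ℕ) (w : List Passage) : keys (switchWord S w) = keys w := by
  simp only [keys, switchWord, List.map_map]
  refine List.map_congr_left fun p _ => ?_
  by_cases h : p.label ∈ S <;> simp [h]

theorem isWord_switchWord (S : Finset ℕ) {w : List Passage} (h : IsWord w) :
    IsWord (switchWord S w) := by
  refine ⟨by rw [keys_switchWord]; exact h.1, fun p hp => ?_⟩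
  obtain ⟨q, hq, rfl⟩ := List.mem_map.1 hp
  refine List.mem_map.2 ⟨q.mate, h.2 q hq, ?_⟩
  by_cases h : q.label ∈ S <;> simp [h, Passage.mate]

namespace Diagram

/-- Switch the real crossings `c ∈ S`. -/
def switch (D : Diagram) (S : Finset Passage) : Diagram where
  word := switchWord (S.image Passage.label) D.word
  isWord := isWord_switchWord _ D.isWord
  planar := by rw [keys_switchWord]; exact D.planar

/-- A classical diagram of the trivial knot. -/
def IsTrivial (D : Diagram) : Prop := D.ClassicallyEquivalent unknot

/-- The least number of crossings of the diagram whose switching yields the trivial knot. -/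
noncomputable def unknottingNumber (D : Diagram) : ℕ :=
  sInf {n | ∃ S ⊆ D.chords, S.card = n ∧ (D.switch S).IsTrivial}

/-- Switching the single crossing `c` yields the trivial knot. -/
def IsUnknottingCrossing (D : Diagram) (c : Passage) : Prop :=
  c ∈ D.chords ∧ (D.switch {c}).IsTrivial

end Diagram

/-! ### Virtualization -/

/-- The local replacement of a crossing `c` (see `Diagram.virtualize`) on one passage. The labels
`n` and `n + 1` are those of the new virtual crossings. -/
def virtualizePassage (c n : ℕ) (anti : Bool) (p : Passage) : List Passage :=
  if p.label = c then
    if anti && !p.ltr then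
      [⟨n + 1, p.ltr, .virt⟩, ⟨c, !p.ltr, p.type.flip⟩, ⟨n, p.ltr, .virt⟩]
    else
      [⟨n, p.ltr, .virt⟩, ⟨c, !p.ltr, p.type.flip⟩, ⟨n + 1, p.ltr, .virt⟩]
  else [p]

/-- A label that is larger than all labels of the word. -/
def freshLabel (w : List Passage) : ℕ := (w.map Passage.label).sum + 1

def virtualizeWord (c : ℕ) (anti : Bool) (w : List Passage) : List Passage :=
  w.flatMap (virtualizePassage c (freshLabel w) anti)


/-! The virtualized word is again a planar word. -/

theorem prev_eq_of_isRotated {α : Type*} [DecidableEq α] {V X Y : List α} {a b : α}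
    (hV : V.Nodup) (h : V ~r X ++ a :: b :: Y) (hb : b ∈ V) : V.prev b hb = a := by
  have h2 : V ~r a :: b :: (Y ++ X) := h.trans (by
    simpa using (List.isRotated_append (l := X) (l' := a :: b :: Y)))
  rw [List.isRotated_prev_eq h2 hV hb]
  have hn : (a :: b :: (Y ++ X)).Nodup := (h2.nodup_iff).1 hV
  have hne : b ≠ a := by
    rintro rfl
    simp at hn
  exact List.prev_cons_cons_of_ne _ _ _ _ hne

theorem isRotated_prev {α : Type*} [DecidableEq α] {u : List α} {e e' : α} (hu : u.Nodup)
    (he : e ∈ u) (he' : e' ∈ u) (hne : e' ≠ e) : ∃ R, u ~r u.prev e he :: e :: R := by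
  obtain ⟨A, B, rfl⟩ := List.append_of_mem he
  have h1 : (A ++ e :: B) ~r e :: (B ++ A) := by
    simpa using (List.isRotated_append (l := A) (l' := e :: B))
  have hBA : B ++ A ≠ [] := by
    intro h0
    have := (h1.mem_iff).1 he'
    rw [h0] at this
    simp [hne] at this
  obtain ⟨t, a, hta⟩ : ∃ t a, B ++ A = t ++ [a] :=
    ⟨_, _, (List.dropLast_append_getLast hBA).symm⟩
  have h2 : (A ++ e :: B) ~r a :: e :: t := by
    refine h1.trans ?_
    rw [hta]
    simpa using (List.isRotated_append (l := e :: t) (l' := [a]))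
  refine ⟨t, ?_⟩
  rw [prev_eq_of_isRotated (X := []) (Y := t) hu h2 he]
  exact h2

theorem isRotated_flatMap {α β : Type*} {u v : List α} (h : u ~r v) (f : α → List β) :
    u.flatMap f ~r v.flatMap f := by
  obtain ⟨n, rfl⟩ := h
  rw [List.rotate_eq_drop_append_take_mod]
  conv_lhs => rw [← List.take_append_drop (n % u.length) u]
  rw [List.flatMap_append, List.flatMap_append]
  exact List.isRotated_append

/-- The effect of `virtualizePassage` on keys. -/
def virtualizeKey (c n : ℕ) (anti : Bool) (e : ℕ × Bool) : List (ℕ × Bool) :=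
  if e.1 = c then
    if anti && !e.2 then [(n + 1, e.2), (c, !e.2), (n, e.2)]
    else [(n, e.2), (c, !e.2), (n + 1, e.2)]
  else [e]

theorem keys_virtualizeWord (c n : ℕ) (anti : Bool) (w : List Passage) :
    keys (w.flatMap (virtualizePassage c n anti)) =
      (keys w).flatMap (virtualizeKey c n anti) := by
  simp only [keys, List.map_flatMap, List.flatMap_map]
  congr 1
  funext p
  unfold virtualizePassage virtualizeKey
  split_ifs <;> simp_all

theorem label_lt_freshLabel {w : List Passage} {p : Passage} (hp : p ∈ w) :
    p.label < freshLabel w :=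
  Nat.lt_succ_of_le (List.le_sum_of_mem (List.mem_map_of_mem hp))

theorem mem_virtualizeKey {c n : ℕ} {anti : Bool} {u : List (ℕ × Bool)} {e : ℕ × Bool} :
    e ∈ u.flatMap (virtualizeKey c n anti) ↔
      (e ∈ u ∧ e.1 ≠ c) ∨ (e.1 = n ∧ (c, e.2) ∈ u) ∨ (e.1 = c ∧ (c, !e.2) ∈ u) ∨
        (e.1 = n + 1 ∧ (c, e.2) ∈ u) := by
  obtain ⟨x, b⟩ := e
  simp only [List.mem_flatMap, virtualizeKey]
  constructor
  · rintro ⟨⟨y, d⟩, hy, h⟩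
    dsimp only at h
    split_ifs at h with h1 h2
    · subst h1; simp at h; rcases h with ⟨rfl, rfl⟩ | ⟨rfl, rfl⟩ | ⟨rfl, rfl⟩ <;> simp [hy]
    · subst h1; simp at h; rcases h with ⟨rfl, rfl⟩ | ⟨rfl, rfl⟩ | ⟨rfl, rfl⟩ <;> simp [hy]
    · simp at h; obtain ⟨rfl, rfl⟩ := h; exact Or.inl ⟨hy, h1⟩
  · rintro (⟨h, h1⟩ | ⟨rfl, h⟩ | ⟨rfl, h⟩ | ⟨rfl, h⟩)
    · exact ⟨_, h, by simp_all⟩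
    · refine ⟨_, h, ?_⟩; split_ifs <;> simp_all
    · refine ⟨_, h, ?_⟩; split_ifs <;> simp_all
    · refine ⟨_, h, ?_⟩; split_ifs <;> simp_all

theorem nodup_virtualizeKey {c n : ℕ} (anti : Bool) {u : List (ℕ × Bool)} (hu : u.Nodup)
    (hn : ∀ e ∈ u, e.1 < n) (hc : c < n) : (u.flatMap (virtualizeKey c n anti)).Nodup := by
  rw [List.nodup_flatMap]
  constructor
  · rintro ⟨x, b⟩ _
    unfold virtualizeKey
    split_ifs <;> simp
  · refine List.Pairwise.imp_of_mem ?_ hu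
    rintro ⟨x, b⟩ ⟨y, d⟩ hx hy hne
    have h1 := hn _ hx
    have h2 := hn _ hy
    have hne' : ¬ (x = y ∧ b = d) := by simpa using hne
    rw [Function.onFun, List.disjoint_left]
    rintro ⟨z, e⟩ h3 h4
    unfold virtualizeKey at h3 h4
    dsimp only at h1 h2 h3 h4
    split_ifs at h3 h4 <;> simp at h3 h4 <;> cases b <;> cases d <;> cases e <;> grind

section Faces

variable {c n : ℕ} {anti : Bool} {u : List (ℕ × Bool)}

/-- The first passage of the replacement of `e`. -/
def entryKey (c n : ℕ) (anti : Bool) (e : ℕ × Bool) : ℕ × Bool :=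
  if e.1 = c then (if anti && !e.2 then (n + 1, e.2) else (n, e.2)) else e

/-- The last passage of the replacement of `e`. -/
def exitKey (c n : ℕ) (anti : Bool) (e : ℕ × Bool) : ℕ × Bool :=
  if e.1 = c then (if anti && !e.2 then (n, e.2) else (n + 1, e.2)) else e

theorem virtualizeKey_eq_entry (e : ℕ × Bool) :
    ∃ Y, virtualizeKey c n anti e = entryKey c n anti e :: Y := by
  unfold virtualizeKey entryKey
  split_ifs <;> exact ⟨_, rfl⟩

theorem virtualizeKey_eq_exit (e : ℕ × Bool) :
    ∃ X, virtualizeKey c n anti e = X ++ [exitKey c n anti e] := by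
  unfold virtualizeKey exitKey
  split_ifs
  · exact ⟨[_, _], rfl⟩
  · exact ⟨[_, _], rfl⟩
  · exact ⟨[], rfl⟩

theorem virtualizeKey_label (b : Bool) :
    virtualizeKey c n anti (c, b) =
      [entryKey c n anti (c, b), (c, !b), exitKey c n anti (c, b)] := by
  unfold virtualizeKey entryKey exitKey
  simp only [if_true]
  split_ifs <;> rfl

theorem prev_entryKey (hu : u.Nodup) (hV : (u.flatMap (virtualizeKey c n anti)).Nodup)
    {e e' : ℕ × Bool} (he : e ∈ u) (he' : e' ∈ u) (hne : e' ≠ e)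
    (h : entryKey c n anti e ∈ u.flatMap (virtualizeKey c n anti)) :
    (u.flatMap (virtualizeKey c n anti)).prev (entryKey c n anti e) h =
      exitKey c n anti (u.prev e he) := by
  obtain ⟨R, hR⟩ := isRotated_prev hu he he' hne
  have h1 := isRotated_flatMap hR (virtualizeKey c n anti)
  obtain ⟨X, hX⟩ := virtualizeKey_eq_exit (c := c) (n := n) (anti := anti) (u.prev e he)
  obtain ⟨Y, hY⟩ := virtualizeKey_eq_entry (c := c) (n := n) (anti := anti) e
  refine prev_eq_of_isRotated (X := X) (Y := Y ++ R.flatMap (virtualizeKey c n anti)) hV ?_ h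
  simpa [List.flatMap_cons, hX, hY] using h1

theorem prev_midKey (hV : (u.flatMap (virtualizeKey c n anti)).Nodup)
    {b : Bool} (hb : (c, b) ∈ u) (h : (c, !b) ∈ u.flatMap (virtualizeKey c n anti)) :
    (u.flatMap (virtualizeKey c n anti)).prev (c, !b) h = entryKey c n anti (c, b) := by
  obtain ⟨A, B, rfl⟩ := List.append_of_mem hb
  refine prev_eq_of_isRotated (X := A.flatMap (virtualizeKey c n anti))
    (Y := exitKey c n anti (c, b) :: B.flatMap (virtualizeKey c n anti)) hV ?_ h
  simp only [List.flatMap_append, List.flatMap_cons, virtualizeKey_label, List.append_assoc,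
    List.cons_append, List.nil_append]
  exact List.IsRotated.refl _

theorem prev_exitKey (hV : (u.flatMap (virtualizeKey c n anti)).Nodup)
    {b : Bool} (hb : (c, b) ∈ u)
    (h : exitKey c n anti (c, b) ∈ u.flatMap (virtualizeKey c n anti)) :
    (u.flatMap (virtualizeKey c n anti)).prev (exitKey c n anti (c, b)) h = (c, !b) := by
  obtain ⟨A, B, rfl⟩ := List.append_of_mem hb
  refine prev_eq_of_isRotated
    (X := A.flatMap (virtualizeKey c n anti) ++ [entryKey c n anti (c, b)])
    (Y := B.flatMap (virtualizeKey c n anti)) hV ?_ h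
  simp only [List.flatMap_append, List.flatMap_cons, virtualizeKey_label, List.append_assoc,
    List.cons_append, List.nil_append]
  exact List.IsRotated.refl _

open Classical in
/-- The side of an edge of the virtualized word lies in a face of the original word, or in one of
the two new bigons. -/
noncomputable def faceOf (c n : ℕ) (anti : Bool) (P Q : {e // e ∈ u}) (k : ℕ × Bool) (s : Side) :
    Face u ⊕ Bool :=
  if k = entryKey c n anti (c, true) then
    if anti then (match s with | .left => .inl (Quot.mk _ (P, .left)) | .right => .inr false)
    else (match s with | .left => .inr false | .right => .inl (Quot.mk _ (P, .right)))
  else if k = (c, false) then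
    if anti then (match s with | .left => .inr true | .right => .inl (Quot.mk _ (pre u P, .right)))
    else (match s with | .left => .inl (Quot.mk _ (Q, .left)) | .right => .inr true)
  else if k = entryKey c n anti (c, false) then
    if anti then (match s with | .left => .inr true | .right => .inl (Quot.mk _ (Q, .right)))
    else (match s with | .left => .inl (Quot.mk _ (Q, .left)) | .right => .inr false)
  else if k = (c, true) then
    if anti then (match s with | .left => .inl (Quot.mk _ (pre u P, .right)) | .right => .inr false)
    else (match s with | .left => .inr true | .right => .inl (Quot.mk _ (P, .right)))
  else if k = exitKey c n anti (c, true) then .inl (Quot.mk _ (P, s))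
  else if k = exitKey c n anti (c, false) then .inl (Quot.mk _ (Q, s))
  else if h : k ∈ u then .inl (Quot.mk _ (⟨k, h⟩, s)) else .inr true

theorem faceOf_exitKey (hn : ∀ e ∈ u, e.1 < n) {P Q : {e // e ∈ u}} (hP : P.1 = (c, true))
    (hQ : Q.1 = (c, false)) (e : {e // e ∈ u}) (s : Side) :
    faceOf c n anti P Q (exitKey c n anti e.1) s = .inl (Quot.mk _ (e, s)) := by
  have hcn : c < n := by simpa [hP] using hn _ P.2
  obtain ⟨⟨x, b⟩, he⟩ := e
  obtain ⟨P, hP'⟩ := P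
  obtain ⟨Q, hQ'⟩ := Q
  dsimp only at hP hQ
  subst hP hQ
  have hx : x < n := hn _ he
  have e1 : c ≠ n := by omega
  have e2 : c ≠ n + 1 := by omega
  have e3 : x ≠ n := by omega
  have e4 : x ≠ n + 1 := by omega
  by_cases hxc : x = c
  · subst hxc
    cases b <;> cases anti <;> simp [faceOf, exitKey, entryKey, e1, e2, e1.symm, e2.symm]
  · cases anti <;> simp [faceOf, exitKey, entryKey, e1, e2, e3, e4, hxc, he]

theorem faceOf_corner (hu : u.Nodup) (hn : ∀ e ∈ u, e.1 < n)
    (hmate : ∀ x b, (x, b) ∈ u → (x, !b) ∈ u)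
    {P Q : {e // e ∈ u}} (hP : P.1 = (c, true)) (hQ : Q.1 = (c, false))
    {a b : {e // e ∈ u.flatMap (virtualizeKey c n anti)} × Side}
    (h : Corner (u.flatMap (virtualizeKey c n anti)) a b) :
    faceOf c n anti P Q a.1.1 a.2 = faceOf c n anti P Q b.1.1 b.2 := by
  have hcn : c < n := by simpa [hP] using hn _ P.2
  have hV := nodup_virtualizeKey anti hu hn hcn
  have e1 : c ≠ n := by omega
  have e2 : c ≠ n + 1 := by omega
  have hPm : (c, true) ∈ u := hP ▸ P.2
  have hQm : (c, false) ∈ u := hQ ▸ Q.2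
  have hNE : (Quot.mk _ (P, .left) : Face u) = Quot.mk _ (Q, .right) :=
    Quot.sound (.northEast c P Q hP hQ)
  have hNW : (Quot.mk _ (pre u P, .left) : Face u) = Quot.mk _ (Q, .left) :=
    Quot.sound (.northWest c P Q hP hQ)
  have hSW : (Quot.mk _ (pre u P, .right) : Face u) = Quot.mk _ (pre u Q, .left) :=
    Quot.sound (.southWest c P Q hP hQ)
  have hSE : (Quot.mk _ (P, .right) : Face u) = Quot.mk _ (pre u Q, .right) :=
    Quot.sound (.southEast c P Q hP hQ)
  -- the edges that run into the passages of the new word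
  have pentry : ∀ (e : {e // e ∈ u}) (s : Side)
      (h : entryKey c n anti e.1 ∈ u.flatMap (virtualizeKey c n anti)),
      faceOf c n anti P Q (pre (u.flatMap (virtualizeKey c n anti)) ⟨_, h⟩).1 s =
        .inl (Quot.mk _ (pre u e, s)) := by
    intro e s h
    have hm : (e.1.1, !e.1.2) ∈ u := hmate e.1.1 e.1.2 e.2
    have hne : (e.1.1, !e.1.2) ≠ e.1 := by
      intro h0
      have := congrArg Prod.snd h0
      simp at this
    have := prev_entryKey (c := c) (n := n) (anti := anti) hu hV e.2 hm hne h
    show faceOf c n anti P Q (List.prev _ _ _) s = _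
    rw [this]
    exact faceOf_exitKey hn hP hQ (pre u e) s
  have pmid : ∀ (b : Bool) (s : Side) (h : (c, b) ∈ u.flatMap (virtualizeKey c n anti)),
      faceOf c n anti P Q (pre (u.flatMap (virtualizeKey c n anti)) ⟨_, h⟩).1 s =
        faceOf c n anti P Q (entryKey c n anti (c, !b)) s := by
    intro b s h
    have hb : (c, !b) ∈ u := by cases b <;> assumption
    have := prev_midKey (n := n) (anti := anti) hV hb (by simpa using h)
    simp only [Bool.not_not] at this
    show faceOf c n anti P Q (List.prev _ _ _) s = _
    rw [this]
  have pexit : ∀ (b : Bool) (s : Side)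
      (h : exitKey c n anti (c, b) ∈ u.flatMap (virtualizeKey c n anti)),
      faceOf c n anti P Q (pre (u.flatMap (virtualizeKey c n anti)) ⟨_, h⟩).1 s =
        faceOf c n anti P Q (c, !b) s := by
    intro b s h
    have hb : (c, b) ∈ u := by cases b <;> assumption
    have := prev_exitKey (n := n) (anti := anti) hV hb h
    show faceOf c n anti P Q (List.prev _ _ _) s = _
    rw [this]
  have vexit := fun e s => faceOf_exitKey (anti := anti) hn hP hQ e s
  have key : ∀ (x : ℕ) (hj : (x, true) ∈ u.flatMap (virtualizeKey c n anti))
      (hk : (x, false) ∈ u.flatMap (virtualizeKey c n anti)),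
      faceOf c n anti P Q (x, true) .left = faceOf c n anti P Q (x, false) .right ∧
      faceOf c n anti P Q (pre _ ⟨_, hj⟩).1 .left = faceOf c n anti P Q (x, false) .left ∧
      faceOf c n anti P Q (pre _ ⟨_, hj⟩).1 .right =
        faceOf c n anti P Q (pre _ ⟨_, hk⟩).1 .left ∧
      faceOf c n anti P Q (x, true) .right = faceOf c n anti P Q (pre _ ⟨_, hk⟩).1 .right := by
    intro x hj hk
    have vP := vexit P
    have vQ := vexit Q
    have nP := pentry P
    have nQ := pentry Q
    have xP := pexit true
    have xQ := pexit false
    rw [hP] at vP nP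
    rw [hQ] at vQ nQ
    by_cases hxc : x = c
    · subst hxc
      rw [pmid _ _ hj, pmid _ _ hj, pmid _ _ hk, pmid _ _ hk]
      cases anti <;> simp [faceOf, entryKey, e1, e2, e1.symm, e2.symm, hNE, hSW]
    by_cases hxu : (x, true) ∈ u
    · have hxu' : (x, false) ∈ u := hmate x true hxu
      have v1 := vexit ⟨_, hxu⟩
      have v2 := vexit ⟨_, hxu'⟩
      have n1 := pentry ⟨_, hxu⟩
      have n2 := pentry ⟨_, hxu'⟩
      simp only [exitKey, entryKey, hxc, if_false] at v1 v2 n1 n2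
      rw [n1 _ hj, n1 _ hj, n2 _ hk, n2 _ hk, v1, v1, v2, v2]
      exact ⟨congrArg _ (Quot.sound (.northEast x _ _ rfl rfl)),
        congrArg _ (Quot.sound (.northWest x _ _ rfl rfl)),
        congrArg _ (Quot.sound (.southWest x _ _ rfl rfl)),
        congrArg _ (Quot.sound (.southEast x _ _ rfl rfl))⟩
    · have hx : x = n ∨ x = n + 1 := by
        rcases mem_virtualizeKey.1 hj with h | h | h | h
        · exact absurd h.1 hxu
        · exact Or.inl h.1
        · exact absurd h.1 hxc
        · exact Or.inr h.1
      cases anti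
      · simp only [exitKey, entryKey, if_true, Bool.false_and, Bool.false_eq_true, if_false]
          at vP vQ nP nQ xP xQ
        rcases hx with rfl | rfl
        · rw [nP _ hj, nP _ hj, nQ _ hk, nQ _ hk]
          simp [faceOf, entryKey, e1, e2, e1.symm, e2.symm, hNW, hSW, hSE]
        · rw [xP _ hj, xP _ hj, xQ _ hk, xQ _ hk, vP, vP, vQ, vQ]
          simp [faceOf, entryKey, e1, e2, e1.symm, e2.symm, hNE]
      · simp only [exitKey, entryKey, if_true, Bool.true_and, Bool.not_true, Bool.not_false,
          Bool.false_eq_true, if_false] at vP vQ nP nQ xP xQ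
        rcases hx with rfl | rfl
        · rw [nP _ hj, nP _ hj, xQ _ hk, xQ _ hk, vQ, vQ]
          simp [faceOf, entryKey, e1, e2, e1.symm, e2.symm, hNE, hNW]
        · rw [xP _ hj, xP _ hj, nQ _ hk, nQ _ hk, vP, vP]
          simp [faceOf, entryKey, e1, e2, e1.symm, e2.symm, hNE, hSW, hSE]
  cases h with
  | northEast x j k hj hk =>
    obtain ⟨j, hj'⟩ := j; obtain ⟨k, hk'⟩ := k; dsimp only at hj hk; subst hj hk
    exact (key x hj' hk').1
  | northWest x j k hj hk =>
    obtain ⟨j, hj'⟩ := j; obtain ⟨k, hk'⟩ := k; dsimp only at hj hk; subst hj hk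
    exact (key x hj' hk').2.1
  | southWest x j k hj hk =>
    obtain ⟨j, hj'⟩ := j; obtain ⟨k, hk'⟩ := k; dsimp only at hj hk; subst hj hk
    exact (key x hj' hk').2.2.1
  | southEast x j k hj hk =>
    obtain ⟨j, hj'⟩ := j; obtain ⟨k, hk'⟩ := k; dsimp only at hj hk; subst hj hk
    exact (key x hj' hk').2.2.2

end Faces

instance : Finite Side :=
  Finite.of_injective (fun s : Side => s == Side.left)
    (by intro a b; cases a <;> cases b <;> decide)

theorem length_flatMap_virtualizeKey {c n : ℕ} (anti : Bool) {u : List (ℕ × Bool)} (hu : u.Nodup)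
    (h1 : (c, true) ∈ u) (h2 : (c, false) ∈ u) :
    (u.flatMap (virtualizeKey c n anti)).length = u.length + 4 := by
  have hlen : ∀ v : List (ℕ × Bool), (v.flatMap (virtualizeKey c n anti)).length =
      v.length + 2 * (v.filter fun e => e.1 = c).length := by
    intro v
    induction v with
    | nil => rfl
    | cons e v ih =>
      rw [List.flatMap_cons, List.length_append, ih]
      by_cases h : e.1 = c
      · have : (virtualizeKey c n anti e).length = 3 := by
          unfold virtualizeKey; rw [if_pos h]; split_ifs <;> rfl
        simp [h, this]; omega
      · have : (virtualizeKey c n anti e).length = 1 := by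
          unfold virtualizeKey; rw [if_neg h]; rfl
        simp [h, this]; omega
  have hperm : (u.filter fun e => e.1 = c).Perm [(c, true), (c, false)] := by
    rw [List.perm_ext_iff_of_nodup (hu.filter _) (by simp)]
    rintro ⟨x, b⟩
    cases b <;> simp <;> grind
  rw [hlen, hperm.length_eq]
  rfl

theorem planar_virtualizeKey {c n : ℕ} (anti : Bool) {u : List (ℕ × Bool)} (hu : u.Nodup)
    (hn : ∀ e ∈ u, e.1 < n) (hmate : ∀ x b, (x, b) ∈ u → (x, !b) ∈ u) (hpl : Planar u)
    (h1 : (c, true) ∈ u) : Planar (u.flatMap (virtualizeKey c n anti)) := by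
  have h2 : (c, false) ∈ u := hmate c true h1
  rcases hpl with rfl | hpl
  · simp at h1
  right
  have hlen := length_flatMap_virtualizeKey (n := n) anti hu h1 h2
  let P : {e // e ∈ u} := ⟨_, h1⟩
  let Q : {e // e ∈ u} := ⟨_, h2⟩
  have hcn : c < n := hn _ h1
  let V := u.flatMap (virtualizeKey c n anti)
  let F : Face V → Face u ⊕ Bool := Quot.lift (fun a => faceOf c n anti P Q a.1.1 a.2)
    (fun a b h => faceOf_corner hu hn hmate rfl rfl h)
  have hF : Function.Surjective F := by
    rintro (y | b)
    · induction y using Quot.ind with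
      | mk y =>
        obtain ⟨e, s⟩ := y
        have hm : exitKey c n anti e.1 ∈ V := by
          obtain ⟨X, hX⟩ := virtualizeKey_eq_exit (c := c) (n := n) (anti := anti) e.1
          exact List.mem_flatMap.2 ⟨e.1, e.2, by rw [hX]; simp⟩
        exact ⟨Quot.mk _ (⟨_, hm⟩, s), faceOf_exitKey hn rfl rfl e s⟩
    · have hm1 : entryKey c n anti (c, true) ∈ V :=
        List.mem_flatMap.2 ⟨_, h1, by rw [virtualizeKey_label]; simp⟩
      have hm2 : (c, !false) ∈ V :=
        List.mem_flatMap.2 ⟨_, h2, by rw [virtualizeKey_label]; simp⟩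
      have hm3 : (c, !true) ∈ V :=
        List.mem_flatMap.2 ⟨_, h1, by rw [virtualizeKey_label]; simp⟩
      have e1 : c ≠ n := by omega
      have e2 : c ≠ n + 1 := by omega
      cases b
      · refine ⟨Quot.mk _ (⟨_, hm1⟩, if anti then .right else .left), ?_⟩
        show faceOf c n anti P Q _ _ = _
        cases anti <;> simp [faceOf]
      · refine ⟨Quot.mk _ (⟨_, hm3⟩, if anti then .left else .right), ?_⟩
        show faceOf c n anti P Q _ _ = _
        cases anti <;> simp [faceOf, entryKey, e1]
  have : Finite (Face V) := inferInstanceAs (Finite (Quot _))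
  have : Finite (Face u) := inferInstanceAs (Finite (Quot _))
  have hcard : Nat.card (Face u) + 2 ≤ Nat.card (Face V) := by
    have := Nat.card_le_card_of_surjective F hF
    rwa [Nat.card_sum, Nat.card_eq_fintype_card (α := Bool), Fintype.card_bool] at this
  unfold eulerChar at hpl ⊢
  rw [hlen]
  have : (u.length + 4) / 2 = u.length / 2 + 2 := by omega
  rw [this]
  push_cast at hpl ⊢
  have : (Nat.card (Face u) : ℤ) + 2 ≤ Nat.card (Face V) := by exact_mod_cast hcard
  show (2 : ℤ) ≤ _ - _ + (Nat.card (Face V) : ℤ)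
  linarith

theorem keys_mate {w : List Passage} (h : IsWord w) (x : ℕ) (b : Bool) (hx : (x, b) ∈ keys w) :
    (x, !b) ∈ keys w := by
  obtain ⟨p, hp, hpe⟩ := List.mem_map.1 hx
  refine List.mem_map.2 ⟨p.mate, h.2 p hp, ?_⟩
  simp only [Prod.mk.injEq] at hpe
  simp [Passage.mate, hpe.1, hpe.2]

theorem keys_lt_freshLabel {w : List Passage} : ∀ e ∈ keys w, e.1 < freshLabel w := by
  intro e he
  obtain ⟨p, hp, rfl⟩ := List.mem_map.1 he
  exact label_lt_freshLabel hp

theorem virtualizeWord_eq_self {c : ℕ} (anti : Bool) {w : List Passage} (h : IsWord w)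
    (hc : (c, true) ∉ keys w) : virtualizeWord c anti w = w := by
  have : ∀ p ∈ w, virtualizePassage c (freshLabel w) anti p = [p] := by
    intro p hp
    have hpc : p.label ≠ c := by
      rintro rfl
      have hk : (p.label, p.ltr) ∈ keys w := List.mem_map.2 ⟨p, hp, rfl⟩
      cases hb : p.ltr
      · rw [hb] at hk; exact hc (keys_mate h _ _ hk)
      · rw [hb] at hk; exact hc hk
    simp [virtualizePassage, hpc]
  unfold virtualizeWord
  rw [List.flatMap_congr this, List.flatMap_singleton']

theorem isWord_virtualizeWord {c : ℕ} (anti : Bool) {w : List Passage} (h : IsWord w) :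
    IsWord (virtualizeWord c anti w) := by
  by_cases hc : (c, true) ∈ keys w
  · refine ⟨?_, fun p hp => ?_⟩
    · rw [virtualizeWord, keys_virtualizeWord]
      exact nodup_virtualizeKey anti h.1 keys_lt_freshLabel (keys_lt_freshLabel _ hc)
    · obtain ⟨q, hq, hp⟩ := List.mem_flatMap.1 hp
      refine List.mem_flatMap.2 ⟨q.mate, h.2 q hq, ?_⟩
      unfold virtualizePassage at hp ⊢
      by_cases hqc : q.label = c
      · cases hb : q.ltr <;> cases anti <;> simp [hqc, hb, Passage.mate] at hp ⊢ <;>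
          rcases hp with rfl | rfl | rfl <;> simp
      · simp [hqc] at hp
        subst hp
        simp [Passage.mate, hqc]
  · rw [virtualizeWord_eq_self anti h hc]; exact h

theorem planar_virtualizeWord {c : ℕ} (anti : Bool) {w : List Passage} (h : IsWord w)
    (hw : Planar (keys w)) : Planar (keys (virtualizeWord c anti w)) := by
  by_cases hc : (c, true) ∈ keys w
  · rw [virtualizeWord, keys_virtualizeWord]
    exact planar_virtualizeKey anti h.1 keys_lt_freshLabel (keys_mate h) hw hc
  · rw [virtualizeWord_eq_self anti h hc]; exact hw

/-- The virtualization of the diagram at the crossing `c`: the crossing is replaced by the real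
crossing of opposite sign (the over-strand remains the over-strand), flanked by two virtual
crossings, so that the four ends of the replaced part are as before. The two ways to place the
flanking crossings are distinguished by `anti`: the two strands pass the three crossings in the same
order (`anti = false`), or in opposite orders (`anti = true`). -/
def Diagram.virtualize (D : Diagram) (c : Passage) (anti : Bool) : Diagram where
  word := virtualizeWord c.label anti D.word
  isWord := isWord_virtualizeWord anti D.isWord
  planar := planar_virtualizeWord anti D.isWord D.planar

end VirtualKnot

namespace VirtualKnot

/-! ### Passages and words -/

/-! Two invariants carry the proof: the writhe polynomial shows that the virtualization is not
classical, and the Casson invariant shows that its coefficient `a` is not zero.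

Writhe polynomial. Following the knot, number the edges so that the number drops or rises by one at
each real passage, according to the direction in which the other strand is crossed, and stays the
same at virtual passages. The index of a chord is then the discrepancy `wordIndex` of the numbering
at its crossing (`Diagram.index_eq_wordIndex`). In these terms invariance under the generalized
moves is local bookkeeping (`wordPolynomial_step`). For a planar classical diagram the numbering
comes from a numbering of the faces, the Alexander numbering, which an Euler characteristic count
provides (`exists_coboundary_eq_one`). Hence all indices vanish (`wordIndex_eq_zero`), and so does
the polynomial.

Virtualizing at `c` reverses the jump of the numbering at both passages of `c`. This shifts the
numbers on one of the two arcs cut off by `c` by two relative to the other arc. Exactly the chords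
crossing `c` acquire an index, namely `2` or `-2` depending on the side of their over-passage. Since
`c` has index zero in `K`, the signed counts in the two directions agree, and the polynomial is `a
t^2 + a t^(-2)` (`Diagram.writhePolynomial_virtualize`).

Non-vanishing of `a`. All crossings of `K` have the same sign, so `a = 0` forces the chord `c` to
cross no other chord. The Polyak-Viro sum `casson` is an invariant of classical diagrams
(`casson_step`), hence is zero for the trivial diagram obtained by switching `c`. An isolated chord
does not enter that sum, and every other term is a product of two equal signs, hence nonnegative. So
all terms vanish, for every choice of base point. Any two crossing chords would contribute for a
suitable base point, so no two chords of `K` cross. Such a diagram unravels by removing curls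
(`Diagram.isTrivial_of_not_interlaced`), so that `K` would be trivial, against unknotting number `1`
(`Diagram.isTrivial_of_switch`, `Diagram.sum_sign_ne_zero`). -/

@[simp] theorem Passage.mate_mate (p : Passage) : p.mate.mate = p := by
  simp [Passage.mate]

@[simp] theorem Passage.mate_label (p : Passage) : p.mate.label = p.label := rfl

@[simp] theorem Passage.mate_type (p : Passage) : p.mate.type = p.type := rfl

@[simp] theorem Passage.mate_ltr (p : Passage) : p.mate.ltr = !p.ltr := rfl

theorem Passage.mate_ne (p : Passage) : p.mate ≠ p := by
  intro h
  simpa using congrArg Passage.ltr h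

theorem Passage.mate_injective : Function.Injective Passage.mate :=
  Function.LeftInverse.injective Passage.mate_mate

theorem Passage.mate_eq_iff {p q : Passage} : p.mate = q ↔ p = q.mate := by
  constructor
  · rintro rfl; simp
  · rintro rfl; simp

theorem IsWord.nodup {w : List Passage} (h : IsWord w) : w.Nodup := List.Nodup.of_map _ h.1

theorem IsWord.mate_mem_iff {w : List Passage} (h : IsWord w) {p : Passage} :
    p.mate ∈ w ↔ p ∈ w :=
  ⟨fun hp => by simpa using h.2 _ hp, h.2 p⟩

theorem IsWord.eq_of_key_eq {w : List Passage} (h : IsWord w) {p q : Passage} (hp : p ∈ w)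
    (hq : q ∈ w) (h1 : p.label = q.label) (h2 : p.ltr = q.ltr) : p = q :=
  List.inj_on_of_nodup_map h.1 hp hq (by rw [h1, h2])

theorem IsWord.eq_or_eq_mate {w : List Passage} (h : IsWord w) {p q : Passage} (hp : p ∈ w)
    (hq : q ∈ w) (h1 : p.label = q.label) : p = q ∨ p = q.mate := by
  by_cases h2 : p.ltr = q.ltr
  · exact Or.inl (h.eq_of_key_eq hp hq h1 h2)
  · refine Or.inr (h.eq_of_key_eq hp (h.2 _ hq) h1 ?_)
    cases hb : p.ltr <;> cases hd : q.ltr <;> simp_all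

theorem IsWord.perm {w w' : List Passage} (h : IsWord w) (hp : w.Perm w') : IsWord w' :=
  ⟨(hp.map _).nodup h.1, fun p hpw => hp.mem_iff.1 (h.2 p (hp.mem_iff.2 hpw))⟩

/-! ### Levels (Alexander numbering) -/

/-- The change of the Alexander numbering along a real passage. -/
def Passage.jump (p : Passage) : ℤ := if p.type = .virt then 0 else if p.ltr then -1 else 1

@[simp] theorem Passage.jump_mate (p : Passage) : p.mate.jump = -p.jump := by
  unfold Passage.jump
  cases h : p.ltr <;> by_cases ht : p.type = .virt <;> simp [h, ht]

/-- The total change of the numbering along a word. -/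
def totalJump (w : List Passage) : ℤ := (w.map Passage.jump).sum

@[simp] theorem totalJump_nil : totalJump [] = 0 := rfl

@[simp] theorem totalJump_cons (p : Passage) (w : List Passage) :
    totalJump (p :: w) = p.jump + totalJump w := by simp [totalJump]

@[simp] theorem totalJump_append (v w : List Passage) :
    totalJump (v ++ w) = totalJump v + totalJump w := by simp [totalJump]

/-- The numbering of the edge that runs into the passage `p`, starting with `0` at the base
point. -/
def level : List Passage → Passage → ℤ
  | [], _ => 0
  | q :: w, p => if q = p then 0 else q.jump + level w p

@[simp] theorem level_nil (p : Passage) : level [] p = 0 := rfl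

theorem level_cons (q : Passage) (w : List Passage) (p : Passage) :
    level (q :: w) p = if q = p then 0 else q.jump + level w p := rfl

theorem level_append (A B : List Passage) (p : Passage) :
    level (A ++ B) p = if p ∈ A then level A p else totalJump A + level B p := by
  induction A with
  | nil => simp
  | cons q A ih =>
    rw [List.cons_append, level_cons, level_cons, ih]
    by_cases h : q = p
    · simp [h]
    · have h' : p ≠ q := fun h0 => h h0.symm
      by_cases hA : p ∈ A
      · simp [h, hA]
      · simp [h, h', hA]; ring

theorem totalJump_toFinset {w : List Passage} (h : w.Nodup) :
    totalJump w = ∑ p ∈ w.toFinset, p.jump := (List.sum_toFinset _ h).symm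

/-- The two passages of a crossing jump by opposite amounts, so the numbering closes up after one
turn. -/
theorem totalJump_eq_zero {w : List Passage} (h : IsWord w) : totalJump w = 0 := by
  rw [totalJump_toFinset h.nodup]
  refine Finset.sum_involution (fun p _ => p.mate) ?_ ?_ ?_ ?_
  · intro p _; simp
  · intro p _ _; exact p.mate_ne
  · intro p hp; simpa [h.mate_mem_iff] using hp
  · intro p _; simp

/-- The difference of the numbering between the two sides of the crossing of `c`. -/
def wordIndex (w : List Passage) (c : Passage) : ℤ := level w c.mate - level w c - c.jump

theorem wordIndex_mate (w : List Passage) (c : Passage) :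
    wordIndex w c.mate = -wordIndex w c := by
  simp [wordIndex]; ring

/-- Because the numbering closes up, a new base point shifts all levels by one common constant,
which cancels in a difference of levels. -/
theorem wordIndex_rotate {A B : List Passage} (h : IsWord (A ++ B)) {c : Passage}
    (hc : c ∈ A ++ B) : wordIndex (B ++ A) c = wordIndex (A ++ B) c := by
  have h0 := totalJump_eq_zero h
  rw [totalJump_append] at h0
  have hm := h.2 c hc
  have hd := List.disjoint_of_nodup_append h.nodup
  have key : ∀ p ∈ A ++ B, level (B ++ A) p = level (A ++ B) p - totalJump A := by
    intro p hp
    rw [level_append, level_append]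
    rcases List.mem_append.1 hp with hA | hB
    · rw [if_neg (hd hA), if_pos hA]; linarith
    · rw [if_pos hB, if_neg (fun hA => hd hA hB)]; linarith
  rw [wordIndex, wordIndex, key _ hc, key _ hm]
  ring

/-- The levels at `c` and at `c.mate` differ by the jump of `c` and the jumps of `R`; the definition
of `wordIndex` removes the former. Reading the index as a signed count along an arc is what connects
it with chords. -/
theorem wordIndex_eq_totalJump {c : Passage} {R L : List Passage}
    (h : (c :: R ++ c.mate :: L).Nodup) :
    wordIndex (c :: R ++ c.mate :: L) c = totalJump R := by
  have h1 : c.mate ∉ R := by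
    intro h0
    simp [List.nodup_append, List.nodup_cons] at h
    grind
  have h2 := c.mate_ne
  simp [wordIndex, level_cons, level_append, h1, h2.symm]

/-! ### Order of passages -/

/-- The passage `a` comes before the passage `b`. -/
def Before (w : List Passage) (a b : Passage) : Prop := [a, b].Sublist w

instance (w : List Passage) (a b : Passage) : Decidable (Before w a b) :=
  inferInstanceAs (Decidable (List.Sublist _ _))

section Before

variable {w s : List Passage} {a b c : Passage}

theorem Before.mono (h : Before s a b) (hs : s.Sublist w) : Before w a b := h.trans hs

theorem Before.left_mem (h : Before w a b) : a ∈ w := h.subset (by simp)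

theorem Before.right_mem (h : Before w a b) : b ∈ w := h.subset (by simp)

theorem before_cons {x : Passage} :
    Before (x :: w) a b ↔ (a = x ∧ b ∈ w) ∨ Before w a b := by
  unfold Before
  constructor
  · intro h
    cases h with
    | cons _ h => exact Or.inr h
    | cons_cons _ h => exact Or.inl ⟨rfl, by simpa using h⟩
  · rintro (⟨rfl, h⟩ | h)
    · exact List.Sublist.cons_cons _ (by simpa using h)
    · exact h.cons _

@[simp] theorem not_before_nil : ¬ Before [] a b := by simp [Before]

theorem before_append {A B : List Passage} :
    Before (A ++ B) a b ↔ Before A a b ∨ (a ∈ A ∧ b ∈ B) ∨ Before B a b := by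
  induction A with
  | nil => simp
  | cons x A ih => simp only [List.cons_append, before_cons, ih, List.mem_append, List.mem_cons]; tauto

theorem before_iff_exists : Before w a b ↔ ∃ X Y Z, w = X ++ a :: Y ++ b :: Z := by
  constructor
  · intro h
    induction w with
    | nil => simp at h
    | cons x w ih =>
      rcases before_cons.1 h with ⟨rfl, h'⟩ | h
      · obtain ⟨Y, Z, rfl⟩ := List.append_of_mem h'
        exact ⟨[], Y, Z, by simp⟩
      · obtain ⟨X, Y, Z, rfl⟩ := ih h
        exact ⟨x :: X, Y, Z, by simp⟩
  · rintro ⟨X, Y, Z, rfl⟩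
    rw [before_append]
    exact Or.inr (Or.inl ⟨by simp, by simp⟩)

theorem Before.ne (hw : w.Nodup) (h : Before w a b) : a ≠ b := by
  have := h.nodup hw
  simpa using this

theorem before_total (ha : a ∈ w) (hb : b ∈ w) (hab : a ≠ b) : Before w a b ∨ Before w b a := by
  induction w with
  | nil => simp at ha
  | cons x w ih =>
    simp only [before_cons]
    grind

theorem before_asymm (hw : w.Nodup) (h : Before w a b) : ¬ Before w b a := by
  induction w with
  | nil => simp at h
  | cons x w ih =>
    intro h'
    rw [before_cons] at h h'
    have hx := List.nodup_cons.1 hw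
    have l1 := fun h : Before w a b => h.left_mem
    have l2 := fun h : Before w a b => h.right_mem
    have l3 := fun h : Before w b a => h.left_mem
    have l4 := fun h : Before w b a => h.right_mem
    have := ih hx.2
    grind

theorem before_trans (hw : w.Nodup) (h : Before w a b) (h' : Before w b c) : Before w a c := by
  induction w with
  | nil => simp at h
  | cons x w ih =>
    rw [before_cons] at h h' ⊢
    have hx := List.nodup_cons.1 hw
    have l2 := fun h : Before w a b => h.right_mem
    have l4 := fun h : Before w b c => h.right_mem
    have := ih hx.2
    grind

theorem not_before (hw : w.Nodup) (ha : a ∈ w) (hb : b ∈ w) (hab : a ≠ b) :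
    ¬ Before w a b ↔ Before w b a :=
  ⟨fun h => (before_total ha hb hab).resolve_left h, fun h h' => before_asymm hw h h'⟩

/-- Order is total on the sublist and antisymmetric on the duplicate-free word, so neither order can
be lost or gained. -/
theorem before_iff_of_sublist (hw : w.Nodup) (hs : s.Sublist w) (ha : a ∈ s) (hb : b ∈ s) :
    Before w a b ↔ Before s a b := by
  refine ⟨fun h => ?_, fun h => h.mono hs⟩
  exact (before_total ha hb (h.ne hw)).resolve_right fun h' => before_asymm hw h (h'.mono hs)

end Before

/-! ### Invariance of the writhe polynomial -/

/-- The contribution of a passage of index `k` to the writhe polynomial. -/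
noncomputable def writheTerm (c : Passage) (k : ℤ) : ℤ[T;T⁻¹] :=
  if c.IsOver ∧ k ≠ 0 then LaurentPolynomial.C (Diagram.sign c) * LaurentPolynomial.T k else 0

/-- The writhe polynomial in terms of the Alexander numbering. -/
noncomputable def wordPolynomial (w : List Passage) : ℤ[T;T⁻¹] :=
  (w.map fun c => writheTerm c (wordIndex w c)).sum

@[simp] theorem writheTerm_zero (c : Passage) : writheTerm c 0 = 0 := by simp [writheTerm]

theorem jump_relabel (f : ℕ → ℕ) (p : Passage) :
    Passage.jump { p with label := f p.label } = p.jump := rfl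

theorem relabel_injective {f : ℕ → ℕ} (hf : Function.Injective f) :
    Function.Injective fun p : Passage => { p with label := f p.label } := by
  rintro ⟨x, b, t⟩ ⟨y, d, s⟩ h
  simp only [Passage.mk.injEq] at h ⊢
  exact ⟨hf h.1, h.2⟩

theorem level_relabel {f : ℕ → ℕ} (hf : Function.Injective f) (w : List Passage) (p : Passage) :
    level (w.map fun p => { p with label := f p.label }) { p with label := f p.label } =
      level w p := by
  induction w with
  | nil => rfl
  | cons q w ih =>
    rw [List.map_cons, level_cons, level_cons, ih]
    by_cases h : q = p
    · simp [h]
    · rw [if_neg h, if_neg (fun h0 => h (relabel_injective hf h0)), jump_relabel]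

theorem wordIndex_relabel {f : ℕ → ℕ} (hf : Function.Injective f) (w : List Passage)
    (p : Passage) :
    wordIndex (w.map fun p => { p with label := f p.label }) { p with label := f p.label } =
      wordIndex w p := by
  unfold wordIndex
  rw [level_relabel hf, jump_relabel, ← level_relabel hf w p.mate]
  rfl

theorem wordPolynomial_relabel {f : ℕ → ℕ} (hf : Function.Injective f) (w : List Passage) :
    wordPolynomial (w.map fun p => { p with label := f p.label }) = wordPolynomial w := by
  unfold wordPolynomial
  rw [List.map_map]
  congr 1
  refine List.map_congr_left fun p _ => ?_
  simp only [Function.comp_apply, wordIndex_relabel hf]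
  rfl

theorem wordPolynomial_rotate {A B : List Passage} (h : IsWord (A ++ B)) :
    wordPolynomial (B ++ A) = wordPolynomial (A ++ B) := by
  unfold wordPolynomial
  have : ∀ p ∈ B ++ A, writheTerm p (wordIndex (B ++ A) p) =
      writheTerm p (wordIndex (A ++ B) p) := by
    intro p hp
    rw [wordIndex_rotate h (by simpa [or_comm] using hp)]
  rw [List.map_congr_left this, List.map_append, List.map_append, List.sum_append,
    List.sum_append, add_comm]

/-- A block with total jump zero leaves the numbering after it as it was. Both the curl and the two
halves of a bigon are such blocks. -/
theorem level_insert {A N B : List Passage} {p : Passage} (hN : totalJump N = 0) (hp : p ∉ N) :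
    level (A ++ N ++ B) p = level (A ++ B) p := by
  simp only [level_append, List.mem_append, hp, or_false, totalJump_append, hN, add_zero]
  split_ifs <;> rfl

/-- No other index changes, and the arc between the two passages of the curl is empty, so the new
crossing has index zero and contributes nothing. -/
theorem wordPolynomial_curl {A B : List Passage} {x : ℕ} {b : Bool} {t : CrossingType}
    (h : IsWord (A ++ B)) (h' : IsWord (A ++ [⟨x, b, t⟩, ⟨x, !b, t⟩] ++ B)) :
    wordPolynomial (A ++ [⟨x, b, t⟩, ⟨x, !b, t⟩] ++ B) = wordPolynomial (A ++ B) := by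
  set N : List Passage := [⟨x, b, t⟩, ⟨x, !b, t⟩] with hN
  set p : Passage := ⟨x, b, t⟩ with hp
  have hN' : N = [p, p.mate] := rfl
  have hj : totalJump N = 0 := by simp [hN']
  have hnd := h'.nodup
  have hdisj : ∀ q ∈ A ++ B, q ∉ N := by
    intro q hq hqN
    rw [List.nodup_append, List.nodup_append] at hnd
    rcases List.mem_append.1 hq with hq | hq
    · exact hnd.1.2.2 q hq q hqN rfl
    · exact hnd.2.2 q (by simp [hqN]) q hq rfl
  have houter : ∀ q ∈ A ++ B, wordIndex (A ++ N ++ B) q = wordIndex (A ++ B) q := by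
    intro q hq
    unfold wordIndex
    rw [level_insert hj (hdisj q hq), level_insert hj (hdisj _ (h.2 q hq))]
  have hA : p ∉ A ∧ p.mate ∉ A := by
    rw [hN'] at hnd
    constructor <;> intro h0 <;> simp [List.nodup_append] at hnd <;> grind
  have hp0 : wordIndex (A ++ N ++ B) p = 0 := by
    have := p.mate_ne
    simp [wordIndex, level_append, hN', hA, level_cons, this.symm]
  have hpm : wordIndex (A ++ N ++ B) p.mate = 0 := by rw [wordIndex_mate, hp0, neg_zero]
  unfold wordPolynomial
  rw [List.map_append, List.map_append, List.sum_append, List.sum_append]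
  have hmap : ∀ g : Passage → ℤ[T;T⁻¹], N.map g = [g p, g p.mate] := fun g => rfl
  have e1 : N.map (fun c => writheTerm c (wordIndex (A ++ N ++ B) c)) = [0, 0] := by
    rw [hmap, hp0, hpm, writheTerm_zero, writheTerm_zero]
  rw [e1, List.map_congr_left fun q hq => by rw [houter q (List.mem_append_left _ hq)],
    List.map_congr_left (l := B) fun q hq => by rw [houter q (List.mem_append_right _ hq)],
    List.map_append, List.sum_append]
  simp

/-! ### The bigon move and the writhe polynomial -/

theorem isOver_flip {x y : ℕ} {b : Bool} {t : CrossingType} :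
    (Passage.mk x (!b) t.flip).IsOver ↔ (Passage.mk y b t).IsOver := by
  cases t <;> cases b <;> simp [Passage.IsOver, CrossingType.flip]

theorem sign_flip {c d : Passage} (h : c.IsOver) (hd : d.type = c.type.flip) :
    Diagram.sign d = -Diagram.sign c := by
  obtain ⟨x, b, t⟩ := c
  cases t <;> simp_all [Diagram.sign, CrossingType.flip, Passage.IsOver]

theorem writheTerm_flip {x y : ℕ} {b : Bool} {t : CrossingType} (k : ℤ) :
    writheTerm ⟨x, b, t⟩ k + writheTerm ⟨y, !b, t.flip⟩ k = 0 := by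
  have ho := isOver_flip (x := y) (y := x) (b := b) (t := t)
  unfold writheTerm
  by_cases h : (Passage.mk x b t).IsOver ∧ k ≠ 0
  · rw [if_pos h, if_pos ⟨ho.2 h.1, h.2⟩, sign_flip (c := ⟨x, b, t⟩) (d := ⟨y, !b, t.flip⟩) h.1 rfl]
    simp
  · rw [if_neg h, if_neg fun h' => h ⟨ho.1 h'.1, h'.2⟩, add_zero]

theorem jump_flip {x y : ℕ} {b : Bool} {t : CrossingType} :
    (Passage.mk x (!b) t.flip).jump = -(Passage.mk y b t).jump := by
  cases t <;> cases b <;> simp [Passage.jump, CrossingType.flip]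

theorem totalJump_inOrder (d : Bool) (p q : Passage) :
    totalJump (inOrder d p q) = p.jump + q.jump := by
  cases d <;> simp [inOrder, add_comm]

theorem mem_inOrder {d : Bool} {p q r : Passage} : r ∈ inOrder d p q ↔ r = p ∨ r = q := by
  cases d <;> simp [inOrder, or_comm]

theorem sum_map_inOrder {M : Type*} [AddCommMonoid M] (f : Passage → M) (d : Bool)
    (p q : Passage) : ((inOrder d p q).map f).sum = f p + f q := by
  cases d <;> simp [inOrder, add_comm]

theorem level_inOrder (d : Bool) (p q r : Passage) :
    level (inOrder d p q) r =
      if d then level [p, q] r else level [q, p] r := by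
  cases d <;> simp [inOrder]

/-- The two new crossings have opposite jumps, so each half of the bigon is neutral for the other
levels. They share one index and, if real, have opposite signs; their contributions cancel. -/
theorem wordPolynomial_bigon {A B C : List Passage} {x y : ℕ} {b d : Bool} {t : CrossingType}
    (h : IsWord (A ++ B ++ C))
    (h' : IsWord (A ++ [⟨x, b, t⟩, ⟨y, !b, t.flip⟩] ++ B ++
      inOrder d ⟨x, !b, t⟩ ⟨y, b, t.flip⟩ ++ C)) :
    wordPolynomial (A ++ [⟨x, b, t⟩, ⟨y, !b, t.flip⟩] ++ B ++
      inOrder d ⟨x, !b, t⟩ ⟨y, b, t.flip⟩ ++ C) = wordPolynomial (A ++ B ++ C) := by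
  set p : Passage := ⟨x, b, t⟩ with hp
  set q : Passage := ⟨y, !b, t.flip⟩ with hq
  have hpm : (⟨x, !b, t⟩ : Passage) = p.mate := rfl
  have hqm : (⟨y, b, t.flip⟩ : Passage) = q.mate := by simp [hq, Passage.mate]
  have hqj : q.jump = -p.jump := jump_flip
  rw [hpm, hqm] at h' ⊢
  set N := [p, q] with hN
  set M := inOrder d p.mate q.mate with hM
  have hNj : totalJump N = 0 := by simp [hN, hqj]
  have hMj : totalJump M = 0 := by simp [hM, totalJump_inOrder, hqj]
  have hnd := h'.nodup
  have hmN : ∀ r, r ∈ N ↔ r = p ∨ r = q := by simp [hN]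
  have hmM : ∀ r, r ∈ M ↔ r = p.mate ∨ r = q.mate := fun r => mem_inOrder
  have hlev : ∀ r, r ∉ N → r ∉ M → level (A ++ N ++ B ++ M ++ C) r = level (A ++ B ++ C) r := by
    intro r h1 h2
    rw [level_insert hMj h2, List.append_assoc, level_insert hNj h1, ← List.append_assoc]
  have hdisj : ∀ r ∈ A ++ B ++ C, r ∉ N ∧ r ∉ M := by
    intro r hr
    simp only [List.nodup_append, List.mem_append] at hnd hr
    constructor <;> intro h0 <;> rcases hr with (hr | hr) | hr <;> grind
  have houter : ∀ r ∈ A ++ B ++ C,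
      wordIndex (A ++ N ++ B ++ M ++ C) r = wordIndex (A ++ B ++ C) r := by
    intro r hr
    unfold wordIndex
    rw [hlev _ (hdisj r hr).1 (hdisj r hr).2,
      hlev _ (hdisj _ (h.2 r hr)).1 (hdisj _ (h.2 r hr)).2]
  -- The levels of `p` and `q` differ by the jump of one of them, and so do those of their mates;
  -- for both orders `d` the discrepancies balance.
  have hidx : wordIndex (A ++ N ++ B ++ M ++ C) p = wordIndex (A ++ N ++ B ++ M ++ C) q := by
    have hpA : p ∉ A ∧ q ∉ A ∧ p.mate ∉ A ∧ q.mate ∉ A ∧ p.mate ∉ N ∧ q.mate ∉ N ∧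
        p.mate ∉ B ∧ q.mate ∉ B ∧ p ≠ q ∧ p.mate ≠ q.mate := by
      have i1 := (hmM p.mate).2 (Or.inl rfl)
      have i2 := (hmM q.mate).2 (Or.inr rfl)
      have i3 := (hmN p).2 (Or.inl rfl)
      have i4 := (hmN q).2 (Or.inr rfl)
      have i5 : p ≠ q := by
        have : N.Nodup := by simp only [List.nodup_append] at hnd; exact hnd.1.1.1.2.1
        simpa [hN] using this
      have i6 := fun h0 => i5 (Passage.mate_injective h0)
      simp only [List.nodup_append, List.mem_append] at hnd
      refine ⟨?_, ?_, ?_, ?_, ?_, ?_, ?_, ?_, i5, i6⟩ <;> intro h0 <;> grind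
    obtain ⟨a1, a2, a3, a4, a5, a6, a7, a8, a9, a10⟩ := hpA
    have hl : ∀ r, r ∉ A → r ∈ N → level (A ++ N ++ B ++ M ++ C) r = totalJump A + level N r := by
      intro r h1 h2
      simp [level_append, h1, h2]
    have hl' : ∀ r, r ∉ A → r ∉ N → r ∉ B → r ∈ M →
        level (A ++ N ++ B ++ M ++ C) r = totalJump A + totalJump B + level M r := by
      intro r h1 h2 h3 h4
      simp [level_append, h1, h2, h3, h4, hNj, add_assoc]
    unfold wordIndex
    rw [hl p a1 (by simp [hN]), hl q a2 (by simp [hN]), hl' _ a3 a5 a7 ((hmM _).2 (Or.inl rfl)),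
      hl' _ a4 a6 a8 ((hmM _).2 (Or.inr rfl)), hM, level_inOrder, level_inOrder]
    have a10' := a10.symm
    cases d <;> simp [hN, level_cons, a9, a10, a10', hqj] <;> ring
  unfold wordPolynomial
  simp only [List.map_append, List.sum_append]
  rw [List.map_congr_left (l := A) fun r hr => by rw [houter r (by simp [hr])],
    List.map_congr_left (l := B) fun r hr => by rw [houter r (by simp [hr])],
    List.map_congr_left (l := C) fun r hr => by rw [houter r (by simp [hr])]]
  have e1 : (N.map fun c => writheTerm c (wordIndex (A ++ N ++ B ++ M ++ C) c)).sum = 0 := by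
    have : ∀ k, writheTerm p k + writheTerm q k = 0 := fun k => writheTerm_flip k
    rw [← this (wordIndex (A ++ N ++ B ++ M ++ C) p)]
    have hmap : ∀ g : Passage → ℤ[T;T⁻¹], (N.map g).sum = g p + g q := fun g => by simp [hN]
    rw [hmap, hidx]
  have e2 : (M.map fun c => writheTerm c (wordIndex (A ++ N ++ B ++ M ++ C) c)).sum = 0 := by
    have : ∀ k, writheTerm p.mate k + writheTerm q.mate k = 0 := by
      intro k
      have := writheTerm_flip (x := x) (y := y) (b := !b) (t := t) k
      simpa [hpm, hqm] using this
    rw [← this (wordIndex (A ++ N ++ B ++ M ++ C) p.mate), hM, sum_map_inOrder, ← hM,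
      wordIndex_mate, wordIndex_mate, hidx]
  rw [e1, e2]
  simp

/-- The word of a diagram with three distinguished pairs of consecutive passages. -/
def threeBlocks (A B C D : List Passage) (p₁ q₁ p₂ q₂ p₃ q₃ : Passage) (e₁ e₂ e₃ : Bool) :
    List Passage :=
  A ++ inOrder e₁ p₁ q₁ ++ B ++ inOrder e₂ p₂ q₂ ++ C ++ inOrder e₃ p₃ q₃ ++ D

theorem inOrder_perm (d e : Bool) (p q : Passage) : (inOrder d p q).Perm (inOrder e p q) := by
  cases d <;> cases e <;> simp only [inOrder, if_true, Bool.false_eq_true, if_false] <;>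
    first | exact List.Perm.refl _ | exact List.Perm.swap _ _ _

theorem threeBlocks_perm (A B C D : List Passage) (p₁ q₁ p₂ q₂ p₃ q₃ : Passage)
    (e₁ e₂ e₃ f₁ f₂ f₃ : Bool) :
    (threeBlocks A B C D p₁ q₁ p₂ q₂ p₃ q₃ e₁ e₂ e₃).Perm
      (threeBlocks A B C D p₁ q₁ p₂ q₂ p₃ q₃ f₁ f₂ f₃) :=
  ((((((inOrder_perm _ _ _ _).append_left A).append_right B).append
    (inOrder_perm _ _ _ _)).append_right C).append (inOrder_perm _ _ _ _)).append_right D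

/-! ### The triangle move and the writhe polynomial -/

section

variable {A B C D : List Passage} {p₁ q₁ p₂ q₂ p₃ q₃ : Passage}

/-- The total jump of a two-element block does not depend on its order, so the reordering is not
felt outside the blocks. -/
theorem level_threeBlocks_of_notMem (e₁ e₂ e₃ f₁ f₂ f₃ : Bool) {r : Passage}
    (hr : r ∉ [p₁, q₁, p₂, q₂, p₃, q₃]) :
    level (threeBlocks A B C D p₁ q₁ p₂ q₂ p₃ q₃ e₁ e₂ e₃) r =
      level (threeBlocks A B C D p₁ q₁ p₂ q₂ p₃ q₃ f₁ f₂ f₃) r := by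
  simp only [List.mem_cons, not_or, List.not_mem_nil, not_false_eq_true, and_true] at hr
  obtain ⟨h1, h2, h3, h4, h5, h6⟩ := hr
  unfold threeBlocks
  have m1 : ∀ e, r ∉ inOrder e p₁ q₁ := fun e h => (mem_inOrder.1 h).elim h1 h2
  have m2 : ∀ e, r ∉ inOrder e p₂ q₂ := fun e h => (mem_inOrder.1 h).elim h3 h4
  have m3 : ∀ e, r ∉ inOrder e p₃ q₃ := fun e h => (mem_inOrder.1 h).elim h5 h6
  simp only [level_append, m1, m2, m3, List.mem_append, or_false, totalJump_append,
    totalJump_inOrder]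
  split_ifs <;> rfl

theorem level_threeBlocks {e₁ e₂ e₃ : Bool}
    (h : (threeBlocks A B C D p₁ q₁ p₂ q₂ p₃ q₃ e₁ e₂ e₃).Nodup) :
    level (threeBlocks A B C D p₁ q₁ p₂ q₂ p₃ q₃ e₁ e₂ e₃) p₁ =
        totalJump A + (if e₁ then 0 else q₁.jump) ∧
    level (threeBlocks A B C D p₁ q₁ p₂ q₂ p₃ q₃ e₁ e₂ e₃) q₁ =
        totalJump A + (if e₁ then p₁.jump else 0) ∧
    level (threeBlocks A B C D p₁ q₁ p₂ q₂ p₃ q₃ e₁ e₂ e₃) p₂ =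
        totalJump A + p₁.jump + q₁.jump + totalJump B + (if e₂ then 0 else q₂.jump) ∧
    level (threeBlocks A B C D p₁ q₁ p₂ q₂ p₃ q₃ e₁ e₂ e₃) q₂ =
        totalJump A + p₁.jump + q₁.jump + totalJump B + (if e₂ then p₂.jump else 0) ∧
    level (threeBlocks A B C D p₁ q₁ p₂ q₂ p₃ q₃ e₁ e₂ e₃) p₃ =
        totalJump A + p₁.jump + q₁.jump + totalJump B + p₂.jump + q₂.jump + totalJump C +
          (if e₃ then 0 else q₃.jump) ∧
    level (threeBlocks A B C D p₁ q₁ p₂ q₂ p₃ q₃ e₁ e₂ e₃) q₃ =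
        totalJump A + p₁.jump + q₁.jump + totalJump B + p₂.jump + q₂.jump + totalJump C +
          (if e₃ then p₃.jump else 0) := by
  have h' : (threeBlocks A B C D p₁ q₁ p₂ q₂ p₃ q₃ true true true).Nodup :=
    (threeBlocks_perm ..).nodup h
  have key : ∀ r ∈ [p₁, q₁, p₂, q₂, p₃, q₃], r ∉ A ∧ r ∉ B ∧ r ∉ C := by
    intro r hr
    simp only [threeBlocks, inOrder, if_true, List.nodup_append, List.mem_append, List.mem_cons,
      List.not_mem_nil, or_false] at h' hr
    refine ⟨?_, ?_, ?_⟩ <;> intro h0 <;> grind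
  have hs : [p₁, q₁, p₂, q₂, p₃, q₃].Nodup := by
    refine List.Nodup.sublist ?_ h'
    have : [p₁, q₁, p₂, q₂, p₃, q₃] =
        [] ++ [p₁, q₁] ++ [] ++ [p₂, q₂] ++ [] ++ [p₃, q₃] ++ [] := rfl
    rw [this, threeBlocks]
    simp only [inOrder, if_true]
    gcongr <;> exact List.nil_sublist _
  simp only [List.forall_mem_cons] at key
  obtain ⟨⟨a1, b1, c1⟩, ⟨a2, b2, c2⟩, ⟨a3, b3, c3⟩, ⟨a4, b4, c4⟩, ⟨a5, b5, c5⟩, ⟨a6, b6, c6⟩, -⟩ := key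
  simp only [List.nodup_cons, List.mem_cons, not_or, List.not_mem_nil, not_false_eq_true,
    and_true, List.nodup_nil] at hs
  obtain ⟨⟨n1, n2, n3, n4, n5⟩, ⟨n6, n7, n8, n9⟩, ⟨n10, n11, n12⟩, ⟨n13, n14⟩, n15⟩ := hs
  have s1 := Ne.symm n1
  have s2 := Ne.symm n2
  have s3 := Ne.symm n3
  have s4 := Ne.symm n4
  have s5 := Ne.symm n5
  have s6 := Ne.symm n6
  have s7 := Ne.symm n7
  have s8 := Ne.symm n8
  have s9 := Ne.symm n9
  have s10 := Ne.symm n10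
  have s11 := Ne.symm n11
  have s12 := Ne.symm n12
  have s13 := Ne.symm n13
  have s14 := Ne.symm n14
  have s15 := Ne.symm n15
  unfold threeBlocks
  simp only [level_append, List.mem_append, totalJump_append, totalJump_inOrder, mem_inOrder,
    a1, a2, a3, a4, a5, a6, b1, b2, b3, b4, b5, b6, c1, c2, c3, c4, c5, c6, s2, s3, s4, s5, s6,
    s7, s8, s9, s10, s11, s12, s13, s14, s15, or_false, or_true, true_or, if_true,
    if_false]
  refine ⟨?_, ?_, ?_, ?_, ?_, ?_⟩
  · cases e₁ <;> simp [inOrder, level_cons, *]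
  · cases e₁ <;> simp [inOrder, level_cons, *]
  · cases e₂ <;> simp [inOrder, level_cons, *] <;> ring
  · cases e₂ <;> simp [inOrder, level_cons, *] <;> ring
  · cases e₃ <;> simp [inOrder, level_cons, *] <;> ring
  · cases e₃ <;> simp [inOrder, level_cons, *] <;> ring

/-- By `level_threeBlocks` the order bits enter the index of `p₁`, `p₂` or `p₃` only through the
expressions in `h₁`, `h₂`, `h₃`. These are required for real crossings only, since virtual ones have
no term in the polynomial. -/
theorem wordPolynomial_threeBlocks {e₁ e₂ e₃ f₁ f₂ f₃ : Bool}
    (hw : IsWord (threeBlocks A B C D p₁ p₃.mate p₂ p₁.mate p₃ p₂.mate e₁ e₂ e₃))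
    (h₁ : p₁.type ≠ .virt → (if e₂ then p₂.jump else 0) - (if e₁ then 0 else p₃.mate.jump) =
      (if f₂ then p₂.jump else 0) - (if f₁ then 0 else p₃.mate.jump))
    (h₂ : p₂.type ≠ .virt → (if e₃ then p₃.jump else 0) - (if e₂ then 0 else p₁.mate.jump) =
      (if f₃ then p₃.jump else 0) - (if f₂ then 0 else p₁.mate.jump))
    (h₃ : p₃.type ≠ .virt → (if e₁ then p₁.jump else 0) - (if e₃ then 0 else p₂.mate.jump) =
      (if f₁ then p₁.jump else 0) - (if f₃ then 0 else p₂.mate.jump)) :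
    wordPolynomial (threeBlocks A B C D p₁ p₃.mate p₂ p₁.mate p₃ p₂.mate e₁ e₂ e₃) =
      wordPolynomial (threeBlocks A B C D p₁ p₃.mate p₂ p₁.mate p₃ p₂.mate f₁ f₂ f₃) := by
  obtain ⟨v, hv⟩ : ∃ v, v = threeBlocks A B C D p₁ p₃.mate p₂ p₁.mate p₃ p₂.mate e₁ e₂ e₃ :=
    ⟨_, rfl⟩
  obtain ⟨w, hw'⟩ : ∃ w, w = threeBlocks A B C D p₁ p₃.mate p₂ p₁.mate p₃ p₂.mate f₁ f₂ f₃ :=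
    ⟨_, rfl⟩
  have hperm : v.Perm w := by rw [hv, hw']; exact threeBlocks_perm ..
  have lv := level_threeBlocks hw.nodup
  have lw := level_threeBlocks (e₁ := f₁) (e₂ := f₂) (e₃ := f₃) (hw.perm (threeBlocks_perm ..)).nodup
  have hout := fun r (hr : r ∉ [p₁, p₃.mate, p₂, p₁.mate, p₃, p₂.mate]) =>
    level_threeBlocks_of_notMem (A := A) (B := B) (C := C) (D := D) e₁ e₂ e₃ f₁ f₂ f₃ hr
  rw [← hv, ← hw'] at *
  obtain ⟨l1, l2, l3, l4, l5, l6⟩ := lv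
  obtain ⟨l1', l2', l3', l4', l5', l6'⟩ := lw
  have i₁ : p₁.type ≠ .virt → wordIndex v p₁ = wordIndex w p₁ := by
    intro h
    unfold wordIndex
    linarith [h₁ h]
  have i₂ : p₂.type ≠ .virt → wordIndex v p₂ = wordIndex w p₂ := by
    intro h
    unfold wordIndex
    linarith [h₂ h]
  have i₃ : p₃.type ≠ .virt → wordIndex v p₃ = wordIndex w p₃ := by
    intro h
    unfold wordIndex
    linarith [h₃ h]
  have hidx : ∀ r, r.type ≠ .virt → wordIndex v r = wordIndex w r := by
    intro r hr
    by_cases hin : r ∈ [p₁, p₃.mate, p₂, p₁.mate, p₃, p₂.mate]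
    · simp only [List.mem_cons, List.not_mem_nil, or_false] at hin
      rcases hin with rfl | rfl | rfl | rfl | rfl | rfl
      · exact i₁ hr
      · rw [wordIndex_mate, wordIndex_mate, i₃ hr]
      · exact i₂ hr
      · rw [wordIndex_mate, wordIndex_mate, i₁ hr]
      · exact i₃ hr
      · rw [wordIndex_mate, wordIndex_mate, i₂ hr]
    · have hin' : r.mate ∉ [p₁, p₃.mate, p₂, p₁.mate, p₃, p₂.mate] := by
        intro h0
        apply hin
        simp only [List.mem_cons, List.not_mem_nil, or_false, Passage.mate_eq_iff,
          Passage.mate_mate] at h0 ⊢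
        rcases h0 with h0 | h0 | h0 | h0 | h0 | h0 <;> simp [h0]
      unfold wordIndex
      rw [hout r hin, hout _ hin']
  have hterm : ∀ r ∈ v, writheTerm r (wordIndex v r) = writheTerm r (wordIndex w r) := by
    intro r _
    by_cases hr : r.type = .virt
    · have : ¬ r.IsOver := by simp [Passage.IsOver, hr]
      simp [writheTerm, this]
    · rw [hidx r hr]
  unfold wordPolynomial
  rw [List.map_congr_left hterm]
  exact (hperm.map _).sum_eq

end

/-- The third strand is pushed across the crossing `12`. Either it meets strands `1` and `2`
virtually and causes no jumps, or it meets both in real crossings, and the order pattern admitted by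
`ε` makes its two jumps compensate. -/
theorem jump_triangle {t₂₃ t₃₁ : CrossingType} {b₁₂ b₂₃ b₃₁ ε : Bool}
    (h : t₂₃ = .virt ↔ t₃₁ = .virt) (x y : ℕ) :
    (if (b₂₃ == b₁₂) == ε then (Passage.mk x b₂₃ t₂₃).jump else 0) -
        (if (b₁₂ == b₃₁) == ε then 0 else (Passage.mk y (!b₃₁) t₃₁).jump) =
      (if (b₂₃ == b₁₂) == !ε then (Passage.mk x b₂₃ t₂₃).jump else 0) -
        (if (b₁₂ == b₃₁) == !ε then 0 else (Passage.mk y (!b₃₁) t₃₁).jump) := by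
  by_cases hv : t₃₁ = .virt
  · simp [Passage.jump, hv, h.2 hv]
  · have hv' : ¬ t₂₃ = .virt := fun h0 => hv (h.1 h0)
    cases b₁₂ <;> cases b₂₃ <;> cases b₃₁ <;> cases ε <;> simp [Passage.jump, hv, hv']

theorem wordPolynomial_triangle {A B C D : List Passage} {x y z : ℕ} {b₁₂ b₂₃ b₃₁ ε : Bool}
    {t₁₂ t₂₃ t₃₁ : CrossingType} (h : TriangleAllowed t₁₂ t₂₃ t₃₁ b₁₂ b₂₃ b₃₁)
    (hw : IsWord (threeBlocks A B C D ⟨x, b₁₂, t₁₂⟩ ⟨z, !b₃₁, t₃₁⟩ ⟨y, b₂₃, t₂₃⟩ ⟨x, !b₁₂, t₁₂⟩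
      ⟨z, b₃₁, t₃₁⟩ ⟨y, !b₂₃, t₂₃⟩ ((b₁₂ == b₃₁) == ε) ((b₂₃ == b₁₂) == ε) ((b₃₁ == b₂₃) == ε))) :
    wordPolynomial (threeBlocks A B C D ⟨x, b₁₂, t₁₂⟩ ⟨z, !b₃₁, t₃₁⟩ ⟨y, b₂₃, t₂₃⟩
      ⟨x, !b₁₂, t₁₂⟩ ⟨z, b₃₁, t₃₁⟩ ⟨y, !b₂₃, t₂₃⟩
      ((b₁₂ == b₃₁) == ε) ((b₂₃ == b₁₂) == ε) ((b₃₁ == b₂₃) == ε)) =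
    wordPolynomial (threeBlocks A B C D ⟨x, b₁₂, t₁₂⟩ ⟨z, !b₃₁, t₃₁⟩ ⟨y, b₂₃, t₂₃⟩
      ⟨x, !b₁₂, t₁₂⟩ ⟨z, b₃₁, t₃₁⟩ ⟨y, !b₂₃, t₂₃⟩
      ((b₁₂ == b₃₁) == !ε) ((b₂₃ == b₁₂) == !ε) ((b₃₁ == b₂₃) == !ε)) := by
  -- In a mixed triangle one strand is virtual at both of its crossings, so opposite a real crossing
  -- the other two are of the same kind. The over/under restriction plays no role for the index.
  have hx : t₁₂ ≠ .virt → (t₂₃ = .virt ↔ t₃₁ = .virt) := by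
    unfold TriangleAllowed at h; tauto
  have hy : t₂₃ ≠ .virt → (t₃₁ = .virt ↔ t₁₂ = .virt) := by
    unfold TriangleAllowed at h; tauto
  have hz : t₃₁ ≠ .virt → (t₁₂ = .virt ↔ t₂₃ = .virt) := by
    unfold TriangleAllowed at h; tauto
  exact wordPolynomial_threeBlocks (p₁ := ⟨x, b₁₂, t₁₂⟩) (p₂ := ⟨y, b₂₃, t₂₃⟩)
    (p₃ := ⟨z, b₃₁, t₃₁⟩) hw (fun h => jump_triangle (hx h) y z)
    (fun h => jump_triangle (hy h) z x) (fun h => jump_triangle (hz h) x y)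

theorem wordPolynomial_step {v w : List Passage} (h : Step v w) (hv : IsWord v) (hw : IsWord w) :
    wordPolynomial v = wordPolynomial w := by
  cases h with
  | relabel σ => exact (wordPolynomial_relabel σ.injective _).symm
  | basePoint A B => exact (wordPolynomial_rotate hv).symm
  | omega1 A B x b t => exact (wordPolynomial_curl hv hw).symm
  | omega2 A B C x y b d t => exact (wordPolynomial_bigon hv hw).symm
  | omega3 A B C D x y z b₁₂ b₂₃ b₃₁ ε t₁₂ t₂₃ t₃₁ h => exact wordPolynomial_triangle h hv

theorem wordPolynomial_eq_of_virtuallyEquivalent {D E : Diagram} (h : D.VirtuallyEquivalent E) :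
    wordPolynomial D.word = wordPolynomial E.word := by
  induction h with
  | rel D E h => exact wordPolynomial_step h D.isWord E.isWord
  | refl D => rfl
  | symm D E _ ih => exact ih.symm
  | trans D E F _ _ ih1 ih2 => exact ih1.trans ih2

/-! ### Arcs, indices and the Alexander numbering -/

theorem idxOf_append_cons {X Y : List Passage} {a : Passage} (h : a ∉ X) :
    (X ++ a :: Y).idxOf a = X.length := by
  rw [List.idxOf_append_of_notMem h]; simp

theorem takeWhile_ne_append_cons {R Y : List Passage} {b : Passage} (h : b ∉ R) :
    (R ++ b :: Y).takeWhile (fun p => p ≠ b) = R := by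
  rw [List.takeWhile_append_of_pos]
  · simp
  · intro p hp
    simp only [decide_not, Bool.not_eq_eq_eq_not, Bool.not_true, decide_eq_false_iff_not]
    rintro rfl
    exact h hp

/-- Rotating the word to its passage `a` puts `R` directly after `a`, up to `b`; rotating it to `b`
makes the other arc wrap around the base point as `Y ++ X`. -/
theorem Diagram.arc_of_split (D : Diagram) {X R Y : List Passage} {a b : Passage}
    (h : D.word = X ++ a :: R ++ b :: Y) : D.arc a b = R ∧ D.arc b a = Y ++ X := by
  have hnd := D.isWord.nodup
  rw [h] at hnd
  simp only [List.nodup_append, List.nodup_cons, List.mem_append, List.mem_cons] at hnd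
  have haX : a ∉ X := by grind
  have hbR : b ∉ R := by grind
  have hbX : b ∉ X ++ a :: R := by
    simp only [List.mem_append, List.mem_cons]; grind
  have haY : a ∉ Y ++ X := by simp only [List.mem_append]; grind
  constructor
  · unfold arc
    have h1 : D.word = X ++ a :: (R ++ b :: Y) := by simp [h]
    rw [h1, idxOf_append_cons haX, List.rotate_append_length_eq, List.cons_append, List.tail_cons,
      List.append_assoc, List.cons_append, takeWhile_ne_append_cons hbR]
  · unfold arc
    rw [h, idxOf_append_cons hbX, List.rotate_append_length_eq, List.cons_append, List.tail_cons,
      ← List.append_assoc, takeWhile_ne_append_cons haY]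

/-- The word, read from the passage `c` on. -/
theorem Diagram.exists_arcs (D : Diagram) {c : Passage} (hc : c ∈ D.word) :
    ∃ A B, D.word = A ++ B ∧ B ++ A = c :: D.rightArc c ++ c.mate :: D.leftArc c := by
  have hm := D.isWord.2 c hc
  unfold rightArc leftArc
  rcases before_total hc hm c.mate_ne.symm with h | h
  · obtain ⟨X, R, Y, h⟩ := before_iff_exists.1 h
    obtain ⟨h1, h2⟩ := D.arc_of_split h
    exact ⟨X, c :: R ++ c.mate :: Y, by simp [h], by simp [h1, h2]⟩
  · obtain ⟨X, R, Y, h⟩ := before_iff_exists.1 h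
    obtain ⟨h1, h2⟩ := D.arc_of_split h
    exact ⟨X ++ c.mate :: R, c :: Y, by simp [h], by simp [h1, h2]⟩

theorem isOver_mate {c : Passage} (hc : c.type ≠ .virt) : c.mate.IsOver ↔ ¬ c.IsOver := by
  obtain ⟨x, b, t⟩ := c
  cases t <;> cases b <;> simp_all [Passage.IsOver, Passage.mate]

theorem Passage.IsOver.type_ne {c : Passage} (hc : c.IsOver) : c.type ≠ .virt := by
  obtain ⟨x, b, t⟩ := c
  cases t <;> simp_all [Passage.IsOver]

/-- The dictionary between crossing directions and Gauss diagrams: an under-passage raises the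
numbering by the sign of the crossing, an over-passage lowers it by the sign, and a virtual passage
does neither. -/
theorem jump_eq (p : Passage) :
    p.jump = (if p.mate.IsOver then Diagram.sign p else 0) -
      (if p.IsOver then Diagram.sign p else 0) := by
  obtain ⟨x, b, t⟩ := p
  cases t <;> cases b <;> simp [Passage.IsOver, Passage.mate, Passage.jump, Diagram.sign]

theorem Passage.IsOver.jump {c : Passage} (hc : c.IsOver) : c.jump = -Diagram.sign c := by
  rw [jump_eq, if_pos hc, if_neg (fun h => (isOver_mate hc.type_ne).1 h hc)]
  ring

theorem Diagram.mem_chords {D : Diagram} {c : Passage} : c ∈ D.chords ↔ c ∈ D.word ∧ c.IsOver := by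
  simp [chords]

/-- The chords that cross `c` from left to right. -/
def Diagram.rightward (D : Diagram) (c : Passage) : Finset Passage :=
  D.chords.filter fun d => d ∈ D.leftArc c ∧ d.mate ∈ D.rightArc c

/-- The chords that cross `c` from right to left. -/
def Diagram.leftward (D : Diagram) (c : Passage) : Finset Passage :=
  D.chords.filter fun d => d ∈ D.rightArc c ∧ d.mate ∈ D.leftArc c

theorem sum_sign {s : Finset Passage} (h : ∀ d ∈ s, d.IsOver) :
    ∑ d ∈ s, Diagram.sign d = ((s.filter fun d => d.type = .positive).card : ℤ) -
      ((s.filter fun d => d.type = .negative).card : ℤ) := by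
  rw [Finset.card_filter, Finset.card_filter]
  push_cast
  rw [← Finset.sum_sub_distrib]
  refine Finset.sum_congr rfl fun d hd => ?_
  have := (h d hd).type_ne
  cases ht : d.type <;> simp_all [Diagram.sign]

theorem Diagram.r_eq (D : Diagram) (s : CrossingType) (c : Passage) :
    D.r s c = ((D.rightward c).filter fun d => d.type = s).card := by
  unfold r rightward
  rw [Finset.filter_filter]
  congr 1
  ext d
  simp only [Finset.mem_filter]
  tauto

theorem Diagram.l_eq (D : Diagram) (s : CrossingType) (c : Passage) :
    D.l s c = ((D.leftward c).filter fun d => d.type = s).card := by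
  unfold l leftward
  rw [Finset.filter_filter]
  congr 1
  ext d
  simp only [Finset.mem_filter]
  tauto

theorem Diagram.index_eq_sum_sign (D : Diagram) (c : Passage) :
    D.index c = ∑ d ∈ D.rightward c, sign d - ∑ d ∈ D.leftward c, sign d := by
  have h1 : ∀ d ∈ D.rightward c, d.IsOver := fun d hd =>
    (mem_chords.1 (Finset.mem_filter.1 hd).1).2
  have h2 : ∀ d ∈ D.leftward c, d.IsOver := fun d hd =>
    (mem_chords.1 (Finset.mem_filter.1 hd).1).2
  rw [sum_sign h1, sum_sign h2, index, r_eq, r_eq, l_eq, l_eq]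
  ring

theorem Diagram.mem_arcs (D : Diagram) {c : Passage} (hc : c ∈ D.word) :
    (∀ d, d ∈ D.word ↔ d = c ∨ d = c.mate ∨ d ∈ D.rightArc c ∨ d ∈ D.leftArc c) ∧
    (c ∉ D.rightArc c ∧ c ∉ D.leftArc c ∧ c.mate ∉ D.rightArc c ∧ c.mate ∉ D.leftArc c) ∧
    (D.rightArc c).Nodup ∧ (D.leftArc c).Nodup ∧ ∀ d ∈ D.rightArc c, d ∉ D.leftArc c := by
  obtain ⟨A, B, hw, hr⟩ := D.exists_arcs hc
  have hp : D.word.Perm (c :: D.rightArc c ++ c.mate :: D.leftArc c) := by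
    rw [← hr, hw]; exact List.perm_append_comm
  have hnd := hp.nodup D.isWord.nodup
  refine ⟨fun d => ?_, ?_⟩
  · rw [hp.mem_iff]; simp; tauto
  · simp only [List.nodup_append, List.nodup_cons, List.mem_cons] at hnd
    grind

theorem Diagram.wordIndex_eq_totalJump (D : Diagram) {c : Passage} (hc : c ∈ D.word) :
    wordIndex D.word c = totalJump (D.rightArc c) := by
  obtain ⟨A, B, hw, hr⟩ := D.exists_arcs hc
  have hW := D.isWord
  rw [hw] at hW hc
  rw [hw, ← wordIndex_rotate hW hc, hr, VirtualKnot.wordIndex_eq_totalJump]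
  rw [← hr]
  exact List.perm_append_comm.nodup hW.nodup

/-- Sum the jumps along the right arc of `c`. A chord with both ends there cancels, a head counts
with its sign, a tail with the opposite sign; what survives is rightward minus leftward chords. -/
theorem Diagram.index_eq_wordIndex (D : Diagram) {c : Passage} (hc : c ∈ D.word) :
    D.index c = wordIndex D.word c := by
  obtain ⟨hmem, ⟨c1, c2, c3, c4⟩, hR, hL, hdisj⟩ := D.mem_arcs hc
  rw [D.index_eq_sum_sign, D.wordIndex_eq_totalJump hc, totalJump_toFinset hR,
    Finset.sum_congr rfl fun p _ => jump_eq p, Finset.sum_sub_distrib]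
  have e1 : ∑ p ∈ (D.rightArc c).toFinset, (if p.mate.IsOver then sign p else 0) =
      ∑ d ∈ D.chords, if d.mate ∈ D.rightArc c then sign d else 0 := by
    rw [← Finset.sum_filter, ← Finset.sum_filter]
    refine Finset.sum_nbij' Passage.mate Passage.mate ?_ ?_ ?_ ?_ ?_
    · intro p hp
      simp only [Finset.mem_filter, List.mem_toFinset, mem_chords, Passage.mate_mate] at hp ⊢
      exact ⟨⟨D.isWord.2 _ ((hmem p).2 (by tauto)), hp.2⟩, hp.1⟩
    · intro p hp
      simp only [Finset.mem_filter, List.mem_toFinset, mem_chords, Passage.mate_mate] at hp ⊢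
      tauto
    · simp
    · simp
    · intro p _; rfl
  have e2 : ∑ p ∈ (D.rightArc c).toFinset, (if p.IsOver then sign p else 0) =
      ∑ d ∈ D.chords, if d ∈ D.rightArc c then sign d else 0 := by
    rw [← Finset.sum_filter, ← Finset.sum_filter]
    congr 1
    ext p
    simp only [Finset.mem_filter, List.mem_toFinset, mem_chords]
    have := hmem p
    tauto
  rw [e1, e2, rightward, leftward, Finset.sum_filter, Finset.sum_filter,
    ← Finset.sum_sub_distrib, ← Finset.sum_sub_distrib]
  refine Finset.sum_congr rfl fun d hd => ?_
  have hdw := (mem_chords.1 hd).1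
  have hmw := D.isWord.2 d hdw
  by_cases h1 : d = c
  · subst h1; simp [c1, c2, c3]
  by_cases h2 : d = c.mate
  · subst h2; simp [c1, c3, c4]
  have h3 : d.mate ≠ c := fun h => h2 (Passage.mate_eq_iff.1 h)
  have h4 : d.mate ≠ c.mate := fun h => h1 (Passage.mate_injective h)
  have m1 := (hmem d).1 hdw
  have m2 := (hmem d.mate).1 hmw
  have d1 := hdisj d
  have d2 := hdisj d.mate
  by_cases hd1 : d ∈ D.rightArc c <;> by_cases hd2 : d.mate ∈ D.rightArc c <;> simp_all

theorem Diagram.writhePolynomial_eq (D : Diagram) :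
    D.writhePolynomial = wordPolynomial D.word := by
  unfold writhePolynomial wordPolynomial
  rw [← List.sum_toFinset _ D.isWord.nodup, Finset.sum_filter, chords, List.toFinset_filter,
    Finset.sum_filter]
  refine Finset.sum_congr rfl fun c hc => ?_
  rw [D.index_eq_wordIndex (List.mem_toFinset.1 hc)]
  unfold writheTerm
  by_cases h1 : c.IsOver <;> simp [h1]

/-! ### Planar classical words have an Alexander numbering -/

section Planar

variable {u : List (ℕ × Bool)}

/-- A function that is constant along the curve is constant. -/
theorem eq_of_pre_eq {α : Type*} (hu : u.Nodup) {φ : {e // e ∈ u} → α}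
    (h : ∀ e, φ (pre u e) = φ e) (e e' : {e // e ∈ u}) : φ e = φ e' := by
  have key : ∀ (i : ℕ) (hi : i < u.length) (h0 : 0 < u.length),
      φ ⟨u[i], List.getElem_mem hi⟩ = φ ⟨u[0], List.getElem_mem h0⟩ := by
    intro i
    induction i with
    | zero => intro _ _; rfl
    | succ i ih =>
      intro hi h0
      rw [← ih (by omega) h0, ← h]
      congr 1
      apply Subtype.ext
      show u.prev _ _ = _
      rw [List.prev_getElem u hu (i + 1) hi]
      congr 1
      have : i + 1 + (u.length - 1) = i + u.length := by omega
      rw [this, Nat.add_mod_right, Nat.mod_eq_of_lt (by omega)]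
  obtain ⟨e, he⟩ := e
  obtain ⟨e', he'⟩ := e'
  obtain ⟨i, hi, rfl⟩ := List.getElem_of_mem he
  obtain ⟨j, hj, rfl⟩ := List.getElem_of_mem he'
  rw [key i hi (by omega), key j hj (by omega)]

/-- The value of a function on faces at a side of an edge. -/
def faceVal {u : List (ℕ × Bool)} (f : Face u → ℚ) (e : {e // e ∈ u}) (s : Side) : ℚ :=
  f (Quot.mk _ (e, s))

/-- The difference of the values of a function on faces at the two sides of an edge. -/
def coboundary {u : List (ℕ × Bool)} (f : Face u → ℚ) (e : {e // e ∈ u}) : ℚ :=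
  faceVal f e .left - faceVal f e .right

theorem coboundary_add (f g : Face u → ℚ) (e : {e // e ∈ u}) :
    coboundary (f + g) e = coboundary f e + coboundary g e :=
  add_sub_add_comm _ _ _ _

theorem coboundary_smul (a : ℚ) (f : Face u → ℚ) (e : {e // e ∈ u}) :
    coboundary (a • f) e = a * coboundary f e :=
  (mul_sub _ _ _).symm

theorem faceVal_corner (f : Face u → ℚ) {x : ℕ} {j k : {e // e ∈ u}} (hj : j.1 = (x, true))
    (hk : k.1 = (x, false)) :
    faceVal f j .left = faceVal f k .right ∧ faceVal f (pre u j) .left = faceVal f k .left ∧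
      faceVal f (pre u j) .right = faceVal f (pre u k) .left ∧
      faceVal f j .right = faceVal f (pre u k) .right :=
  ⟨congrArg f (Quot.sound (.northEast x j k hj hk)), congrArg f (Quot.sound (.northWest x j k hj hk)),
    congrArg f (Quot.sound (.southWest x j k hj hk)),
    congrArg f (Quot.sound (.southEast x j k hj hk))⟩

/-- A dimension count replaces topology. Requiring constant coboundary along the curve is one linear
condition per crossing, and prescribing its value at one edge is one more. The homogeneous system
has only the constant functions as solutions, and planarity supplies at least `V + 2` faces, so the
system of `V + 1` conditions is solvable for every right-hand side. -/
theorem exists_coboundary_eq_one (hu : u.Nodup) (hm : ∀ x b, (x, b) ∈ u → (x, !b) ∈ u)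
    (hne : u ≠ []) (hpl : 2 ≤ eulerChar u) :
    ∃ f : Face u → ℚ, ∀ e, coboundary f e = 1 := by
  classical
  obtain ⟨e₀, he₀⟩ := List.exists_mem_of_ne_nil u hne
  let V := {x : ℕ // (x, true) ∈ u}
  have fE : Fintype {e // e ∈ u} := List.Subtype.fintype u
  have hE : Fintype.card {e // e ∈ u} = u.length := by
    rw [Fintype.card_of_subtype u.toFinset (by simp), List.toFinset_card_of_nodup hu]
  have fV : Finite V := Finite.of_injective (fun x : V => (⟨_, x.2⟩ : {e // e ∈ u})) (by
    intro x y h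
    exact Subtype.ext (by simpa using h))
  have fV' : Fintype V := Fintype.ofFinite V
  have : Finite (Face u) := inferInstanceAs (Finite (Quot _))
  have fF : Fintype (Face u) := Fintype.ofFinite _
  have hV : 2 * Fintype.card V ≤ u.length := by
    have : Fintype.card (V × Bool) ≤ Fintype.card {e // e ∈ u} := by
      refine Fintype.card_le_of_injective
        (fun x => ⟨(x.1.1, x.2), ?_⟩) ?_
      · obtain ⟨⟨x, hx⟩, b⟩ := x
        cases b
        · exact hm x true hx
        · exact hx
      · rintro ⟨⟨x, hx⟩, b⟩ ⟨⟨y, hy⟩, d⟩ h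
        simp only [Subtype.mk.injEq, Prod.mk.injEq] at h
        simp [h.1, h.2]
    rw [Fintype.card_prod, Fintype.card_bool, hE] at this
    omega
  -- With at least two edges per crossing, Euler characteristic at least `2` gives this number of
  -- faces.
  have hF : Fintype.card V + 2 ≤ Fintype.card (Face u) := by
    unfold eulerChar at hpl
    rw [Nat.card_eq_fintype_card] at hpl
    omega
  let Θ : (Face u → ℚ) →ₗ[ℚ] ℚ × (V → ℚ) :=
    { toFun := fun f => (coboundary f ⟨e₀, he₀⟩,
        fun x => coboundary f ⟨_, x.2⟩ - coboundary f (pre u ⟨_, x.2⟩))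
      map_add' := by
        intro f g
        ext <;> simp [coboundary_add]
        ring
      map_smul' := by
        intro a f
        ext <;> simp [coboundary_smul, mul_sub] }
  -- Around a crossing the four corner identities make the change of coboundary along one strand the
  -- negative of that along the other. One condition per crossing therefore controls both strands.
  have hflow : ∀ f : Face u → ℚ, (∀ x : V, coboundary f ⟨_, x.2⟩ =
      coboundary f (pre u ⟨_, x.2⟩)) → ∀ e, coboundary f (pre u e) = coboundary f e := by
    intro f hf e
    obtain ⟨⟨x, b⟩, he⟩ := e
    cases b
    · have h' := hm x false he
      obtain ⟨h1, h2, h3, h4⟩ := faceVal_corner f (j := ⟨_, h'⟩) (k := ⟨_, he⟩) rfl rfl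
      have := hf ⟨x, h'⟩
      unfold coboundary at *
      simp only [Bool.not_false] at *
      linarith
    · exact (hf ⟨x, he⟩).symm
  -- If the coboundary vanishes everywhere, the two sides of each edge carry one value, and the
  -- corners pass this value on along the whole curve.
  have hker : Module.finrank ℚ (LinearMap.ker Θ) ≤ 1 := by
    refine finrank_le_one (⟨fun _ => 1, ?_⟩ : LinearMap.ker Θ) ?_
    · rw [LinearMap.mem_ker]
      ext <;> simp [Θ, coboundary, faceVal]
    · rintro ⟨f, hf⟩
      rw [LinearMap.mem_ker] at hf
      have hf1 : coboundary f ⟨e₀, he₀⟩ = 0 := congrArg Prod.fst hf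
      have hf2 : ∀ x : V, coboundary f ⟨_, x.2⟩ = coboundary f (pre u ⟨_, x.2⟩) := fun x =>
        sub_eq_zero.1 (congrFun (congrArg Prod.snd hf) x)
      have h0 : ∀ e, coboundary f e = 0 := fun e =>
        (eq_of_pre_eq hu (hflow f hf2) e ⟨e₀, he₀⟩).trans hf1
      have hlr : ∀ e, faceVal f e .left = faceVal f e .right := fun e => sub_eq_zero.1 (h0 e)
      have hpre : ∀ e, faceVal f (pre u e) .left = faceVal f e .left := by
        rintro ⟨⟨x, b⟩, he⟩
        have h' := hm x b he
        cases b
        · obtain ⟨h1, h2, h3, h4⟩ := faceVal_corner f (j := ⟨_, h'⟩) (k := ⟨_, he⟩) rfl rfl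
          rw [← h3, ← hlr, h2]
        · obtain ⟨h1, h2, h3, h4⟩ := faceVal_corner f (j := ⟨_, he⟩) (k := ⟨_, h'⟩) rfl rfl
          rw [h1, ← hlr, h2]
      refine ⟨faceVal f ⟨e₀, he₀⟩ .left, Subtype.ext (funext fun y => ?_)⟩
      induction y using Quot.ind with
      | mk y =>
        obtain ⟨e, s⟩ := y
        have h1 := eq_of_pre_eq (φ := fun e => faceVal f e .left) hu hpre e ⟨e₀, he₀⟩
        have h2 : faceVal f e s = faceVal f e .left := by
          cases s
          · rfl
          · exact (hlr e).symm
        exact (mul_one _).trans (h2.trans h1).symm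
  have hrk := LinearMap.finrank_range_add_finrank_ker Θ
  rw [Module.finrank_fintype_fun_eq_card] at hrk
  have htop : LinearMap.range Θ = ⊤ := by
    apply Submodule.eq_top_of_finrank_eq
    refine le_antisymm (Submodule.finrank_le _) ?_
    rw [Module.finrank_prod, Module.finrank_self, Module.finrank_fintype_fun_eq_card]
    omega
  -- Value `1` at the chosen edge and no change at any crossing: the Alexander numbering of the
  -- faces.
  obtain ⟨f, hf⟩ := LinearMap.range_eq_top.1 htop (1, 0)
  have hf1 : coboundary f ⟨e₀, he₀⟩ = 1 := congrArg Prod.fst hf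
  have hf2 : ∀ x : V, coboundary f ⟨_, x.2⟩ = coboundary f (pre u ⟨_, x.2⟩) := fun x =>
    sub_eq_zero.1 (congrFun (congrArg Prod.snd hf) x)
  exact ⟨f, fun e => (eq_of_pre_eq hu (hflow f hf2) e ⟨e₀, he₀⟩).trans hf1⟩

end Planar

theorem level_getElem {w : List Passage} (hw : w.Nodup) (i : ℕ) (hi : i + 1 < w.length) :
    level w w[i + 1] = level w w[i] + w[i].jump := by
  induction w generalizing i with
  | nil => simp at hi
  | cons q w ih =>
    have hq := (List.nodup_cons.1 hw).1
    have hne : ∀ (k : ℕ) (hk : k < w.length), q ≠ w[k] := by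
      rintro k hk rfl
      exact hq (List.getElem_mem hk)
    cases i with
    | zero =>
      cases w with
      | nil => simp at hi
      | cons r w =>
        have : q ≠ r := hne 0 (by simp)
        simp [level_cons, this]
    | succ i =>
      have hi' : i + 1 < w.length := by simpa using hi
      simp only [List.getElem_cons_succ, level_cons, hne, if_false]
      rw [ih (List.nodup_cons.1 hw).2 i hi']
      ring

/-- In a classical word every passage jumps by one, just as the face to the left of the strand does
in the Alexander numbering. So levels are face numbers up to a constant, and both strands at a
crossing read off the same faces. -/
theorem wordIndex_eq_zero {w : List Passage} (hw : IsWord w) (hpl : Planar (keys w))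
    (hcl : ∀ p ∈ w, p.type ≠ .virt) {c : Passage} (hc : c ∈ w) : wordIndex w c = 0 := by
  have hkne : keys w ≠ [] := by
    intro h
    have : (c.label, c.ltr) ∈ keys w := List.mem_map.2 ⟨c, hc, rfl⟩
    simp [h] at this
  obtain ⟨f, hf⟩ := exists_coboundary_eq_one hw.1 (keys_mate hw) hkne
    (hpl.resolve_left hkne)
  have hk : ∀ p ∈ w, (p.label, p.ltr) ∈ keys w := fun p hp => List.mem_map.2 ⟨p, hp, rfl⟩
  -- Passing the crossing moves the left face across the other strand, whose left side is numbered
  -- one higher than its right side. Reality of the crossing is used here: a virtual passage has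
  -- jump zero.
  have hstep : ∀ p (hp : p ∈ w), faceVal f ⟨_, hk p hp⟩ .left =
      faceVal f (pre _ ⟨_, hk p hp⟩) .left + p.jump := by
    rintro ⟨x, b, t⟩ hp
    have ht := hcl _ hp
    have h' := keys_mate hw x b (hk _ hp)
    cases b
    · obtain ⟨h1, h2, h3, h4⟩ := faceVal_corner f (j := ⟨_, h'⟩) (k := ⟨_, hk _ hp⟩) rfl rfl
      have := hf (pre _ ⟨_, h'⟩)
      unfold coboundary at this
      simp only [Passage.jump] at *
      simp [ht]
      linarith
    · obtain ⟨h1, h2, h3, h4⟩ := faceVal_corner f (j := ⟨_, hk _ hp⟩) (k := ⟨_, h'⟩) rfl rfl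
      have := hf ⟨_, h'⟩
      unfold coboundary at this
      simp only [Passage.jump] at *
      simp [ht]
      linarith
  have hlen : (keys w).length = w.length := by simp [keys]
  have h0 : 0 < w.length := List.length_pos_of_mem hc
  have hlev : ∀ (i : ℕ) (hi : i < w.length), faceVal f (pre _ ⟨_, hk _ (List.getElem_mem hi)⟩) .left =
      faceVal f (pre _ ⟨_, hk _ (List.getElem_mem h0)⟩) .left + level w w[i] := by
    intro i
    induction i with
    | zero =>
      intro hi
      have : level w w[0] = 0 := by
        cases w with
        | nil => simp at hi
        | cons q w => simp [level_cons]
      simp [this]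
    | succ i ih =>
      intro hi
      rw [level_getElem hw.nodup i hi]
      have h1 := hstep _ (List.getElem_mem (show i < w.length by omega))
      rw [ih (by omega)] at h1
      have h2 : pre (keys w) ⟨_, hk _ (List.getElem_mem hi)⟩ =
          ⟨_, hk _ (List.getElem_mem (show i < w.length by omega))⟩ := by
        apply Subtype.ext
        have h3 : ∀ (k : ℕ) (hk : k < w.length), (w[k].label, w[k].ltr) =
            (keys w)[k]'(by omega) := by
          intro k hk; simp [keys]
        show (keys w).prev _ _ = _
        have h4 := List.prev_getElem (keys w) hw.1 (i + 1) (by omega)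
        have h5 : (i + 1 + ((keys w).length - 1)) % (keys w).length = i := by
          have : i + 1 + ((keys w).length - 1) = i + (keys w).length := by omega
          rw [this, Nat.add_mod_right, Nat.mod_eq_of_lt (by omega)]
        simp only [h5] at h4
        simp only [h3]
        exact h4
      rw [h2, h1]
      push_cast
      ring
  have hlev' : ∀ p (hp : p ∈ w), faceVal f (pre _ ⟨_, hk _ hp⟩) .left =
      faceVal f (pre _ ⟨_, hk _ (List.getElem_mem h0)⟩) .left + level w p := by
    intro p hp
    obtain ⟨i, hi, rfl⟩ := List.getElem_of_mem hp
    exact hlev i hi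
  -- For a right-to-left passage this is a single corner of the crossing; for a left-to-right
  -- passage the numbers of the two faces agree although the faces are opposite corners.
  have hover : ∀ p (hp : p ∈ w), faceVal f ⟨_, hk _ hp⟩ .left =
      faceVal f (pre _ ⟨_, hk _ (hw.2 p hp)⟩) .left := by
    rintro ⟨x, b, t⟩ hp
    have h' := keys_mate hw x b (hk _ hp)
    cases b
    · obtain ⟨h1, h2, h3, h4⟩ := faceVal_corner f (j := ⟨_, h'⟩) (k := ⟨_, hk _ hp⟩) rfl rfl
      exact h2.symm
    · obtain ⟨h1, h2, h3, h4⟩ := faceVal_corner f (j := ⟨_, hk _ hp⟩) (k := ⟨_, h'⟩) rfl rfl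
      have e1 := hf ⟨_, h'⟩
      have e2 := hf (pre _ ⟨_, h'⟩)
      have e3 := hf ⟨_, hk _ hp⟩
      unfold coboundary at e1 e2 e3
      show _ = faceVal f (pre _ ⟨_, h'⟩) .left
      simp only at *
      linarith
  have h1 := hover c hc
  rw [hstep c hc, hlev' c hc, hlev' _ (hw.2 c hc)] at h1
  unfold wordIndex
  have : ((level w c.mate - level w c - c.jump : ℤ) : ℚ) = 0 := by
    push_cast
    linarith
  exact_mod_cast this

/-! ### The Polyak-Viro formula for the second coefficient of the Conway polynomial -/

/-- The passages of the crossings of `p` and `q` alternate, in the order `p, q, p.mate, q.mate`. -/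
def Interlaced (w : List Passage) (p q : Passage) : Prop :=
  Before w p q ∧ Before w q p.mate ∧ Before w p.mate q.mate

instance (w : List Passage) (p q : Passage) : Decidable (Interlaced w p q) :=
  inferInstanceAs (Decidable (_ ∧ _))

/-- The contribution of a pair of passages to the Polyak-Viro formula. -/
def cassonTerm (w : List Passage) (p q : Passage) : ℤ :=
  if p.IsOver ∧ ¬ q.IsOver ∧ Interlaced w p q then Diagram.sign p * Diagram.sign q else 0

/-- The Polyak-Viro formula for the Casson invariant of a based classical diagram. -/
def casson (w : List Passage) : ℤ := ∑ p ∈ w.toFinset, ∑ q ∈ w.toFinset, cassonTerm w p q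

theorem cassonTerm_congr {v w : List Passage} {p q : Passage}
    (h : Interlaced v p q ↔ Interlaced w p q) : cassonTerm v p q = cassonTerm w p q := by
  unfold cassonTerm
  simp only [h]

theorem cassonTerm_eq_zero {w : List Passage} {p q : Passage} (h : ¬ Interlaced w p q) :
    cassonTerm w p q = 0 := if_neg fun h' => h h'.2.2

/-! ### The Polyak-Viro sum under relabelling and insertion of passages -/

theorem before_map {f : Passage → Passage} (hf : Function.Injective f) {w : List Passage}
    {a b : Passage} : Before (w.map f) (f a) (f b) ↔ Before w a b := by
  induction w with
  | nil => simp
  | cons x w ih => simp [before_cons, ih, hf.eq_iff]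

theorem casson_relabel {f : ℕ → ℕ} (hf : Function.Injective f) (w : List Passage) :
    casson (w.map fun p => { p with label := f p.label }) = casson w := by
  have hinj := relabel_injective hf
  have hset : (w.map fun p : Passage => { p with label := f p.label }).toFinset =
      w.toFinset.map ⟨_, hinj⟩ := by
    ext p; simp
  unfold casson
  rw [hset, Finset.sum_map]
  refine Finset.sum_congr rfl fun p _ => ?_
  rw [Finset.sum_map]
  refine Finset.sum_congr rfl fun q _ => ?_
  have hI : Interlaced (w.map fun p => { p with label := f p.label })
      { p with label := f p.label } { q with label := f q.label } ↔ Interlaced w p q := by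
    have hb := fun a b => before_map hinj (w := w) (a := a) (b := b)
    exact and_congr (hb p q) (and_congr (hb q p.mate) (hb p.mate q.mate))
  show cassonTerm _ _ _ = _
  unfold cassonTerm
  simp only [Function.Embedding.coeFn_mk, hI]
  rfl

theorem interlaced_iff_of_sublist {w s : List Passage} {p q : Passage} (hw : w.Nodup)
    (hs : IsWord s) (hsw : s.Sublist w) (hp : p ∈ s) (hq : q ∈ s) :
    Interlaced w p q ↔ Interlaced s p q := by
  have hp' := hs.2 p hp
  have hq' := hs.2 q hq
  unfold Interlaced
  rw [before_iff_of_sublist hw hsw hp hq, before_iff_of_sublist hw hsw hq hp',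
    before_iff_of_sublist hw hsw hp' hq']

/-- Terms among old passages depend only on the subword `s`, so it suffices that the new passages
`N` cancel against each fixed old passage and do not interact among themselves. Curl and bigon both
have this shape. -/
theorem casson_insert {w s : List Passage} {N : Finset Passage} (hw : w.Nodup) (hs : IsWord s)
    (hsw : s.Sublist w) (hset : w.toFinset = s.toFinset ∪ N) (hdisj : ∀ p ∈ s, p ∉ N)
    (h1 : ∀ p ∈ s, ∑ q ∈ N, cassonTerm w p q = 0) (h2 : ∀ q ∈ s, ∑ p ∈ N, cassonTerm w p q = 0)
    (h3 : ∀ p ∈ N, ∀ q ∈ N, cassonTerm w p q = 0) : casson w = casson s := by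
  have hd : Disjoint s.toFinset N := Finset.disjoint_left.2 fun p hp => hdisj p (by simpa using hp)
  unfold casson
  rw [hset, Finset.sum_union hd]
  have e2 : ∑ p ∈ N, ∑ q ∈ s.toFinset ∪ N, cassonTerm w p q = 0 := by
    rw [Finset.sum_comm]
    refine Finset.sum_eq_zero fun q hq => ?_
    rcases Finset.mem_union.1 hq with hq | hq
    · exact h2 q (by simpa using hq)
    · exact Finset.sum_eq_zero fun p hp => h3 p hp q hq
  rw [e2, add_zero]
  refine Finset.sum_congr rfl fun p hp => ?_
  have hp' : p ∈ s := by simpa using hp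
  rw [Finset.sum_union hd, h1 p hp', add_zero]
  refine Finset.sum_congr rfl fun q hq => ?_
  exact cassonTerm_congr (interlaced_iff_of_sublist hw hs hsw hp' (by simpa using hq))

/-! ### The curl and bigon moves and the Polyak-Viro sum -/

theorem before_adjacent {X Y : List Passage} {a b c : Passage} (hw : (X ++ [a, b] ++ Y).Nodup)
    (ha : c ≠ a) (hb : c ≠ b) :
    (Before (X ++ [a, b] ++ Y) a c ↔ Before (X ++ [a, b] ++ Y) b c) ∧
      (Before (X ++ [a, b] ++ Y) c a ↔ Before (X ++ [a, b] ++ Y) c b) := by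
  have l1 := fun h : Before X a c => h.left_mem
  have l2 := fun h : Before X b c => h.left_mem
  have l3 := fun h : Before Y a c => h.left_mem
  have l4 := fun h : Before Y b c => h.left_mem
  have l5 := fun h : Before X c a => h.right_mem
  have l6 := fun h : Before X c b => h.right_mem
  have l7 := fun h : Before Y c a => h.right_mem
  have l8 := fun h : Before Y c b => h.right_mem
  simp only [before_append, before_cons, List.nodup_append, List.mem_append, List.mem_cons,
    not_before_nil, List.not_mem_nil] at *
  constructor <;> grind

/-- No passage lies between the two adjacent passages of a curl, so its chord is interlaced with no
other. -/
theorem casson_curl {A B : List Passage} {p : Passage} (h : IsWord (A ++ B))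
    (h' : IsWord (A ++ [p, p.mate] ++ B)) :
    casson (A ++ [p, p.mate] ++ B) = casson (A ++ B) := by
  have hnd := h'.nodup
  have hadj : ∀ c, Before (A ++ [p, p.mate] ++ B) p c → ¬ Before (A ++ [p, p.mate] ++ B) c p.mate := by
    intro c h1 h2
    exact before_asymm hnd h2 ((before_adjacent hnd (h1.ne hnd).symm (h2.ne hnd)).1.1 h1)
  have hord : Before (A ++ [p, p.mate] ++ B) p p.mate := by
    simp [before_append, before_cons]
  have hnot : ∀ r q, r ∈ [p, p.mate] ∨ q ∈ [p, p.mate] →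
      ¬ Interlaced (A ++ [p, p.mate] ++ B) r q := by
    rintro r q hm ⟨i1, i2, i3⟩
    simp only [List.mem_cons, List.not_mem_nil, or_false] at hm
    rcases hm with (rfl | rfl) | (rfl | rfl)
    · exact hadj _ i1 i2
    · rw [Passage.mate_mate] at i2
      exact before_asymm hnd hord (before_trans hnd i1 i2)
    · exact hadj _ i2 i3
    · rw [Passage.mate_mate] at i3
      exact before_asymm hnd hord (before_trans hnd i2 i3)
  refine casson_insert (N := [p, p.mate].toFinset) hnd h ?_ ?_ ?_ ?_ ?_ ?_
  · exact (List.sublist_append_left A _).append_right B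
  · ext r; simp only [List.mem_toFinset, List.mem_append, Finset.mem_union]; tauto
  · intro r hr h0
    rw [List.mem_toFinset] at h0
    simp only [List.nodup_append, List.mem_append] at hnd hr
    grind
  · exact fun r _ => Finset.sum_eq_zero fun q hq =>
      cassonTerm_eq_zero (hnot r q (Or.inr (List.mem_toFinset.1 hq)))
  · exact fun q _ => Finset.sum_eq_zero fun r hr =>
      cassonTerm_eq_zero (hnot r q (Or.inl (List.mem_toFinset.1 hr)))
  · exact fun r hr q _ => cassonTerm_eq_zero (hnot r q (Or.inl (List.mem_toFinset.1 hr)))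

/-- Seen from any other chord, `p` and `q` are in the same position and at the same level, but have
opposite signs, so their terms cancel in pairs. -/
theorem casson_bigon {A B C : List Passage} {p q : Passage} {d : Bool} (h : IsWord (A ++ B ++ C))
    (h' : IsWord (A ++ [p, q] ++ B ++ inOrder d p.mate q.mate ++ C)) (hp : p.type ≠ .virt)
    (hq : q.type ≠ .virt) (hover : p.IsOver ↔ q.IsOver)
    (hsign : Diagram.sign q = -Diagram.sign p) :
    casson (A ++ [p, q] ++ B ++ inOrder d p.mate q.mate ++ C) = casson (A ++ B ++ C) := by
  have hnd := h'.nodup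
  have hmo := isOver_mate hp
  have hqo := isOver_mate hq
  have hpq : p ≠ q := by
    simp only [List.nodup_append] at hnd
    simpa using hnd.1.1.1.2.1
  have hdis : ∀ r ∈ A ++ B ++ C, r ≠ p ∧ r ≠ q ∧ r ≠ p.mate ∧ r ≠ q.mate := by
    intro r hr
    have i1 : p.mate ∈ inOrder d p.mate q.mate := mem_inOrder.2 (Or.inl rfl)
    have i2 : q.mate ∈ inOrder d p.mate q.mate := mem_inOrder.2 (Or.inr rfl)
    simp only [List.nodup_append, List.mem_append, List.mem_cons] at hnd hr
    grind
  have hfst : ∀ c, c ≠ p → c ≠ q →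
      (Before (A ++ [p, q] ++ B ++ inOrder d p.mate q.mate ++ C) p c ↔
        Before (A ++ [p, q] ++ B ++ inOrder d p.mate q.mate ++ C) q c) ∧
      (Before (A ++ [p, q] ++ B ++ inOrder d p.mate q.mate ++ C) c p ↔
        Before (A ++ [p, q] ++ B ++ inOrder d p.mate q.mate ++ C) c q) := by
    intro c h1 h2
    have := before_adjacent (X := A) (Y := B ++ inOrder d p.mate q.mate ++ C) (c := c)
      (by simpa using hnd) h1 h2
    simpa using this
  have hsnd : ∀ c, c ≠ p.mate → c ≠ q.mate →
      (Before (A ++ [p, q] ++ B ++ inOrder d p.mate q.mate ++ C) p.mate c ↔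
        Before (A ++ [p, q] ++ B ++ inOrder d p.mate q.mate ++ C) q.mate c) ∧
      (Before (A ++ [p, q] ++ B ++ inOrder d p.mate q.mate ++ C) c p.mate ↔
        Before (A ++ [p, q] ++ B ++ inOrder d p.mate q.mate ++ C) c q.mate) := by
    intro c h1 h2
    cases d
    · have := before_adjacent (X := A ++ [p, q] ++ B) (Y := C) (c := c) hnd h2 h1
      exact ⟨this.1.symm, this.2.symm⟩
    · exact before_adjacent (X := A ++ [p, q] ++ B) (Y := C) (c := c) hnd h1 h2
  have hblock : ∀ a ∈ [p, q], ∀ b ∈ [p.mate, q.mate],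
      Before (A ++ [p, q] ++ B ++ inOrder d p.mate q.mate ++ C) a b := by
    intro a ha b hb
    have : b ∈ inOrder d p.mate q.mate := mem_inOrder.2 (by simpa using hb)
    rw [before_append, before_append]
    exact Or.inl (Or.inr (Or.inl ⟨by simp only [List.mem_append, ha]; tauto, this⟩))
  generalize hw : A ++ [p, q] ++ B ++ inOrder d p.mate q.mate ++ C = w at *
  have hback : ∀ a ∈ [p, q], ∀ b ∈ [p.mate, q.mate], ¬ Before w b a := fun a ha b hb =>
    before_asymm hnd (hblock a ha b hb)
  have hmate : ∀ r ∈ A ++ B ++ C, r.mate ∈ A ++ B ++ C := h.2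
  have hleft : ∀ r ∈ A ++ B ++ C, cassonTerm w p r + cassonTerm w q r = 0 ∧
      cassonTerm w p.mate r + cassonTerm w q.mate r = 0 := by
    intro r hr
    obtain ⟨r1, r2, r3, r4⟩ := hdis r hr
    obtain ⟨s1, s2, s3, s4⟩ := hdis _ (hmate r hr)
    have i1 : Interlaced w p r ↔ Interlaced w q r :=
      and_congr (hfst r r1 r2).1 (and_congr (hsnd r r3 r4).2 (hsnd _ s3 s4).1)
    have i2 : Interlaced w p.mate r ↔ Interlaced w q.mate r := by
      unfold Interlaced
      rw [Passage.mate_mate, Passage.mate_mate]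
      exact and_congr (hsnd r r3 r4).1 (and_congr (hfst r r1 r2).2 (hfst _ s1 s2).1)
    have hs' : Diagram.sign q.mate = -Diagram.sign p.mate := hsign
    unfold cassonTerm
    simp only [i1, i2, hmo, hqo, hover, hsign, hs']
    constructor <;> split_ifs <;> ring
  have hright : ∀ r ∈ A ++ B ++ C, cassonTerm w r p + cassonTerm w r q = 0 ∧
      cassonTerm w r p.mate + cassonTerm w r q.mate = 0 := by
    intro r hr
    obtain ⟨r1, r2, r3, r4⟩ := hdis r hr
    obtain ⟨s1, s2, s3, s4⟩ := hdis _ (hmate r hr)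
    have i1 : Interlaced w r p ↔ Interlaced w r q :=
      and_congr (hfst r r1 r2).2 (and_congr (hfst _ s1 s2).1 (hsnd _ s3 s4).2)
    have i2 : Interlaced w r p.mate ↔ Interlaced w r q.mate := by
      unfold Interlaced
      rw [Passage.mate_mate, Passage.mate_mate]
      exact and_congr (hsnd r r3 r4).2 (and_congr (hsnd _ s3 s4).1 (hfst _ s1 s2).2)
    have hs' : Diagram.sign q.mate = -Diagram.sign p.mate := hsign
    unfold cassonTerm
    simp only [i1, i2, hmo, hqo, hover, hsign, hs']
    constructor <;> split_ifs <;> ring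
  have hN : ∀ f : Passage → ℤ, ∑ r ∈ ({p, q, p.mate, q.mate} : Finset Passage), f r =
      (f p + f q) + (f p.mate + f q.mate) := by
    intro f
    have n1 : p ≠ p.mate := p.mate_ne.symm
    have n2 : q ≠ q.mate := q.mate_ne.symm
    have n3 : p.mate ≠ q.mate := fun h0 => hpq (Passage.mate_injective h0)
    have n4 : p ≠ q.mate := fun h0 =>
      ((hblock p (by simp) q.mate (by simp)).ne hnd) h0
    have n5 : q ≠ p.mate := fun h0 =>
      ((hblock q (by simp) p.mate (by simp)).ne hnd) h0
    rw [Finset.sum_insert (by simp [hpq, n1, n4]), Finset.sum_insert (by simp [n2, n5]),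
      Finset.sum_insert (by simp [n3]), Finset.sum_singleton]
    ring
  refine casson_insert (N := {p, q, p.mate, q.mate}) hnd h ?_ ?_ ?_ ?_ ?_ ?_
  · rw [← hw]
    exact ((List.sublist_append_left A _).append_right B).trans
      (List.sublist_append_left _ _) |>.append_right C
  · rw [← hw]; ext r; simp [mem_inOrder]; tauto
  · intro r hr
    obtain ⟨r1, r2, r3, r4⟩ := hdis r hr
    simp [r1, r2, r3, r4]
  · intro r hr
    rw [hN, (hright r hr).1, (hright r hr).2, add_zero]
  · intro r hr
    rw [hN, (hleft r hr).1, (hleft r hr).2, add_zero]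
  · intro r hr s hs
    have b1 := hback p (by simp) p.mate (by simp)
    have b2 := hback p (by simp) q.mate (by simp)
    have b3 := hback q (by simp) p.mate (by simp)
    have b4 := hback q (by simp) q.mate (by simp)
    simp only [Finset.mem_insert, Finset.mem_singleton] at hr hs
    -- The two new chords may cross each other, but a term needs its first passage over and its
    -- second under, whereas `p` and `q` are both over or both under, and so are their mates. The
    -- remaining pairs have the wrong order.
    unfold cassonTerm Interlaced
    rw [if_neg]
    rcases hr with rfl | rfl | rfl | rfl <;> rcases hs with rfl | rfl | rfl | rfl <;>
      (try simp only [Passage.mate_mate]) <;> tauto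

/-! ### The triangle move and the Polyak-Viro sum -/

theorem before_threeBlocks {A B C D : List Passage} {p₁ q₁ p₂ q₂ p₃ q₃ : Passage}
    (e₁ e₂ e₃ f₁ f₂ f₃ : Bool) {a b : Passage}
    (h : ¬ (a ∈ [p₁, q₁, p₂, q₂, p₃, q₃] ∧ b ∈ [p₁, q₁, p₂, q₂, p₃, q₃])) :
    Before (threeBlocks A B C D p₁ q₁ p₂ q₂ p₃ q₃ e₁ e₂ e₃) a b ↔
      Before (threeBlocks A B C D p₁ q₁ p₂ q₂ p₃ q₃ f₁ f₂ f₃) a b := by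
  have key : ∀ p q e, (p = p₁ ∧ q = q₁) ∨ (p = p₂ ∧ q = q₂) ∨ (p = p₃ ∧ q = q₃) →
      ¬ Before (inOrder e p q) a b := by
    intro p q e hpq hb
    have h1 := mem_inOrder.1 hb.left_mem
    have h2 := mem_inOrder.1 hb.right_mem
    apply h
    simp only [List.mem_cons, List.not_mem_nil, or_false]
    rcases hpq with ⟨rfl, rfl⟩ | ⟨rfl, rfl⟩ | ⟨rfl, rfl⟩ <;> constructor
    all_goals first
      | rcases h1 with rfl | rfl <;> simp
      | rcases h2 with rfl | rfl <;> simp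
  unfold threeBlocks
  simp only [before_append, List.mem_append, mem_inOrder, key p₁ q₁ _ (by simp),
    key p₂ q₂ _ (by simp), key p₃ q₃ _ (by simp)]

/-- Localization: a term involving a passage outside `s` compares only pairs whose order is the same
in `v` and `w`, so the difference of the two sums is already the difference for the subwords. -/
theorem casson_eq_of_subwords {v w s s' : List Passage} (hv : v.Nodup) (hw : w.Nodup)
    (hs : IsWord s) (hs' : IsWord s') (hsv : s.Sublist v) (hsw : s'.Sublist w)
    (hvw : v.toFinset = w.toFinset) (hss : s.toFinset = s'.toFinset)
    (hout : ∀ a b, ¬ (a ∈ s ∧ b ∈ s) → (Before v a b ↔ Before w a b))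
    (h : casson s = casson s') : casson v = casson w := by
  have hmem : ∀ r, r ∈ s' ↔ r ∈ s := fun r => by
    rw [← List.mem_toFinset, ← hss, List.mem_toFinset]
  have hsub : s.toFinset ⊆ v.toFinset := fun r hr => by
    rw [List.mem_toFinset] at hr ⊢; exact hsv.subset hr
  have h0 : ∀ p q, ¬ (p ∈ s ∧ q ∈ s) → cassonTerm v p q - cassonTerm w p q = 0 := by
    intro p q hpq
    rw [sub_eq_zero]
    refine cassonTerm_congr (and_congr (hout _ _ hpq) (and_congr (hout _ _ ?_) (hout _ _ ?_)))
    · rw [hs.mate_mem_iff]; tauto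
    · rw [hs.mate_mem_iff, hs.mate_mem_iff]; exact hpq
  rw [← sub_eq_zero] at h ⊢
  unfold casson at h ⊢
  rw [← hss, ← Finset.sum_sub_distrib] at h
  rw [← hvw, ← Finset.sum_sub_distrib, ← h]
  symm
  refine Eq.trans (Finset.sum_congr rfl fun p hp => ?_) (Finset.sum_subset hsub fun p _ hp => ?_)
  · rw [List.mem_toFinset] at hp
    rw [← Finset.sum_sub_distrib, ← Finset.sum_sub_distrib]
    refine Eq.trans (Finset.sum_congr rfl fun q hq => ?_) (Finset.sum_subset hsub fun q _ hq => ?_)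
    · rw [List.mem_toFinset] at hq
      rw [cassonTerm_congr (interlaced_iff_of_sublist hv hs hsv hp hq),
        cassonTerm_congr (interlaced_iff_of_sublist hw hs' hsw ((hmem p).2 hp) ((hmem q).2 hq))]
    · rw [List.mem_toFinset] at hq
      exact h0 p q fun h => hq h.2
  · rw [List.mem_toFinset] at hp
    rw [← Finset.sum_sub_distrib]
    exact Finset.sum_eq_zero fun q _ => h0 p q fun h => hp h.1

/-- The move reorders pairs only among its six passages, which form a word by themselves. This
reduces the triangle move to a finite problem. -/
theorem casson_threeBlocks {A B C D : List Passage} {p₁ p₂ p₃ : Passage}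
    {e₁ e₂ e₃ f₁ f₂ f₃ : Bool}
    (hw : IsWord (threeBlocks A B C D p₁ p₃.mate p₂ p₁.mate p₃ p₂.mate e₁ e₂ e₃))
    (h : casson (threeBlocks [] [] [] [] p₁ p₃.mate p₂ p₁.mate p₃ p₂.mate e₁ e₂ e₃) =
      casson (threeBlocks [] [] [] [] p₁ p₃.mate p₂ p₁.mate p₃ p₂.mate f₁ f₂ f₃)) :
    casson (threeBlocks A B C D p₁ p₃.mate p₂ p₁.mate p₃ p₂.mate e₁ e₂ e₃) =
      casson (threeBlocks A B C D p₁ p₃.mate p₂ p₁.mate p₃ p₂.mate f₁ f₂ f₃) := by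
  have hw' := hw.perm (threeBlocks_perm _ _ _ _ _ _ _ _ _ _ _ _ _ f₁ f₂ f₃)
  have hmem : ∀ e₁ e₂ e₃ r, r ∈ threeBlocks [] [] [] [] p₁ p₃.mate p₂ p₁.mate p₃ p₂.mate e₁ e₂ e₃ ↔
      r ∈ [p₁, p₃.mate, p₂, p₁.mate, p₃, p₂.mate] := by
    intro e₁ e₂ e₃ r
    simp only [threeBlocks, List.mem_append, mem_inOrder, List.mem_cons, List.not_mem_nil]
    tauto
  have hsub : ∀ e₁ e₂ e₃, (threeBlocks [] [] [] [] p₁ p₃.mate p₂ p₁.mate p₃ p₂.mate e₁ e₂ e₃).Sublist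
      (threeBlocks A B C D p₁ p₃.mate p₂ p₁.mate p₃ p₂.mate e₁ e₂ e₃) := by
    intro e₁ e₂ e₃
    unfold threeBlocks
    gcongr <;> exact List.nil_sublist _
  have hmate : ∀ r, r.mate ∈ [p₁, p₃.mate, p₂, p₁.mate, p₃, p₂.mate] ↔
      r ∈ [p₁, p₃.mate, p₂, p₁.mate, p₃, p₂.mate] := by
    intro r
    simp only [List.mem_cons, List.not_mem_nil, or_false, Passage.mate_eq_iff, Passage.mate_mate]
    constructor <;> intro h0 <;> rcases h0 with h0 | h0 | h0 | h0 | h0 | h0 <;> simp [h0]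
  have hword : ∀ e₁ e₂ e₃, IsWord (threeBlocks A B C D p₁ p₃.mate p₂ p₁.mate p₃ p₂.mate e₁ e₂ e₃) →
      IsWord (threeBlocks [] [] [] [] p₁ p₃.mate p₂ p₁.mate p₃ p₂.mate e₁ e₂ e₃) := by
    intro e₁ e₂ e₃ h0
    refine ⟨((hsub e₁ e₂ e₃).map _).nodup h0.1, fun r hr => ?_⟩
    rw [hmem] at hr ⊢
    exact (hmate r).2 hr
  refine casson_eq_of_subwords hw.nodup hw'.nodup (hword _ _ _ hw) (hword _ _ _ hw')
    (hsub e₁ e₂ e₃) (hsub f₁ f₂ f₃) (List.toFinset_eq_of_perm _ _ (threeBlocks_perm ..))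
    (List.toFinset_eq_of_perm _ _ (threeBlocks_perm ..)) (fun a b hab => ?_) h
  rw [hmem, hmem] at hab
  exact before_threeBlocks _ _ _ _ _ _ hab

/-- The local check, over all directions, signs and the two order patterns. A strand is over exactly
if its direction bit equals its sign bit, so the first two alternatives are the cyclic level
patterns excluded from the move. -/
theorem casson_triangle_aux : ∀ (b₁₂ b₂₃ b₃₁ ε s₁₂ s₂₃ s₃₁ : Bool),
    (b₁₂ == s₁₂) = true ∧ (b₂₃ == s₂₃) = true ∧ (b₃₁ == s₃₁) = true ∨
    (b₁₂ == s₁₂) = false ∧ (b₂₃ == s₂₃) = false ∧ (b₃₁ == s₃₁) = false ∨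
    (let t : Bool → CrossingType := fun b => if b then .positive else .negative
    casson (threeBlocks [] [] [] [] ⟨0, b₁₂, t s₁₂⟩ ⟨2, !b₃₁, t s₃₁⟩ ⟨1, b₂₃, t s₂₃⟩
      ⟨0, !b₁₂, t s₁₂⟩ ⟨2, b₃₁, t s₃₁⟩ ⟨1, !b₂₃, t s₂₃⟩
      ((b₁₂ == b₃₁) == ε) ((b₂₃ == b₁₂) == ε) ((b₃₁ == b₂₃) == ε)) =
    casson (threeBlocks [] [] [] [] ⟨0, b₁₂, t s₁₂⟩ ⟨2, !b₃₁, t s₃₁⟩ ⟨1, b₂₃, t s₂₃⟩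
      ⟨0, !b₁₂, t s₁₂⟩ ⟨2, b₃₁, t s₃₁⟩ ⟨1, !b₂₃, t s₂₃⟩
      ((b₁₂ == b₃₁) == !ε) ((b₂₃ == b₁₂) == !ε) ((b₃₁ == b₂₃) == !ε))) := by
  set_option maxRecDepth 100000 in decide +kernel

theorem threeBlocks_map (g : Passage → Passage) (A B C D : List Passage)
    (p₁ q₁ p₂ q₂ p₃ q₃ : Passage) (e₁ e₂ e₃ : Bool) :
    (threeBlocks A B C D p₁ q₁ p₂ q₂ p₃ q₃ e₁ e₂ e₃).map g =
      threeBlocks (A.map g) (B.map g) (C.map g) (D.map g) (g p₁) (g q₁) (g p₂) (g q₂) (g p₃)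
        (g q₃) e₁ e₂ e₃ := by
  cases e₁ <;> cases e₂ <;> cases e₃ <;> simp [threeBlocks, inOrder]

theorem casson_triangle {A B C D : List Passage} {x y z : ℕ} {b₁₂ b₂₃ b₃₁ ε : Bool}
    {t₁₂ t₂₃ t₃₁ : CrossingType} (h : TriangleAllowed t₁₂ t₂₃ t₃₁ b₁₂ b₂₃ b₃₁)
    (hw : IsWord (threeBlocks A B C D ⟨x, b₁₂, t₁₂⟩ ⟨z, !b₃₁, t₃₁⟩ ⟨y, b₂₃, t₂₃⟩ ⟨x, !b₁₂, t₁₂⟩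
      ⟨z, b₃₁, t₃₁⟩ ⟨y, !b₂₃, t₂₃⟩ ((b₁₂ == b₃₁) == ε) ((b₂₃ == b₁₂) == ε) ((b₃₁ == b₂₃) == ε)))
    (h₁₂ : t₁₂ ≠ .virt) (h₂₃ : t₂₃ ≠ .virt) (h₃₁ : t₃₁ ≠ .virt) :
    casson (threeBlocks A B C D ⟨x, b₁₂, t₁₂⟩ ⟨z, !b₃₁, t₃₁⟩ ⟨y, b₂₃, t₂₃⟩
      ⟨x, !b₁₂, t₁₂⟩ ⟨z, b₃₁, t₃₁⟩ ⟨y, !b₂₃, t₂₃⟩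
      ((b₁₂ == b₃₁) == ε) ((b₂₃ == b₁₂) == ε) ((b₃₁ == b₂₃) == ε)) =
    casson (threeBlocks A B C D ⟨x, b₁₂, t₁₂⟩ ⟨z, !b₃₁, t₃₁⟩ ⟨y, b₂₃, t₂₃⟩
      ⟨x, !b₁₂, t₁₂⟩ ⟨z, b₃₁, t₃₁⟩ ⟨y, !b₂₃, t₂₃⟩
      ((b₁₂ == b₃₁) == !ε) ((b₂₃ == b₁₂) == !ε) ((b₃₁ == b₂₃) == !ε)) := by
  refine casson_threeBlocks (p₁ := ⟨x, b₁₂, t₁₂⟩) (p₂ := ⟨y, b₂₃, t₂₃⟩)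
    (p₃ := ⟨z, b₃₁, t₃₁⟩) hw ?_
  have hxyz : x ≠ y ∧ x ≠ z ∧ y ≠ z := by
    have hk := (hw.perm (threeBlocks_perm _ _ _ _ _ _ _ _ _ _ _ _ _ true true true)).1
    simp only [threeBlocks, inOrder, if_true, keys, List.map_append, List.map_cons, List.map_nil,
      List.nodup_append, List.nodup_cons, List.mem_append, List.mem_cons, List.not_mem_nil,
      or_false] at hk
    refine ⟨?_, ?_, ?_⟩ <;> rintro rfl <;> cases b₁₂ <;> cases b₂₃ <;> cases b₃₁ <;> grind
  obtain ⟨hxy, hxz, hyz⟩ := hxyz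
  -- An injective relabelling that carries the model labels `0, 1, 2` to the given ones; beyond `2`
  -- the values exceed all of `x, y, z`.
  let f : ℕ → ℕ := fun n => if n = 0 then x else if n = 1 then y else if n = 2 then z else n + x + y + z
  have hf : Function.Injective f := by
    intro m n hmn
    simp only [f] at hmn
    split_ifs at hmn <;> omega
  let t : Bool → CrossingType := fun b => if b then .positive else .negative
  have ht : ∀ s : CrossingType, s ≠ .virt → ∃ b, s = t b := by
    intro s hs
    cases s
    · exact ⟨true, rfl⟩
    · exact ⟨false, rfl⟩
    · exact absurd rfl hs
  obtain ⟨s₁₂, rfl⟩ := ht _ h₁₂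
  obtain ⟨s₂₃, rfl⟩ := ht _ h₂₃
  obtain ⟨s₃₁, rfl⟩ := ht _ h₃₁
  have hover : ∀ (b s : Bool), (Passage.mk 0 b (t s)).IsOver ↔ (b == s) = true := by
    intro b s
    cases b <;> cases s <;> simp [t, Passage.IsOver]
  have hall : ¬ ((b₁₂ == s₁₂) = true ∧ (b₂₃ == s₂₃) = true ∧ (b₃₁ == s₃₁) = true) ∧
      ¬ ((b₁₂ == s₁₂) = false ∧ (b₂₃ == s₂₃) = false ∧ (b₃₁ == s₃₁) = false) := by
    unfold TriangleAllowed at h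
    simp only [hover, Bool.not_eq_true] at h
    tauto
  have key := ((casson_triangle_aux b₁₂ b₂₃ b₃₁ ε s₁₂ s₂₃ s₃₁).resolve_left hall.1).resolve_left
    hall.2
  simp only at key
  rw [← casson_relabel hf, ← casson_relabel hf (threeBlocks _ _ _ _ _ _ _ _ _ _ (_ == !ε) _ _),
    threeBlocks_map, threeBlocks_map] at key
  exact key

/-! ### Change of base point in the Polyak-Viro sum -/

theorem level_eq_sum {w : List Passage} (hw : w.Nodup) {p : Passage} (hp : p ∈ w) :
    level w p = ∑ q ∈ w.toFinset, if Before w q p then q.jump else 0 := by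
  induction w with
  | nil => simp at hp
  | cons r w ih =>
    obtain ⟨hr, hw'⟩ := List.nodup_cons.1 hw
    rw [level_cons]
    by_cases h : r = p
    · subst h
      rw [if_pos rfl]
      symm
      refine Finset.sum_eq_zero fun q _ => if_neg fun hb => ?_
      rcases before_cons.1 hb with ⟨_, h⟩ | h
      · exact hr h
      · exact hr h.right_mem
    · have hp' : p ∈ w := (List.mem_cons.1 hp).resolve_left fun h0 => h h0.symm
      rw [if_neg h, ih hw' hp', List.toFinset_cons, Finset.sum_insert (by simpa using hr),
        if_pos (before_cons.2 (Or.inl ⟨rfl, hp'⟩))]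
      congr 1
      refine Finset.sum_congr rfl fun q hq => ?_
      have : q ≠ r := by rintro rfl; exact hr (by simpa using hq)
      simp [before_cons, this]

/-- Vanishing index means that the jumps between `p` and `p.mate` add up to zero. Crossings with
both passages in that stretch cancel, so the chords that cross the chord of `p` already balance.
This is what makes the base point immaterial. -/
theorem sum_jump_crossing {w : List Passage} {p : Passage} (hw : IsWord (p :: w))
    (h0 : wordIndex (p :: w) p = 0) :
    ∑ q ∈ w.toFinset, (if Before w q p.mate ∧ Before w p.mate q.mate then q.jump else 0) = 0 := by
  obtain ⟨hp, hnd⟩ := List.nodup_cons.1 hw.nodup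
  have hpm : p.mate ∈ w := (List.mem_cons.1 (hw.2 p (by simp))).resolve_left p.mate_ne
  have hl : level w p.mate = 0 := by
    simpa [wordIndex, level_cons, p.mate_ne.symm] using h0
  have hm : ∀ q ∈ w, q ≠ p.mate → q.mate ∈ w := by
    intro q hq hqp
    refine (List.mem_cons.1 (hw.2 q (by simp [hq]))).resolve_left fun h => ?_
    exact hqp (Passage.mate_eq_iff.1 h)
  rw [level_eq_sum hnd hpm] at hl
  have hz : ∑ q ∈ w.toFinset, (if Before w q p.mate ∧ Before w q.mate p.mate then q.jump else 0) = 0 := by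
    rw [← Finset.sum_filter]
    refine Finset.sum_involution (fun q _ => q.mate) ?_ ?_ ?_ ?_
    · intro q _; simp
    · intro q _ _; exact q.mate_ne
    · intro q hq
      simp only [Finset.mem_filter, List.mem_toFinset, Passage.mate_mate] at hq ⊢
      exact ⟨hq.2.2.left_mem, hq.2.2, hq.2.1⟩
    · intro q _; simp
  have hsub : ∑ q ∈ w.toFinset, (if Before w q p.mate ∧ Before w p.mate q.mate then q.jump else 0) =
      ∑ q ∈ w.toFinset, (if Before w q p.mate then q.jump else 0) -
        ∑ q ∈ w.toFinset, (if Before w q p.mate ∧ Before w q.mate p.mate then q.jump else 0) := by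
    rw [← Finset.sum_sub_distrib]
    refine Finset.sum_congr rfl fun q hq => ?_
    rw [List.mem_toFinset] at hq
    by_cases hb : Before w q p.mate
    · have hqp := hb.ne hnd
      have hqm := hm q hq hqp
      have hne : q.mate ≠ p.mate := fun h => hp (Passage.mate_injective h ▸ hq)
      by_cases hb' : Before w q.mate p.mate
      · simp [hb, hb', before_asymm hnd hb']
      · simp [hb, hb', (not_before hnd hqm hpm hne).1 hb']
    · simp [hb]
  rw [hsub, hl, hz, sub_zero]

/-- Moving the base point past an over-passage `p` exchanges the terms with `p` in first position
for terms with `p.mate` in second position. The difference is the sign of `p` times a signed count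
of the chords crossing it, which is zero as `p` has index zero. -/
theorem casson_rotate_cons {w : List Passage} {p : Passage} (hw : IsWord (p :: w))
    (hcl : ∀ q ∈ p :: w, q.type ≠ .virt) (h0 : wordIndex (p :: w) p = 0) :
    casson (w ++ [p]) = casson (p :: w) := by
  obtain ⟨hp, hnd⟩ := List.nodup_cons.1 hw.nodup
  have hset : (w ++ [p]).toFinset = (p :: w).toFinset :=
    List.toFinset_eq_of_perm _ _ (List.perm_append_singleton p w)
  have hpm : p.mate ∈ w := (List.mem_cons.1 (hw.2 p (by simp))).resolve_left p.mate_ne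
  -- `g` collects the terms lost, in which `p` comes first; `g'` collects the terms gained, in which
  -- `p.mate` is the under-passage in second position.
  let g : Passage → ℤ := fun s =>
    if p.IsOver ∧ ¬ s.IsOver ∧ Before w s p.mate ∧ Before w p.mate s.mate then
      Diagram.sign p * Diagram.sign s else 0
  let g' : Passage → ℤ := fun r =>
    if p.IsOver ∧ r.IsOver ∧ Before w r p.mate ∧ Before w p.mate r.mate then
      Diagram.sign p * Diagram.sign r else 0
  have key : ∀ r ∈ (p :: w).toFinset, ∀ s ∈ (p :: w).toFinset,
      cassonTerm (p :: w) r s - cassonTerm (w ++ [p]) r s =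
        (if p = r then g s else 0) - (if p.mate = s then g' r else 0) := by
    intro r hr s hs
    rw [List.mem_toFinset] at hr hs
    have hov : p.mate.IsOver ↔ ¬ p.IsOver := isOver_mate (hcl p (by simp))
    have hsg : Diagram.sign p.mate = Diagram.sign p := rfl
    have pm := p.mate_ne
    have pm' := pm.symm
    have n1 : ∀ x, ¬ Before w p x := fun x h => hp h.left_mem
    have n2 : ∀ x, ¬ Before w x p := fun x h => hp h.right_mem
    have irr : ∀ x, ¬ Before w x x := fun x h => h.ne hnd rfl
    have asy : ∀ x y, Before w x y → ¬ Before w y x := fun x y => before_asymm hnd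
    have hl : ∀ x y, Before w x y → x ∈ w := fun x y h => h.left_mem
    have hrm : ∀ x y, Before w x y → y ∈ w := fun x y h => h.right_mem
    have hm : ∀ x, x.mate = p ↔ x = p.mate := fun x => Passage.mate_eq_iff
    have c1 : ∀ x y, Before (p :: w) x y ↔ (x = p ∧ y ∈ w) ∨ Before w x y := fun x y => before_cons
    have c2 : ∀ x y, Before (w ++ [p]) x y ↔ Before w x y ∨ (x ∈ w ∧ y = p) := by
      intro x y; simp [before_append, before_cons]
    by_cases r1 : r = p
    · subst r1
      have i1 : Interlaced (r :: w) r s ↔ Before w s r.mate ∧ Before w r.mate s.mate := by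
        have : Before w s r.mate → s ∈ w := hl _ _
        have : Before w r.mate s.mate → s ≠ r := fun h h0 => irr _ (h0 ▸ h)
        simp only [Interlaced, c1, n1, pm]
        grind
      have i2 : ¬ Interlaced (w ++ [r]) r s := by
        simp only [Interlaced, c2, n1]
        grind
      have i3 : g' r = 0 := if_neg fun h => n1 _ h.2.2.1
      simp only [cassonTerm, i1, i2, i3, g, if_true, and_false, if_false, sub_zero, ite_self]
    · have r1' : p ≠ r := fun h => r1 h.symm
      rw [if_neg r1', zero_sub]
      by_cases s1 : s = p.mate
      · subst s1
        have i1 : ¬ Interlaced (p :: w) r p.mate := by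
          simp only [Interlaced, c1, Passage.mate_mate, n2, r1]
          grind
        have i2 : Interlaced (w ++ [p]) r p.mate ↔
            Before w r p.mate ∧ Before w p.mate r.mate := by
          have : Before w p.mate r.mate → r.mate ∈ w := hrm _ _
          have : Before w r p.mate → r.mate ≠ p := fun h h0 => irr _ ((hm r).1 h0 ▸ h)
          simp only [Interlaced, c2, Passage.mate_mate, n2, pm]
          grind
        have hcomm : Diagram.sign r * Diagram.sign p.mate = Diagram.sign p * Diagram.sign r := by
          rw [hsg, mul_comm]
        rw [cassonTerm_eq_zero i1]
        simp only [cassonTerm, i2, g', if_true, hov, hcomm, not_not, zero_sub]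
        congr 2
        simp only [eq_iff_iff]
        tauto
      · have s1' : p.mate ≠ s := fun h => s1 h.symm
        rw [if_neg s1', neg_zero, sub_eq_zero]
        apply cassonTerm_congr
        have hmr := hm r
        have hms := hm s
        simp only [Interlaced, c1, c2]
        have := n1 s.mate
        have := n1 s
        have := n2 s
        have := n2 r
        grind
  rw [eq_comm, ← sub_eq_zero]
  unfold casson
  rw [hset, ← Finset.sum_sub_distrib]
  have hpmem : p ∈ (p :: w).toFinset := by simp
  have hpmmem : p.mate ∈ (p :: w).toFinset := by simp [hpm]
  have e1 : ∀ r ∈ (p :: w).toFinset,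
      ∑ s ∈ (p :: w).toFinset, cassonTerm (p :: w) r s -
        ∑ s ∈ (p :: w).toFinset, cassonTerm (w ++ [p]) r s =
      (if p = r then ∑ s ∈ (p :: w).toFinset, g s else 0) - g' r := by
    intro r hr
    rw [← Finset.sum_sub_distrib, Finset.sum_congr rfl (key r hr), Finset.sum_sub_distrib,
      Finset.sum_ite_eq, if_pos hpmmem]
    congr 1
    split_ifs <;> simp
  rw [Finset.sum_congr rfl e1, Finset.sum_sub_distrib, Finset.sum_ite_eq, if_pos hpmem,
    ← Finset.sum_sub_distrib]
  -- Only an over-passage matters: if `p` is under, it cannot open a term, and at the end of the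
  -- word it would have to be the over-passage that closes one.
  by_cases hpo : p.IsOver
  · have e2 : ∀ q ∈ (p :: w).toFinset, g q - g' q = Diagram.sign p *
        (if Before w q p.mate ∧ Before w p.mate q.mate then q.jump else 0) := by
      intro q hq
      have hq' := isOver_mate (hcl q (List.mem_toFinset.1 hq))
      have hj := jump_eq q
      by_cases hb : Before w q p.mate ∧ Before w p.mate q.mate
      · by_cases hqo : q.IsOver <;> simp [g, g', hpo, hqo, hb, hj, hq']
      · simp [g, g', hb]
    rw [Finset.sum_congr rfl e2, ← Finset.mul_sum, List.toFinset_cons,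
      Finset.sum_insert (by simpa using hp), sum_jump_crossing hw h0, if_neg, add_zero, mul_zero]
    exact fun h => hp h.1.left_mem
  · exact Finset.sum_eq_zero fun q _ => by simp [g, g', hpo]

theorem casson_rotate {A B : List Passage} (hw : IsWord (A ++ B))
    (hcl : ∀ q ∈ A ++ B, q.type ≠ .virt) (h0 : ∀ q ∈ A ++ B, wordIndex (A ++ B) q = 0) :
    casson (B ++ A) = casson (A ++ B) := by
  induction A generalizing B with
  | nil => simp
  | cons p A ih =>
    have hperm : (p :: A ++ B).Perm (A ++ (B ++ [p])) := by
      rw [← List.append_assoc]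
      exact (List.perm_append_singleton p (A ++ B)).symm
    have h1 := casson_rotate_cons (w := A ++ B) (p := p) hw hcl (h0 p (by simp))
    rw [List.append_assoc] at h1
    have h2 := ih (B := B ++ [p]) (hw.perm hperm) (fun q hq => hcl q (hperm.mem_iff.2 hq)) (by
      intro q hq
      have := wordIndex_rotate (A := [p]) (B := A ++ B) (by simpa using hw)
        (by simpa using hperm.mem_iff.2 hq)
      rw [← List.append_assoc, this]
      simpa using h0 q (hperm.mem_iff.2 hq))
    rw [List.cons_append, ← h1, ← h2]
    simp

/-- Planarity enters through the base point: the vanishing of all indices holds because the diagram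
is planar and classical. -/
theorem casson_step {D E : Diagram} (hD : D.IsClassical) (hE : E.IsClassical)
    (h : Step D.word E.word) : casson D.word = casson E.word := by
  have hDw := D.isWord
  have hEw := E.isWord
  have h0 := fun c => wordIndex_eq_zero hDw D.planar hD (c := c)
  unfold Diagram.IsClassical at hD hE
  generalize D.word = v at *
  generalize E.word = w at *
  cases h with
  | relabel σ => exact (casson_relabel σ.injective _).symm
  | basePoint A B => exact (casson_rotate hDw hD fun q => h0 q).symm
  | omega1 A B x b t => exact (casson_curl hDw hEw).symm
  | omega2 A B C x y b d t =>
    have ht : t ≠ .virt := hE ⟨x, b, t⟩ (by simp)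
    have ht' : t.flip ≠ .virt := hE ⟨y, !b, t.flip⟩ (by simp)
    have hm : (⟨y, b, t.flip⟩ : Passage) = Passage.mate ⟨y, !b, t.flip⟩ := by simp [Passage.mate]
    rw [hm] at hEw ⊢
    refine (casson_bigon (p := ⟨x, b, t⟩) (q := ⟨y, !b, t.flip⟩) hDw hEw ht ht' isOver_flip.symm
      ?_).symm
    cases t <;> simp_all [Diagram.sign, CrossingType.flip]
  | omega3 A B C D x y z b₁₂ b₂₃ b₃₁ ε t₁₂ t₂₃ t₃₁ h =>
    exact casson_triangle h hDw (hD ⟨x, b₁₂, t₁₂⟩ (by simp [mem_inOrder]))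
      (hD ⟨y, b₂₃, t₂₃⟩ (by simp [mem_inOrder])) (hD ⟨z, b₃₁, t₃₁⟩ (by simp [mem_inOrder]))

theorem casson_eq_of_classicallyEquivalent {D E : Diagram} (h : D.ClassicallyEquivalent E) :
    casson D.word = casson E.word := by
  induction h with
  | rel D E h => exact casson_step h.1 h.2.1 h.2.2
  | refl D => rfl
  | symm D E _ ih => exact ih.symm
  | trans D E F _ _ ih1 ih2 => exact ih1.trans ih2

/-! ### Diagrams without crossing chords are trivial -/

/-- Only the edge that leaves the curl gets a new predecessor, namely the edge that entered it.
Length at least `2` excludes an edge that would be its own predecessor. -/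
theorem prev_remove_curl {A B : List (ℕ × Bool)} {f s : ℕ × Bool}
    (hU : (A ++ [f, s] ++ B).Nodup) (hl : 2 ≤ (A ++ B).length) {e : ℕ × Bool} (he : e ∈ A ++ B)
    (he' : e ∈ A ++ [f, s] ++ B) (hf : f ∈ A ++ [f, s] ++ B) :
    (A ++ [f, s] ++ B).prev e he' = (A ++ B).prev e he ∨
      ((A ++ [f, s] ++ B).prev e he' = s ∧
        (A ++ B).prev e he = (A ++ [f, s] ++ B).prev f hf) := by
  have hV : (A ++ B).Nodup := hU.sublist ((List.sublist_append_left A _).append_right B)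
  have rV : (A ++ B) ~r (B ++ A) := List.isRotated_append
  have rU : (A ++ [f, s] ++ B) ~r (f :: s :: (B ++ A)) := by
    have : (A ++ ([f, s] ++ B)) ~r (([f, s] ++ B) ++ A) := List.isRotated_append
    simpa using this
  have heT : e ∈ B ++ A := rV.mem_iff.1 he
  obtain ⟨X, Y, hXY⟩ := List.append_of_mem heT
  rw [hXY] at rV rU
  rcases List.eq_nil_or_concat X with rfl | ⟨X', l, rfl⟩
  · right
    have hY : Y ≠ [] := by
      rintro rfl
      have := rV.perm.length_eq
      simp only [List.nil_append, List.length_singleton] at this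
      omega
    obtain ⟨Y', l, rfl⟩ := (List.eq_nil_or_concat Y).resolve_left hY
    refine ⟨prev_eq_of_isRotated (X := [f]) (Y := Y' ++ [l]) hU (by simpa using rU) he', ?_⟩
    rw [prev_eq_of_isRotated (X := []) (Y := Y') (a := l) hV ?_ he,
      prev_eq_of_isRotated (X := []) (Y := s :: e :: Y') (a := l) hU ?_ hf]
    · have : (f :: s :: e :: Y') ++ [l] ~r [l] ++ (f :: s :: e :: Y') := List.isRotated_append
      exact rU.trans (by simpa using this)
    · have : (e :: Y') ++ [l] ~r [l] ++ (e :: Y') := List.isRotated_append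
      exact rV.trans (by simpa using this)
  · left
    rw [prev_eq_of_isRotated (X := X') (Y := Y) (a := l) hV (by simpa using rV) he,
      prev_eq_of_isRotated (X := f :: s :: X') (Y := Y) (a := l) hU (by simpa using rU) he']

/-- Removing a curl removes one vertex, two edges and at most one face, the monogon inside the loop,
so the Euler characteristic does not drop. -/
theorem planar_remove_curl {A B : List (ℕ × Bool)} {x : ℕ} {b : Bool}
    (hU : (A ++ [(x, b), (x, !b)] ++ B).Nodup) (hm : ∀ y d, (y, d) ∈ A ++ B → (y, !d) ∈ A ++ B)
    (hpl : Planar (A ++ [(x, b), (x, !b)] ++ B)) : Planar (A ++ B) := by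
  by_cases hne : A ++ B = []
  · exact Or.inl hne
  right
  have hpl := hpl.resolve_left (by simp)
  have hV : (A ++ B).Nodup := hU.sublist ((List.sublist_append_left A _).append_right B)
  have hl : 2 ≤ (A ++ B).length := by
    obtain ⟨⟨y, d⟩, he⟩ := List.exists_mem_of_ne_nil _ hne
    have h2 : [(y, d), (y, !d)].Subperm (A ++ B) := by
      refine List.subperm_of_subset (by simp) ?_
      intro z hz
      simp only [List.mem_cons, List.not_mem_nil, or_false] at hz
      rcases hz with rfl | rfl
      · exact he
      · exact hm _ _ he
    simpa using h2.length_le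
  have hmem : ∀ e, e ∈ A ++ [(x, b), (x, !b)] ++ B ↔ e = (x, b) ∨ e = (x, !b) ∨ e ∈ A ++ B := by
    intro e; simp only [List.mem_append, List.mem_cons, List.not_mem_nil]; tauto
  have hlen : (A ++ [(x, b), (x, !b)] ++ B).length = (A ++ B).length + 2 := by
    simp only [List.length_append, List.length_cons, List.length_nil]; omega
  have hf := (hmem _).2 (Or.inl rfl)
  have hs := (hmem _).2 (Or.inr (Or.inl rfl))
  have hprev := fun e (he : e ∈ A ++ B) => prev_remove_curl hU hl he ((hmem e).2 (Or.inr (Or.inr he))) hf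
  have hps : (A ++ [(x, b), (x, !b)] ++ B).prev (x, !b) hs = (x, b) :=
    prev_eq_of_isRotated (X := A) (Y := B) hU (by simpa using List.IsRotated.refl _) hs
  have hpf : (A ++ [(x, b), (x, !b)] ++ B).prev (x, b) hf ∈ A ++ B := by
    rcases List.eq_nil_or_concat (B ++ A) with h | ⟨T, l, h⟩
    · exact absurd (by simpa [and_comm] using h) hne
    · have rU : (A ++ [(x, b), (x, !b)] ++ B) ~r ((x, b) :: (x, !b) :: T) ++ [l] := by
        have : (A ++ ([(x, b), (x, !b)] ++ B)) ~r (([(x, b), (x, !b)] ++ B) ++ A) :=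
          List.isRotated_append
        simpa [h] using this
      have rU' : (A ++ [(x, b), (x, !b)] ++ B) ~r [] ++ l :: (x, b) :: (x, !b) :: T :=
        rU.trans (by simpa using List.isRotated_append (l := (x, b) :: (x, !b) :: T) (l' := [l]))
      rw [prev_eq_of_isRotated hU rU' hf]
      have : l ∈ B ++ A := by simp [h]
      simpa [or_comm] using this
  generalize hUdef : A ++ [(x, b), (x, !b)] ++ B = U at *
  generalize hVdef : A ++ B = V at *
  let emb : {e // e ∈ V} → {e // e ∈ U} := fun e => ⟨e.1, (hmem _).2 (Or.inr (Or.inr e.2))⟩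
  let a : {e // e ∈ V} := ⟨_, hpf⟩
  have ha : pre U ⟨_, hf⟩ = emb a := rfl
  have hs' : pre U ⟨_, hs⟩ = ⟨_, hf⟩ := Subtype.ext hps
  let mk : {e // e ∈ U} → Side → Face U := fun e s => Quot.mk _ (e, s)
  have corner : ∀ (y : ℕ) (j k : {e // e ∈ U}), j.1 = (y, true) → k.1 = (y, false) →
      mk j .left = mk k .right ∧ mk (pre U j) .left = mk k .left ∧
      mk (pre U j) .right = mk (pre U k) .left ∧ mk j .right = mk (pre U k) .right := by
    intro y j k hj hk
    exact ⟨Quot.sound (.northEast y j k hj hk), Quot.sound (.northWest y j k hj hk),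
      Quot.sound (.southWest y j k hj hk), Quot.sound (.southEast y j k hj hk)⟩
  -- The side of the loop edge that faces the monogon: there one of the corners glues that side to
  -- itself.
  let inner : Side := if b then .right else .left
  have hcurl : (∀ s, mk ⟨_, hs⟩ s = mk (emb a) s) ∧
      ∀ s, s ≠ inner → ∃ s', mk ⟨_, hf⟩ s = mk (emb a) s' := by
    cases b
    · obtain ⟨c1, c2, c3, c4⟩ := corner x ⟨_, hs⟩ ⟨_, hf⟩ rfl rfl
      rw [hs', ha] at *
      refine ⟨fun s => ?_, fun s hs => ?_⟩
      · cases s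
        · rw [c1, c3]
        · rw [c4]
      · cases s
        · exact absurd rfl hs
        · exact ⟨_, c3⟩
    · obtain ⟨c1, c2, c3, c4⟩ := corner x ⟨_, hf⟩ ⟨_, hs⟩ rfl rfl
      rw [hs', ha] at *
      refine ⟨fun s => ?_, fun s hs => ?_⟩
      · cases s
        · rw [c2]
        · rw [← c1, c3]
      · cases s
        · exact ⟨_, c3.symm⟩
        · exact absurd rfl hs
  have hpre : ∀ e s, mk (emb (pre V e)) s = mk (pre U (emb e)) s := by
    intro e s
    rcases hprev e.1 e.2 with h | ⟨h1, h2⟩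
    · have : pre U (emb e) = emb (pre V e) := Subtype.ext h
      rw [this]
    · have e1 : pre U (emb e) = ⟨_, hs⟩ := Subtype.ext h1
      have e2 : pre V e = a := Subtype.ext h2
      rw [e1, e2, hcurl.1]
  -- The extra element `none` stands for the monogon; every other face of the larger surface is met
  -- by an edge that survives.
  let G : Option (Face V) → Face U := fun y => y.elim (mk ⟨_, hf⟩ inner)
    (Quot.lift (fun z => mk (emb z.1) z.2) (by
      intro z z' h
      cases h with
      | northEast y j k hj hk => exact (corner y (emb j) (emb k) hj hk).1
      | northWest y j k hj hk => exact (hpre _ _).trans (corner y (emb j) (emb k) hj hk).2.1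
      | southWest y j k hj hk =>
        exact ((hpre _ _).trans (corner y (emb j) (emb k) hj hk).2.2.1).trans (hpre _ _).symm
      | southEast y j k hj hk =>
        exact (corner y (emb j) (emb k) hj hk).2.2.2.trans (hpre _ _).symm))
  have hG : Function.Surjective G := by
    intro y
    induction y using Quot.ind with
    | mk y =>
      obtain ⟨⟨e, he⟩, s⟩ := y
      rcases (hmem e).1 he with rfl | rfl | h
      · by_cases hsi : s = inner
        · exact ⟨none, by rw [hsi]; rfl⟩
        · obtain ⟨s', h'⟩ := hcurl.2 s hsi
          exact ⟨some (Quot.mk _ (a, s')), h'.symm⟩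
      · exact ⟨some (Quot.mk _ (a, s)), (hcurl.1 s).symm⟩
      · exact ⟨some (Quot.mk _ (⟨e, h⟩, s)), rfl⟩
  have : Finite (Face V) := inferInstanceAs (Finite (Quot _))
  have hcard := Nat.card_le_card_of_surjective G hG
  rw [Finite.card_option] at hcard
  unfold eulerChar at hpl ⊢
  rw [hlen] at hpl
  omega

/-- An innermost chord is a curl: if `q` comes directly after `p` and the chords do not cross, then
both passages of `q` lie between those of `p`, and the stretch between them is shorter. -/
theorem exists_curl {w : List Passage} (hw : IsWord w) (hne : w ≠ [])
    (hcr : ∀ p q, ¬ Interlaced w p q) : ∃ X p Y, w = X ++ [p, p.mate] ++ Y := by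
  have key : ∀ (n : ℕ) (X R Y : List Passage) (p : Passage), R.length = n →
      w = X ++ p :: R ++ p.mate :: Y → ∃ X p Y, w = X ++ [p, p.mate] ++ Y := by
    intro n
    induction n using Nat.strong_induction_on with
    | _ n ih =>
      intro X R Y p hR hsplit
      cases R with
      | nil => exact ⟨X, p, Y, by simp [hsplit]⟩
      | cons q R =>
        have hnd := hw.nodup
        have hq : q ∈ w := by simp [hsplit]
        have hqm := hw.2 q hq
        have hqp : q ≠ p ∧ q ≠ p.mate := by
          rw [hsplit] at hnd
          simp only [List.nodup_append, List.nodup_cons, List.mem_cons, List.mem_append] at hnd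
          grind
        have hqm1 : q.mate ≠ p.mate := fun h => hqp.1 (Passage.mate_injective h)
        have hqm2 : q.mate ≠ p := fun h => hqp.2 (Passage.mate_eq_iff.1 h)
        have hloc : q.mate ∈ X ∨ q.mate ∈ R ∨ q.mate ∈ Y := by
          rw [hsplit] at hqm
          simp only [List.mem_append, List.mem_cons, hqm1, hqm2, q.mate_ne] at hqm
          tauto
        have hpq : Before w p q := by rw [hsplit]; simp [before_append, before_cons]
        have hqpm : Before w q p.mate := by rw [hsplit]; simp [before_append, before_cons]
        rcases hloc with h | h | h
        · refine absurd ⟨?_, ?_, ?_⟩ (hcr q.mate p)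
          · rw [hsplit, List.append_assoc, before_append]
            exact Or.inr (Or.inl ⟨h, by simp⟩)
          · simpa using hpq
          · simpa using hqpm
        · obtain ⟨R₁, R₂, rfl⟩ := List.append_of_mem h
          refine ih R₁.length ?_ (X ++ [p]) R₁ (R₂ ++ p.mate :: Y) q rfl (by simp [hsplit])
          rw [← hR]
          simp
        · refine absurd ⟨hpq, hqpm, ?_⟩ (hcr p q)
          rw [hsplit, before_append]
          exact Or.inr (Or.inr (before_cons.2 (Or.inl ⟨rfl, h⟩)))
  obtain ⟨p, hp⟩ := List.exists_mem_of_ne_nil w hne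
  rcases before_total hp (hw.2 p hp) p.mate_ne.symm with h | h
  · obtain ⟨X, R, Y, h⟩ := before_iff_exists.1 h
    exact key _ X R Y p rfl h
  · obtain ⟨X, R, Y, h⟩ := before_iff_exists.1 h
    exact key _ X R Y p.mate rfl (by simpa using h)

/-- Remove curls one at a time. Removal preserves planarity and creates no crossing chords, so every
intermediate word is again a classical diagram of the same kind. -/
theorem Diagram.isTrivial_of_not_interlaced (D : Diagram) (hcl : D.IsClassical)
    (hcr : ∀ p q, ¬ Interlaced D.word p q) : D.IsTrivial := by
  induction hn : D.word.length using Nat.strong_induction_on generalizing D with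
  | _ n ih =>
    by_cases hne : D.word = []
    · have : D = unknot := by
        obtain ⟨w, h1, h2⟩ := D
        simp only at hne
        subst hne
        rfl
      rw [this]
      exact Relation.EqvGen.refl _
    obtain ⟨A, p, B, hw⟩ := exists_curl D.isWord hne hcr
    have hW := D.isWord
    have hP := D.planar
    have hsub : (A ++ B).Sublist D.word := by
      rw [hw]; exact (List.sublist_append_left A _).append_right B
    have hnd := hW.nodup
    have hmate : ∀ q ∈ A ++ B, q.mate ∈ A ++ B := by
      intro q hq
      have h1 := hW.2 q (hsub.subset hq)
      have h2 : q ≠ p ∧ q ≠ p.mate := by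
        rw [hw] at hnd
        simp only [List.nodup_append, List.mem_cons, List.mem_append] at hnd hq
        grind
      have h3 : q.mate ≠ p.mate := fun h => h2.1 (Passage.mate_injective h)
      have h4 : q.mate ≠ p := fun h => h2.2 (Passage.mate_eq_iff.1 h)
      rw [hw] at h1
      simp only [List.mem_append, List.mem_cons, List.not_mem_nil, h3, h4] at h1 ⊢
      tauto
    have hword : IsWord (A ++ B) := ⟨(hsub.map _).nodup hW.1, hmate⟩
    have hk : keys D.word = keys A ++ [(p.label, p.ltr), (p.label, !p.ltr)] ++ keys B := by
      simp [hw, keys]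
    have hk' : keys (A ++ B) = keys A ++ keys B := by simp [keys]
    have hpl : Planar (keys (A ++ B)) := by
      rw [hk']
      refine planar_remove_curl (x := p.label) (b := p.ltr) ?_ ?_ ?_
      · rw [← hk]; exact hW.1
      · rw [← hk']; exact keys_mate hword
      · rw [← hk]; exact hP
    have hE := ih (A ++ B).length (by rw [← hn, hw]; simp) ⟨A ++ B, hword, hpl⟩
      (fun q hq => hcl q (hsub.subset hq))
      (fun q r h => hcr q r ⟨h.1.mono hsub, h.2.1.mono hsub, h.2.2.mono hsub⟩) rfl
    refine Relation.EqvGen.trans _ _ _ (Relation.EqvGen.symm _ _ (Relation.EqvGen.rel _ _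
      ⟨fun q hq => hcl q (hsub.subset hq), hcl, ?_⟩)) hE
    rw [hw]
    exact Step.omega1 A B p.label p.ltr p.type

/-! ### Isolated chords of positive or negative diagrams -/

/-- The chords of `p` and `q` cross; the condition does not depend on the base point. -/
def Linked (w : List Passage) (p q : Passage) : Prop :=
  Interlaced w p q ∨ Interlaced w q p.mate ∨ Interlaced w p.mate q.mate ∨ Interlaced w q.mate p

/-- Since passages do not repeat, the three order relations merge into a single sublist. In this
form a rotation only has to split a list of four. -/
theorem Interlaced.sublist {w : List Passage} {p q : Passage} (hw : w.Nodup)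
    (h : Interlaced w p q) : [p, q, p.mate, q.mate].Sublist w := by
  obtain ⟨h1, h2, h3⟩ := h
  obtain ⟨X, Y, Z, rfl⟩ := before_iff_exists.1 h2
  simp only [List.nodup_append, List.nodup_cons, List.mem_append, List.mem_cons] at hw
  have l1 := fun h : Before Y p q => h.right_mem
  have l2 := fun h : Before Z p q => h.right_mem
  have l3 := fun h : Before X p q => h.right_mem
  have l4 := fun h : Before Y p.mate q.mate => h.left_mem
  have l5 := fun h : Before X p.mate q.mate => h.left_mem
  have l6 := fun h : Before Z p.mate q.mate => h.left_mem
  have hp : p ∈ X := by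
    simp only [before_append, before_cons, List.mem_cons] at h1
    grind
  have hq : q.mate ∈ Z := by
    simp only [before_append, before_cons, List.mem_cons, List.mem_append] at h3
    grind
  have e : [p, q, p.mate, q.mate] = [p] ++ q :: [] ++ p.mate :: [q.mate] := rfl
  rw [e]
  gcongr
  · simpa using hp
  · simp
  · simpa using hq

theorem interlaced_of_sublist {w : List Passage} {p q : Passage}
    (h : [p, q, p.mate, q.mate].Sublist w) : Interlaced w p q := by
  refine ⟨List.Sublist.trans ?_ h, List.Sublist.trans ?_ h, List.Sublist.trans ?_ h⟩
  · simp
  · exact List.Sublist.cons _ (by simp)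
  · exact List.Sublist.cons _ (List.Sublist.cons _ (List.Sublist.refl _))

/-- The rotation cuts the alternating quadruple at one of its gaps, and each cut yields one of the
four cyclic readings in `Linked`. -/
theorem linked_rotate {A B : List Passage} {p q : Passage} (hw : (A ++ B).Nodup)
    (h : Linked (A ++ B) p q) : Linked (B ++ A) p q := by
  have key : ∀ p q, Interlaced (A ++ B) p q → Linked (B ++ A) p q := by
    intro p q h
    obtain ⟨l, r, hlr, hl, hr⟩ := List.sublist_append_iff.1 (h.sublist hw)
    have hsub := hr.append hl
    unfold Linked
    rcases l with _ | ⟨a, _ | ⟨b, _ | ⟨c, _ | ⟨d, l⟩⟩⟩⟩ <;>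
      simp only [List.nil_append, List.cons_append, List.cons.injEq] at hlr
    · subst hlr
      exact Or.inl (interlaced_of_sublist (by simpa using hsub))
    · obtain ⟨rfl, rfl⟩ := hlr
      exact Or.inr (Or.inl (interlaced_of_sublist (by simpa using hsub)))
    · obtain ⟨rfl, rfl, rfl⟩ := hlr
      exact Or.inr (Or.inr (Or.inl (interlaced_of_sublist (by simpa using hsub))))
    · obtain ⟨rfl, rfl, rfl, rfl⟩ := hlr
      exact Or.inr (Or.inr (Or.inr (interlaced_of_sublist (by simpa using hsub))))
    · obtain ⟨rfl, rfl, rfl, rfl, hlr⟩ := hlr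
      obtain ⟨rfl, rfl⟩ := List.append_eq_nil_iff.1 hlr.symm
      exact Or.inl (interlaced_of_sublist (by simpa using hsub))
  unfold Linked at h
  rcases h with h | h | h | h
  · exact key _ _ h
  · have := key _ _ h
    unfold Linked at this ⊢
    simp only [Passage.mate_mate] at this
    tauto
  · have := key _ _ h
    unfold Linked at this ⊢
    simp only [Passage.mate_mate] at this
    tauto
  · have := key _ _ h
    unfold Linked at this ⊢
    simp only [Passage.mate_mate] at this
    tauto

theorem Interlaced.exists_rotate {w : List Passage} {p q : Passage} (hw : w.Nodup)
    (h : Interlaced w p q) : ∃ A B, w = A ++ B ∧ Interlaced (B ++ A) q p.mate := by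
  have hs := h.sublist hw
  obtain ⟨l, r, rfl, hl, hr⟩ := List.cons_sublist_iff.1 hs
  refine ⟨l, r, rfl, interlaced_of_sublist ?_⟩
  have : [q, p.mate, q.mate, p.mate.mate] = [q, p.mate, q.mate] ++ [p] := by simp
  rw [this]
  exact hr.append (by simpa using hl)

/-- Exchange of over and under at the crossings with labels in `S`. -/
def Passage.switch (S : Finset ℕ) (p : Passage) : Passage :=
  if p.label ∈ S then { p with type := p.type.flip } else p

theorem Passage.switch_switch (S : Finset ℕ) (p : Passage) : (p.switch S).switch S = p := by
  obtain ⟨x, b, t⟩ := p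
  by_cases h : x ∈ S <;> cases t <;> simp [Passage.switch, h, CrossingType.flip]

theorem Passage.switch_mate (S : Finset ℕ) (p : Passage) : (p.switch S).mate = p.mate.switch S := by
  obtain ⟨x, b, t⟩ := p
  by_cases h : x ∈ S <;> simp [Passage.switch, h, Passage.mate]

theorem interlaced_switch (S : Finset ℕ) {w : List Passage} {p q : Passage} :
    Interlaced (w.map (Passage.switch S)) (p.switch S) (q.switch S) ↔ Interlaced w p q := by
  have hf : Function.Injective (Passage.switch S) :=
    Function.LeftInverse.injective (Passage.switch_switch S)
  unfold Interlaced
  rw [Passage.switch_mate, Passage.switch_mate, before_map hf, before_map hf, before_map hf]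

theorem isRotated_iff_exists {α : Type*} {v w : List α} :
    v ~r w ↔ ∃ A B, v = A ++ B ∧ w = B ++ A := by
  constructor
  · rintro ⟨n, rfl⟩
    refine ⟨v.take (n % v.length), v.drop (n % v.length), (List.take_append_drop _ _).symm, ?_⟩
    exact List.rotate_eq_drop_append_take_mod
  · rintro ⟨A, B, rfl, rfl⟩
    exact List.isRotated_append

theorem Linked.of_isRotated {v w : List Passage} {p q : Passage} (h : Linked v p q)
    (hv : v.Nodup) (hr : v ~r w) : Linked w p q := by
  obtain ⟨A, B, rfl, rfl⟩ := isRotated_iff_exists.1 hr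
  exact linked_rotate hv h

/-- If switching a crossing whose chord is isolated in a positive or negative diagram yields the
trivial knot, then the diagram was trivial before. -/
theorem Diagram.isTrivial_of_switch {K : Diagram} (hcl : K.IsClassical)
    (hsign : K.IsPositive ∨ K.IsNegative) {c : Passage}
    (hiso : ∀ p q, p.label = c.label → ¬ Linked K.word p q) (ht : (K.switch {c}).IsTrivial) :
    K.IsTrivial := by
  have hW := K.isWord
  obtain ⟨s, hs⟩ : ∃ s : ℤ, s * s = 1 ∧ ∀ p ∈ K.word, sign p = s := by
    rcases hsign with h | h
    · exact ⟨1, by norm_num, fun p hp => by simp [sign, h p hp]⟩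
    · exact ⟨-1, by norm_num, fun p hp => by simp [sign, h p hp]⟩
  have hsw : (K.switch {c}).word = K.word.map (Passage.switch {c.label}) := by
    show List.map _ _ = _
    simp only [Finset.image_singleton]
    rfl
  have hcl' : (K.switch {c}).IsClassical := by
    intro p hp
    rw [hsw] at hp
    obtain ⟨q, hq, rfl⟩ := List.mem_map.1 hp
    have := hcl q hq
    unfold Passage.switch
    split_ifs
    · cases h : q.type <;> simp_all [CrossingType.flip]
    · exact this
  have h0 : casson (K.switch {c}).word = 0 := by
    rw [casson_eq_of_classicallyEquivalent ht]; rfl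
  have hW' := (K.switch {c}).isWord
  have hP' := (K.switch {c}).planar
  rw [hsw] at h0 hW' hP'
  have hcl'' : ∀ p ∈ K.word.map (Passage.switch {c.label}), p.type ≠ .virt := by
    rw [← hsw]; exact hcl'
  -- The sum is zero from every base point, so the positivity argument below applies to each
  -- rotation separately.
  have hrot : ∀ w, K.word ~r w → casson (w.map (Passage.switch {c.label})) = 0 := by
    intro w hw
    obtain ⟨A, B, hAB, rfl⟩ := isRotated_iff_exists.1 hw
    rw [hAB, List.map_append] at h0 hW' hP' hcl''
    rw [List.map_append, casson_rotate hW' hcl'' (fun q hq => wordIndex_eq_zero hW' hP' hcl'' hq), h0]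
  have hterm : ∀ w, K.word ~r w → ∀ p ∈ w, ∀ q ∈ w,
      p.IsOver → ¬ q.IsOver → ¬ Interlaced w p q := by
    intro w hw p hp q hq hpo hqo hI
    have hr := hrot w hw
    have hinj : Function.Injective (Passage.switch {c.label}) :=
      Function.LeftInverse.injective (Passage.switch_switch _)
    have hset : (w.map (Passage.switch {c.label})).toFinset = w.toFinset.map ⟨_, hinj⟩ := by
      ext p; simp
    have hlab : ∀ p q, Interlaced w p q → p.label ≠ c.label ∧ q.label ≠ c.label := by
      intro p q h
      have hL : Linked K.word p q := Linked.of_isRotated (Or.inl h)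
        (hw.nodup_iff.1 hW.nodup) hw.symm
      refine ⟨fun h1 => hiso p q h1 hL, fun h1 => hiso q p.mate h1 ?_⟩
      unfold Linked at hL ⊢
      simp only [Passage.mate_mate]
      tauto
    have hsame : ∀ p : Passage, p.label ≠ c.label → p.switch {c.label} = p := by
      intro p h
      simp [Passage.switch, h]
    -- An interlaced pair avoids the isolated crossing, so switching does not affect it, and its two
    -- equal signs multiply to `1`. A vanishing sum of such terms has no nonzero term.
    have hval : ∀ p ∈ w, ∀ q ∈ w, cassonTerm (w.map (Passage.switch {c.label}))
        (p.switch {c.label}) (q.switch {c.label}) =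
          if p.IsOver ∧ ¬ q.IsOver ∧ Interlaced w p q then 1 else 0 := by
      intro p hp q hq
      unfold cassonTerm
      simp only [interlaced_switch]
      by_cases h : Interlaced w p q
      · obtain ⟨h1, h2⟩ := hlab p q h
        rw [hsame p h1, hsame q h2, hs.2 p (hw.mem_iff.2 hp), hs.2 q (hw.mem_iff.2 hq), hs.1]
      · simp [h]
    unfold casson at hr
    rw [hset, Finset.sum_map] at hr
    have hnn : ∀ p ∈ w.toFinset, 0 ≤ ∑ q ∈ w.toFinset.map ⟨_, hinj⟩,
        cassonTerm (w.map (Passage.switch {c.label})) (p.switch {c.label}) q := by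
      intro p hp
      rw [Finset.sum_map]
      refine Finset.sum_nonneg fun q hq => ?_
      show 0 ≤ cassonTerm _ _ (q.switch _)
      rw [hval p (by simpa using hp) q (by simpa using hq)]
      split_ifs <;> norm_num
    have h1 := (Finset.sum_eq_zero_iff_of_nonneg hnn).1 hr p (by simpa using hp)
    rw [Finset.sum_map] at h1
    have h2 := (Finset.sum_eq_zero_iff_of_nonneg (fun r hr => ?_)).1 h1 q (by simpa using hq)
    · have h3 := hval p hp q hq
      rw [if_pos ⟨hpo, hqo, hI⟩] at h3
      have h4 : (0 : ℤ) = 1 := h2.symm.trans h3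
      norm_num at h4
    · show 0 ≤ cassonTerm _ _ (r.switch _)
      rw [hval p hp r (by simpa using hr)]
      split_ifs <;> norm_num
  have hnext : ∀ w p q, K.word ~r w → Interlaced w p q →
      ∃ w', K.word ~r w' ∧ Interlaced w' q p.mate := by
    intro w p q hw h
    obtain ⟨A, B, rfl, h'⟩ := h.exists_rotate (hw.nodup_iff.1 hW.nodup)
    exact ⟨_, hw.trans List.isRotated_append, h'⟩
  refine K.isTrivial_of_not_interlaced hcl fun p q h => ?_
  have hp : p ∈ K.word := h.1.left_mem
  have hq : q ∈ K.word := h.1.right_mem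
  have hpm := isOver_mate (hcl p hp)
  have hqm := isOver_mate (hcl q hq)
  have mem : ∀ w p, K.word ~r w → p ∈ K.word → p ∈ w := fun w p h hp => h.mem_iff.1 hp
  have hp' := hW.2 p hp
  have hq' := hW.2 q hq
  -- Place the base point in turn before each of the four alternating passages. Each chord has one
  -- over- and one under-passage, so somewhere in the cyclic order an over-passage is followed by an
  -- under-passage, and from there the pair contributes.
  obtain ⟨w₁, hw₁, h₁⟩ := hnext _ _ _ (List.IsRotated.refl _) h
  obtain ⟨w₂, hw₂, h₂⟩ := hnext _ _ _ hw₁ h₁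
  obtain ⟨w₃, hw₃, h₃⟩ := hnext _ _ _ hw₂ h₂
  rw [Passage.mate_mate] at h₃
  by_cases hpo : p.IsOver <;> by_cases hqo : q.IsOver
  · exact hterm w₁ hw₁ _ (mem _ _ hw₁ hq) _ (mem _ _ hw₁ hp') hqo (fun h => hpm.1 h hpo) h₁
  · exact hterm _ (List.IsRotated.refl _) p hp q hq hpo hqo h
  · exact hterm w₂ hw₂ _ (mem _ _ hw₂ hp') _ (mem _ _ hw₂ hq') (hpm.2 hpo) (fun h => hqm.1 h hqo) h₂
  · exact hterm w₃ hw₃ _ (mem _ _ hw₃ hq') _ (mem _ _ hw₃ hp) (hqm.2 hqo) hpo h₃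

/-! ### The writhe polynomial of the virtualization -/

/-- Evaluation at `t = 1` gives `2a`. -/
theorem laurent_ne_zero {a : ℤ} (ha : a ≠ 0) :
    (LaurentPolynomial.C a * LaurentPolynomial.T 2 +
      LaurentPolynomial.C a * LaurentPolynomial.T (-2) : ℤ[T;T⁻¹]) ≠ 0 := by
  intro h
  have := congrArg (LaurentPolynomial.eval₂ (RingHom.id ℤ) 1) h
  simp at this
  omega

theorem Diagram.index_eq_zero (D : Diagram) (hcl : D.IsClassical) {c : Passage} (hc : c ∈ D.word) :
    wordIndex D.word c = 0 :=
  wordIndex_eq_zero D.isWord D.planar hcl hc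

theorem Diagram.wordPolynomial_eq_zero (D : Diagram) (hcl : D.IsClassical) :
    wordPolynomial D.word = 0 := by
  unfold wordPolynomial
  refine List.sum_eq_zero fun x hx => ?_
  obtain ⟨c, hc, rfl⟩ := List.mem_map.1 hx
  rw [D.index_eq_zero hcl hc, writheTerm_zero]

theorem flatMap_eq_self {w : List Passage} {x n : ℕ} {anti : Bool}
    (h : ∀ p ∈ w, p.label ≠ x) : w.flatMap (virtualizePassage x n anti) = w := by
  have : ∀ p ∈ w, virtualizePassage x n anti p = [p] := fun p hp => by
    simp [virtualizePassage, h p hp]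
  rw [List.flatMap_congr this, List.flatMap_singleton']

/-- The real crossing that replaces the crossing of `c` in the virtualization. -/
def Passage.reverse (c : Passage) : Passage := ⟨c.label, !c.ltr, c.type.flip⟩

theorem Passage.reverse_mate (c : Passage) : c.mate.reverse = c.reverse.mate := rfl

/-- The over-strand stays over while the sign changes, so the crossing direction and hence the jump
are reversed. This is the whole effect of virtualization on the numbering. -/
theorem Passage.jump_reverse (c : Passage) : c.reverse.jump = -c.jump := jump_flip

/-- The flanking crossings have zero jump and no term in the polynomial, so nothing but their being
virtual has to be recorded, and both placements are treated at once. -/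
theorem virtualizePassage_eq (c : Passage) (n : ℕ) (anti : Bool) :
    ∃ v v' : Passage, v.type = .virt ∧ v'.type = .virt ∧
      virtualizePassage c.label n anti c = [v, c.reverse, v'] := by
  unfold virtualizePassage
  rw [if_pos rfl]
  split_ifs <;> exact ⟨_, _, rfl, rfl, rfl⟩

theorem writheTerm_virt {v : Passage} (hv : v.type = .virt) (k : ℤ) : writheTerm v k = 0 := by
  have : ¬ v.IsOver := by simp [Passage.IsOver, hv]
  simp [writheTerm, this]

theorem jump_virt {v : Passage} (hv : v.type = .virt) : v.jump = 0 := by simp [Passage.jump, hv]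

/-- The effect of a virtualization on the writhe polynomial of a word with indices `0`. -/
theorem wordPolynomial_virtualize {c v₁ v₂ v₃ v₄ : Passage} {R L : List Passage}
    (hT : IsWord (c :: R ++ c.mate :: L)) (hv₁ : v₁.type = .virt) (hv₂ : v₂.type = .virt)
    (hv₃ : v₃.type = .virt) (hv₄ : v₄.type = .virt)
    (hcl : ∀ p ∈ c :: R ++ c.mate :: L, p.type ≠ .virt)
    (hlab : ∀ p ∈ R ++ L, p.label ≠ c.label)
    (h0 : ∀ p ∈ c :: R ++ c.mate :: L, wordIndex (c :: R ++ c.mate :: L) p = 0) :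
    wordPolynomial ([v₁, c.reverse, v₂] ++ R ++ [v₃, c.reverse.mate, v₄] ++ L) =
      (R.map fun d => if d.mate ∈ L then writheTerm d (2 * c.jump) else 0).sum +
        (L.map fun d => if d.mate ∈ R then writheTerm d (-(2 * c.jump)) else 0).sum := by
  have hnd := hT.nodup
  have hR0 : totalJump R = 0 := by
    rw [← VirtualKnot.wordIndex_eq_totalJump hnd]
    exact h0 c (by simp)
  have hct : c.reverse.type ≠ .virt := by
    have := hcl c (by simp)
    cases h : c.type <;> simp_all [Passage.reverse, CrossingType.flip]
  have hne : ∀ v : Passage, v.type = .virt → v ≠ c.reverse ∧ v ≠ c.reverse.mate := by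
    intro v hv
    exact ⟨fun h => hct (h ▸ hv), fun h => hct ((congrArg Passage.type h).symm.trans hv)⟩
  have hrR : ∀ p ∈ R ++ L, ∀ q : Passage, q = c.reverse ∨ q = c.reverse.mate ∨ q.type = .virt →
      p ≠ q := by
    rintro p hp q hq rfl
    have h1 := hlab p hp
    have h2 := hcl p (by simp only [List.mem_append, List.mem_cons] at hp ⊢; tauto)
    rcases hq with rfl | rfl | hq
    · exact h1 rfl
    · exact h1 rfl
    · exact h2 hq
  have hdisj : ∀ p ∈ R, p ∉ L := by
    intro p hp hp'
    simp only [List.nodup_append, List.nodup_cons, List.mem_cons] at hnd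
    exact hnd.2.2 p (Or.inr hp) p (Or.inr hp') rfl
  have hc : ∀ p ∈ R ++ L, p ≠ c ∧ p ≠ c.mate := by
    intro p hp
    exact ⟨fun h => hlab p hp (h ▸ rfl), fun h => hlab p hp (h ▸ rfl)⟩
  have hmate : ∀ p ∈ R ++ L, p.mate ∈ R ++ L := by
    intro p hp
    have := hT.2 p (by simp only [List.mem_append, List.mem_cons] at hp ⊢; tauto)
    have h1 : p.mate ≠ c := fun h => (hc p hp).2 (Passage.mate_eq_iff.1 h)
    have h2 : p.mate ≠ c.mate := fun h => (hc p hp).1 (Passage.mate_injective h)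
    simp only [List.mem_append, List.mem_cons, h1, h2] at this ⊢
    tauto
  have hlevT : ∀ p ∈ R ++ L, level (c :: R ++ c.mate :: L) p =
      if p ∈ R then c.jump + level R p else level L p := by
    intro p hp
    obtain ⟨h1, h2⟩ := hc p hp
    rw [level_append, level_cons, level_cons]
    simp only [List.mem_cons, h1, false_or, Ne.symm h1, Ne.symm h2, if_false, totalJump_cons, hR0,
      Passage.jump_mate]
    split_ifs <;> ring
  -- Compared with `hlevT`, the levels on `R` move by `-2 * c.jump`; on `L` they stay, since the two
  -- passages of the crossing cancel.
  have hlevV : ∀ p ∈ R ++ L, level ([v₁, c.reverse, v₂] ++ R ++ [v₃, c.reverse.mate, v₄] ++ L) p =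
      if p ∈ R then -c.jump + level R p else level L p := by
    intro p hp
    have e1 := hrR p hp c.reverse (by simp)
    have e2 := hrR p hp c.reverse.mate (by simp)
    have e3 := hrR p hp v₁ (by simp [hv₁])
    have e4 := hrR p hp v₂ (by simp [hv₂])
    have e5 := hrR p hp v₃ (by simp [hv₃])
    have e6 := hrR p hp v₄ (by simp [hv₄])
    simp only [level_append, List.mem_append, List.mem_cons, List.not_mem_nil, e1, e2, e3, e4, e5,
      e6, false_or, or_false, if_false, totalJump_append, totalJump_cons, totalJump_nil, hR0,
      jump_virt hv₁, jump_virt hv₂, jump_virt hv₃, jump_virt hv₄, Passage.jump_mate,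
      Passage.jump_reverse]
    split_ifs <;> ring
  -- The old index is zero, so only the shift survives, and it survives exactly for chords with one
  -- end in `R` and the other in `L`.
  have hidx : ∀ p ∈ R ++ L, wordIndex ([v₁, c.reverse, v₂] ++ R ++ [v₃, c.reverse.mate, v₄] ++ L) p =
      2 * c.jump * ((if p ∈ R then 1 else 0) - (if p.mate ∈ R then 1 else 0)) := by
    intro p hp
    have h1 := h0 p (by simp only [List.mem_append, List.mem_cons] at hp ⊢; tauto)
    unfold wordIndex at h1 ⊢
    rw [hlevT p hp, hlevT _ (hmate p hp)] at h1
    rw [hlevV p hp, hlevV _ (hmate p hp)]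
    split_ifs at h1 ⊢ <;> linarith
  have hcV : wordIndex ([v₁, c.reverse, v₂] ++ R ++ [v₃, c.reverse.mate, v₄] ++ L) c.reverse = 0 := by
    have n1 := (hne v₁ hv₁).1
    have n2 := (hne v₂ hv₂).2
    have n3 := (hne v₃ hv₃).2
    have n4 := (hne v₁ hv₁).2
    have n5 := c.reverse.mate_ne
    have n6 : c.reverse.mate ∉ R := fun h => hrR _ (List.mem_append_left _ h) c.reverse.mate (by simp) rfl
    simp [wordIndex, level_append, level_cons, n1, n2, n3, n4, 
      n5.symm, n6, hR0, jump_virt hv₁, jump_virt hv₂, jump_virt hv₃]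
  have hcVm : wordIndex ([v₁, c.reverse, v₂] ++ R ++ [v₃, c.reverse.mate, v₄] ++ L)
      c.reverse.mate = 0 := by rw [wordIndex_mate, hcV, neg_zero]
  have eR : ∀ d ∈ R, writheTerm d (wordIndex ([v₁, c.reverse, v₂] ++ R ++
      [v₃, c.reverse.mate, v₄] ++ L) d) = if d.mate ∈ L then writheTerm d (2 * c.jump) else 0 := by
    intro d hd
    have h1 := hmate d (by simp [hd])
    rw [hidx d (by simp [hd]), if_pos hd]
    by_cases h : d.mate ∈ R
    · simp [h, hdisj _ h]
    · have h2 : d.mate ∈ L := (List.mem_append.1 h1).resolve_left h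
      simp [h, h2]
  have eL : ∀ d ∈ L, writheTerm d (wordIndex ([v₁, c.reverse, v₂] ++ R ++
      [v₃, c.reverse.mate, v₄] ++ L) d) = if d.mate ∈ R then writheTerm d (-(2 * c.jump)) else 0 := by
    intro d hd
    have h1 := hmate d (by simp [hd])
    have h2 : d ∉ R := fun h => hdisj d h hd
    rw [hidx d (by simp [hd]), if_neg h2]
    by_cases h : d.mate ∈ R <;> simp [h]
  unfold wordPolynomial
  generalize wordIndex ([v₁, c.reverse, v₂] ++ R ++ [v₃, c.reverse.mate, v₄] ++ L) = F at *
  rw [List.map_append, List.map_append, List.map_append, List.sum_append, List.sum_append,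
    List.sum_append, List.map_congr_left eR, List.map_congr_left eL]
  simp [hcV, hcVm, writheTerm_virt hv₁, writheTerm_virt hv₂, writheTerm_virt hv₃,
    writheTerm_virt hv₄]

theorem Diagram.writhePolynomial_virtualize (K : Diagram) (hcl : K.IsClassical) {c : Passage}
    (hc : c ∈ K.chords) (anti : Bool) :
    (K.virtualize c anti).writhePolynomial =
      LaurentPolynomial.C (∑ d ∈ K.rightward c, sign d) * LaurentPolynomial.T 2 +
        LaurentPolynomial.C (∑ d ∈ K.rightward c, sign d) * LaurentPolynomial.T (-2) := by
  obtain ⟨hcw, hco⟩ := mem_chords.1 hc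
  obtain ⟨A, B, hAB, hBA⟩ := K.exists_arcs hcw
  -- The chord `c` has index zero in the classical diagram `K`; this makes the two coefficients
  -- equal.
  have hsum : ∑ d ∈ K.leftward c, sign d = ∑ d ∈ K.rightward c, sign d := by
    have := K.index_eq_sum_sign c
    rw [K.index_eq_wordIndex hcw, K.index_eq_zero hcl hcw] at this
    linarith
  have hW := K.isWord
  have hperm : K.word.Perm (c :: K.rightArc c ++ c.mate :: K.leftArc c) := by
    rw [← hBA, hAB]; exact List.perm_append_comm
  have hT := hW.perm hperm
  have hTcl : ∀ p ∈ c :: K.rightArc c ++ c.mate :: K.leftArc c, p.type ≠ .virt :=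
    fun p hp => hcl p (hperm.mem_iff.2 hp)
  have h0 : ∀ p ∈ c :: K.rightArc c ++ c.mate :: K.leftArc c,
      wordIndex (c :: K.rightArc c ++ c.mate :: K.leftArc c) p = 0 := by
    intro p hp
    have hp' := hperm.mem_iff.2 hp
    have h1 := K.index_eq_zero hcl hp'
    rw [hAB] at hW hp' h1
    rw [← hBA, wordIndex_rotate hW hp', h1]
  obtain ⟨hmem, ⟨c1, c2, c3, c4⟩, hR, hL, hdisj⟩ := K.mem_arcs hcw
  have hlab : ∀ p ∈ K.rightArc c ++ K.leftArc c, p.label ≠ c.label := by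
    intro p hp h
    have hp' := (hmem p).2 (by rw [List.mem_append] at hp; tauto)
    rcases hW.eq_or_eq_mate hp' hcw h with rfl | rfl
    · simp [c1, c2] at hp
    · simp [c3, c4] at hp
  rw [writhePolynomial_eq]
  have hV : (K.virtualize c anti).word = A.flatMap (virtualizePassage c.label (freshLabel K.word) anti) ++
      B.flatMap (virtualizePassage c.label (freshLabel K.word) anti) := by
    show virtualizeWord _ _ _ = _
    unfold virtualizeWord
    conv_lhs => rw [hAB]
    rw [List.flatMap_append, ← hAB]
  have hVW := (K.virtualize c anti).isWord
  rw [hV] at hVW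
  rw [hV, ← wordPolynomial_rotate hVW, ← List.flatMap_append, hBA]
  obtain ⟨v₁, v₂, hv₁, hv₂, hv⟩ := virtualizePassage_eq c (freshLabel K.word) anti
  obtain ⟨v₃, v₄, hv₃, hv₄, hv'⟩ := virtualizePassage_eq c.mate (freshLabel K.word) anti
  rw [List.flatMap_append, List.flatMap_cons, List.flatMap_cons, hv,
    flatMap_eq_self fun p hp => hlab p (List.mem_append_left _ hp),
    flatMap_eq_self fun p hp => hlab p (List.mem_append_right _ hp)]
  rw [Passage.mate_label] at hv'
  rw [hv', Passage.reverse_mate, ← List.append_assoc,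
    wordPolynomial_virtualize hT hv₁ hv₂ hv₃ hv₄ hTcl hlab h0]
  have hj : c.jump = 1 ∨ c.jump = -1 := by
    rw [hco.jump]
    unfold sign
    split_ifs <;> simp
  have hterm : ∀ (d : Passage) (k : ℤ), k ≠ 0 → writheTerm d k =
      if d.IsOver then LaurentPolynomial.C (sign d) * LaurentPolynomial.T k else 0 := by
    intro d k hk
    simp [writheTerm, hk]
  have hj2 : 2 * c.jump ≠ 0 := by rcases hj with h | h <;> rw [h] <;> norm_num
  have hj3 : -(2 * c.jump) ≠ 0 := neg_ne_zero.2 hj2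
  -- Only over-passages count, and an over-passage on the right arc whose mate is on the left arc is
  -- the tail of a leftward chord.
  have eR : ((K.rightArc c).map fun d =>
      if d.mate ∈ K.leftArc c then writheTerm d (2 * c.jump) else 0).sum =
      LaurentPolynomial.C (∑ d ∈ K.leftward c, sign d) * LaurentPolynomial.T (2 * c.jump) := by
    rw [← List.sum_toFinset _ hR, map_sum, Finset.sum_mul]
    simp only [hterm _ _ hj2, ← ite_and]
    rw [← Finset.sum_filter]
    refine Finset.sum_congr ?_ fun _ _ => rfl
    ext d
    simp only [leftward, Finset.mem_filter, List.mem_toFinset, mem_chords]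
    have := hmem d
    tauto
  have eL : ((K.leftArc c).map fun d =>
      if d.mate ∈ K.rightArc c then writheTerm d (-(2 * c.jump)) else 0).sum =
      LaurentPolynomial.C (∑ d ∈ K.rightward c, sign d) * LaurentPolynomial.T (-(2 * c.jump)) := by
    rw [← List.sum_toFinset _ hL, map_sum, Finset.sum_mul]
    simp only [hterm _ _ hj3, ← ite_and]
    rw [← Finset.sum_filter]
    refine Finset.sum_congr ?_ fun _ _ => rfl
    ext d
    simp only [rightward, Finset.mem_filter, List.mem_toFinset, mem_chords]
    have := hmem d
    tauto
  rw [eR, eL, hsum]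
  -- The sign of `c` decides which direction gets exponent `2`; as the coefficients agree, the
  -- polynomial is the same.
  rcases hj with h | h <;> rw [h] <;> norm_num [add_comm]

/-- Read the word from `c` on: a chord linked with `c` has one end on each arc, and since it has an
over-end it is directed either rightward or leftward. -/
theorem Diagram.not_linked_of_isolated (K : Diagram) (hcl : K.IsClassical) {c : Passage}
    (hc : c ∈ K.word) (hr : K.rightward c = ∅) (hl : K.leftward c = ∅) {p q : Passage}
    (hp : p.label = c.label) : ¬ Linked K.word p q := by
  intro h
  obtain ⟨A, B, hAB, hBA⟩ := K.exists_arcs hc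
  obtain ⟨hmem, ⟨c1, c2, c3, c4⟩, hR, hL, hdisj⟩ := K.mem_arcs hc
  have hW := K.isWord
  have hpm : p ∈ K.word := by
    rcases h with h | h | h | h
    · exact h.1.left_mem
    · exact hW.mate_mem_iff.1 h.1.right_mem
    · exact hW.mate_mem_iff.1 h.1.left_mem
    · exact h.1.right_mem
  have hrot : K.word ~r (c :: K.rightArc c ++ c.mate :: K.leftArc c) := by
    rw [← hBA, hAB]; exact List.isRotated_append
  have hT := Linked.of_isRotated h hW.nodup hrot
  have hnd := hrot.nodup_iff.1 hW.nodup
  have hsep : ∀ q, q ∈ K.rightArc c → q.mate ∈ K.leftArc c → False := by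
    intro q h1 h2
    have hq : q ∈ K.word := (hmem q).2 (by tauto)
    by_cases hqo : q.IsOver
    · have : q ∈ K.leftward c := Finset.mem_filter.2 ⟨mem_chords.2 ⟨hq, hqo⟩, h1, h2⟩
      simp [hl] at this
    · have : q.mate ∈ K.rightward c := Finset.mem_filter.2
        ⟨mem_chords.2 ⟨hW.2 q hq, (isOver_mate (hcl q hq)).2 hqo⟩, h2, by simpa using h1⟩
      simp [hr] at this
  have hfirst : ∀ x, ¬ Before (c :: K.rightArc c ++ c.mate :: K.leftArc c) x c := by
    intro x hx
    by_cases hxc : x = c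
    · exact hx.ne hnd hxc
    · rw [List.cons_append] at hx hnd
      refine before_asymm hnd hx (before_cons.2 (Or.inl ⟨rfl, ?_⟩))
      exact (List.mem_cons.1 hx.left_mem).resolve_left hxc
  have hI : ∀ q, ¬ Interlaced (c :: K.rightArc c ++ c.mate :: K.leftArc c) c q := by
    rintro q ⟨h1, h2, h3⟩
    have n1 := h1.ne hnd
    have n2 := h2.ne hnd
    have n3 := h3.ne hnd
    have l1 := fun h : Before (K.leftArc c) q c.mate => h.right_mem
    have l2 := fun h : Before (K.rightArc c) q c.mate => h.right_mem
    have l3 := fun h : Before (K.leftArc c) c.mate q.mate => h.left_mem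
    have l4 := fun h : Before (K.rightArc c) c.mate q.mate => h.left_mem
    apply hsep q
    · simp only [before_append, before_cons, List.mem_cons] at h2
      grind
    · simp only [before_append, before_cons, List.mem_cons] at h3
      grind [Passage.mate_ne]
  unfold Linked at hT
  rcases hW.eq_or_eq_mate hpm hc hp with rfl | rfl
  all_goals
    simp only [Interlaced, Passage.mate_mate] at hT hI
    rcases hT with h | h | h | h
    all_goals
      first
        | exact hI q h
        | exact hI q.mate (by simpa using h)
        | exact hfirst _ h.1
        | exact hfirst _ h.2.1
        | exact hfirst _ h.2.2

/-- With all signs equal there is no cancellation: a vanishing sum means no rightward chords and, as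
`c` has index zero, no leftward ones. Then `c` is isolated and `K` would already be trivial. -/
theorem Diagram.sum_sign_ne_zero (K : Diagram) (hcl : K.IsClassical)
    (hsign : K.IsPositive ∨ K.IsNegative) (hu : ¬ K.IsTrivial) {c : Passage}
    (hc : K.IsUnknottingCrossing c) : ∑ d ∈ K.rightward c, sign d ≠ 0 := by
  intro h
  obtain ⟨hcw, hco⟩ := mem_chords.1 hc.1
  have hsum : ∑ d ∈ K.leftward c, sign d = 0 := by
    have := K.index_eq_sum_sign c
    rw [K.index_eq_wordIndex hcw, K.index_eq_zero hcl hcw] at this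
    linarith
  obtain ⟨s, hs0, hs⟩ : ∃ s : ℤ, s ≠ 0 ∧ ∀ p ∈ K.word, sign p = s := by
    rcases hsign with h | h
    · exact ⟨1, by norm_num, fun p hp => by simp [sign, h p hp]⟩
    · exact ⟨-1, by norm_num, fun p hp => by simp [sign, h p hp]⟩
  have hempty : ∀ t ⊆ K.chords, ∑ d ∈ t, sign d = 0 → t = ∅ := by
    intro t ht h
    rw [Finset.sum_congr rfl fun d hd => hs d (mem_chords.1 (ht hd)).1, Finset.sum_const,
      smul_eq_zero, Finset.card_eq_zero] at h
    exact h.resolve_right hs0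
  exact hu (K.isTrivial_of_switch hcl hsign (fun p q hp => K.not_linked_of_isolated hcl hcw
    (hempty _ (Finset.filter_subset _ _) h) (hempty _ (Finset.filter_subset _ _) hsum) hp) hc.2)

theorem Diagram.switch_empty (K : Diagram) : K.switch ∅ = K := by
  have : (K.switch ∅).word = K.word := by
    show List.map _ _ = _
    simp
  obtain ⟨w, h1, h2⟩ := K
  simp only [switch] at this ⊢
  congr

end VirtualKnot

/-! ### Proof of the proposition -/

theorem proposition2p3 (K : VirtualKnot.Diagram) (hclassical : K.IsClassical)
    (hsign : K.IsPositive ∨ K.IsNegative) (hu : K.unknottingNumber = 1) :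
    (∃ c, K.IsUnknottingCrossing c) ∧
      ∀ c, K.IsUnknottingCrossing c → ∀ anti : Bool,
        (K.virtualize c anti).IsNonClassical ∧
        ∃ a : ℤ, a ≠ 0 ∧
          a = (K.r .positive c : ℤ) - (K.r .negative c : ℤ) ∧
          (K.virtualize c anti).writhePolynomial =
            LaurentPolynomial.C a * LaurentPolynomial.T 2 +
              LaurentPolynomial.C a * LaurentPolynomial.T (-2) := by
  -- In `ℕ` the infimum of the empty set is `0`, so the value `1` shows that some set of switches
  -- trivializes `K`.
  have hne : {n | ∃ S ⊆ K.chords, S.card = n ∧ (K.switch S).IsTrivial}.Nonempty := by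
    rw [Set.nonempty_iff_ne_empty]
    intro h
    rw [VirtualKnot.Diagram.unknottingNumber, h, Nat.sInf_empty] at hu
    exact zero_ne_one hu
  have hmem := Nat.sInf_mem hne
  rw [VirtualKnot.Diagram.unknottingNumber] at hu
  -- Otherwise the empty set of switches would give unknotting number `0`.
  have htriv : ¬ K.IsTrivial := by
    intro h
    have : sInf {n | ∃ S ⊆ K.chords, S.card = n ∧ (K.switch S).IsTrivial} ≤ 0 :=
      Nat.sInf_le ⟨∅, Finset.empty_subset _, rfl, by rwa [K.switch_empty]⟩
    omega
  rw [hu] at hmem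
  obtain ⟨S, hS, hcard, ht⟩ := hmem
  obtain ⟨c, rfl⟩ := Finset.card_eq_one.1 hcard
  refine ⟨⟨c, hS (Finset.mem_singleton_self c), ht⟩, fun c hc anti => ?_⟩
  have hW := K.writhePolynomial_virtualize hclassical hc.1 anti
  have ha := K.sum_sign_ne_zero hclassical hsign htriv hc
  -- The witness for `a` is the sum of the signs of the rightward chords of `c`. A classical diagram
  -- equivalent to the virtualization would force its nonzero writhe polynomial to vanish.
  refine ⟨fun E hE hEq => ?_, _, ha, ?_, hW⟩
  · have := VirtualKnot.wordPolynomial_eq_of_virtuallyEquivalent hEq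
    rw [E.wordPolynomial_eq_zero hE, ← VirtualKnot.Diagram.writhePolynomial_eq, hW] at this
    exact VirtualKnot.laurent_ne_zero ha this
  · rw [K.r_eq, K.r_eq]
    exact VirtualKnot.sum_sign fun d hd =>
      (VirtualKnot.Diagram.mem_chords.1 (Finset.mem_filter.1 hd).1).2
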